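/- **Setting.** Let $a<b$, $T>0$, and integers $s\ge1$, $k\ge1$. Let $u$ be a classical solution, continuous on $[a,b]\times[0,T]$, of $$\partial_tu+\partial_xu=0\ \text{ on }[a,b]\times(0,T],\qquad u(\cdot,0)=u_0,$$ with either $u(a,t)=0$ or $u(a,t)=u(b,t)$ for $0\le t\le T$. Put $\|u\|_{m,\infty}=\sup_{0\le t\le T}\|u(\cdot,t)\|_{W^{m,\infty}(a,b)}$ ($=\infty$ if $u$ is not that regular), and let $\|\cdot\|$ be the $L^2(a,b)$ norm. **Mesh.** Let $a=x_{1/2}<\dots<x_{N+1/2}=b$, $I_i=[x_{i-1/2},x_{i+1/2}]$, $h_i=|I_i|$, $h=\max_ih_i$, with $\alpha h\le\min_ih_i$ for a fixed $\alpha>0$. Let $-1=y_0<y_1<\dots<y_k<y_{k+1}=1$, where $y_1,\dots,y_k$ are either the zeros of the Legendre polynomial $L_k$ (LSV) or the zeros in $(-1,1)$ of $L_{k+1}-L_k$ (RRSV, right-Radau points), and let $x_{i,j}=\frac{h_i}{2}y_j+\frac{x_{i-1/2}+x_{i+1/2}}2$. Let $\mathcal U_h$ be the space of functions that are polynomials of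 degree at most $k$ on every $I_i$; for $v\in\mathcal U_h$ let $v_{i,j}^-$ be the left limit at $x_{i,j}$, where $v^-_{1,0}$ is $0$ (homogeneous boundary condition) or $v^-(b)$ (periodic boundary condition). **Scheme RKSV(s,k).** Let $\tau=T/M$ with an integer $M\ge1$. Let $g_{0,0}=1$ and, for $m\ge1$, $g_{m,l}=\frac1l g_{m-1,l-1}$ for $1\le l\le m-1$, $g_{m,m}=\frac1{(m+1)!}$, $g_{m,0}=1-\sum_{l=1}^mg_{m,l}$. For $0\le l,\kappa\le s-1$ let $c_{l\kappa}=d_{l\kappa}=\delta_{l\kappa}$ if $l<s-1$, and $c_{s-1,\kappa}=g_{s-1,\kappa}$, $d_{s-1,\kappa}=\delta_{s-1,\kappa}\,g_{s-1,s-1}$. The stages $u_h^{n,l}\in\mathcal U_h$ satisfy $u_h^{n,0}=u_h^n$, $u_h^{n,s}=u_h^{n+1}$ and, for $0\le l\le s-1$, $1\le i\le N$, $0\le j\le k$, $$\int_{x_{i,j}}^{x_{i,j+1}}u_h^{n,l+1}\,dx=\sum_{\kappa=0}^{l}\Big[c_{l\kappa}\int_{x_{i,j}}^{x_{i,j+1}}u_h^{n,\kappa}\,dx-\tau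 d_{l\kappa}\big((u_h^{n,\kappa})^-_{i,j+1}-(u_h^{n,\kappa})^-_{i,j}\big)\Big].$$ The initial value $u_h^0\in\mathcal U_h$ is the Lagrange interpolant of $u_0$ at the points $x_{i,j}$, $1\le j\le k+1$, or any element of $\mathcal U_h$ with $\|u_0-u_h^0\|\le C_0(h^{k+1}+\tau^s)\|u\|_{k+2,\infty}$. **Matrix transferring process.** For $\phi'=L\phi$ with $L$ linear, the Runge-Kutta method above can be written $\beta_0\phi^{n+1}=\sum_{\kappa=0}^s\beta_\kappa\mathbb E_\kappa\phi^n$, where $\mathbb E_0\phi^n=\phi^n$, $\mathbb E_\kappa\phi^n=\tau L\,\mathbb E_{\kappa-1}\phi^n$ and $\beta_0=s!$. Define symmetric $(s+1)\times(s+1)$ matrices (indices $0,\dots,s$; out-of-range entries are $0$) by $c^{(0)}_{00}=0$, $c^{(0)}_{pq}=\beta_p\beta_q$ for $p+q>0$, $h^{(0)}_{pq}=0$ and, for $l\ge1$ and $q\le p$, $$c^{(l)}_{pq}=\begin{cases}0,&q\le l-1,\\ c^{(l-1)}_{pq}-2c^{(l-1)}_{p+1,q-1},&p=q=l,\\ c^{(l-1)}_{pq}-c^{(l-1)}_{p+1,q-1},&l+1\le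 p\le s-1,\ q=l,\\ c^{(l-1)}_{pq},&\text{otherwise,}\end{cases}\qquad h^{(l)}_{pq}=\begin{cases}2c^{(l-1)}_{p+1,q},&l-1\le p\le s-1,\ q=l-1,\\ h^{(l-1)}_{pq},&\text{otherwise.}\end{cases}$$ Let $\zeta$ be the least $l\ge1$ with $c^{(l)}_{ll}\ne0$. Let $\rho$ be the least $\kappa\in\{0,\dots,\zeta-1\}$ for which the leading principal minor of order $\kappa+1$ of $(h^{(\zeta)}_{pq})$ is $\le0$, and $\rho=\zeta$ if there is none. Let $\lambda=\tau/h$. **Theorem.** In each of the following cases $$\|u^n-u_h^n\|\le C\,(h^{k+1}+\tau^s)\,\|u\|_{k+2,\infty},\qquad 0\le n\le M,\quad u^n=u(\cdot,n\tau).$$ 1. $c^{(\zeta)}_{\zeta\zeta}<0$, $\rho=\zeta$, and $\tau\le\lambda_0h$, where $\lambda_0>0$ is a sufficiently small constant that depends only on $s$, $k$, the choice of LSV or RRSV, the type of boundary condition and $\alpha$; 2. $c^{(\zeta)}_{\zeta\zeta}<0$, $\rho<\zeta$, and $\lambda^{2\rho+1}\le K\tau$, for an arbitrary constant $K$; 3.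 $c^{(\zeta)}_{\zeta\zeta}>0$ and $\lambda^{\min(2\zeta,2\rho+1)}\le K\tau$, for an arbitrary constant $K$. Here $C>0$ depends only on $s$, $k$, the choice of LSV or RRSV, the type of boundary condition, $\alpha$, $a$, $b$, $T$, $C_0$ and, in cases 2 and 3, on $K$; it does not depend on the mesh, $\tau$, $n$, $u$ or $u_h$. -/

import Mathlib

open Polynomial MeasureTheory Set
open scoped ENNReal ContDiff

namespace RKSV

/-! ### Coefficients of the strong-stability-preserving Runge-Kutta method -/

/-- The parameters `g m l`, where `m = s - 1`: `g 0 0 = 1` and, for `m ≥ 1`,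
`g m l = g (m-1) (l-1) / l` for `1 ≤ l ≤ m - 1`, `g m m = 1 / (m+1)!` and
`g m 0 = 1 - ∑_{l=1}^{m} g m l`. -/
def sspParam : ℕ → ℕ → ℚ
  | 0, l => if l = 0 then 1 else 0
  | m + 1, l =>
    let tail : ℕ → ℚ := fun j =>
      if j = m + 1 then 1 / ((m + 2).factorial : ℚ)
      else if 1 ≤ j ∧ j ≤ m then sspParam m (j - 1) / (j : ℚ) else 0
    if l = 0 then 1 - ∑ j ∈ Finset.Icc 1 (m + 1), tail j else tail l

/-- The matrix `{c_{lκ}}`, `0 ≤ l, κ ≤ s - 1`, of the `s`-stage method. -/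
def rkC (s l κ : ℕ) : ℚ :=
  if l + 1 = s then sspParam (s - 1) κ else if κ = l then 1 else 0

/-- The matrix `{d_{lκ}}`, `0 ≤ l, κ ≤ s - 1`, of the `s`-stage method. -/
def rkD (s l κ : ℕ) : ℚ :=
  if κ = l then (if l + 1 = s then sspParam (s - 1) (s - 1) else 1) else 0

/-! ### The matrix transferring process -/

/-- The stage polynomials: applied to `φ' = L φ` with `L` linear, the method has the stages
`φ^{n,l} = (stagePoly s l)(τ L) φ^n`. -/
noncomputable def stagePoly (s : ℕ) : ℕ → ℚ[X]
  | 0 => 1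
  | l + 1 => ∑ κ : Fin (l + 1),
      (C (rkC s l κ) + C (rkD s l κ) * X) * stagePoly s κ
termination_by l => l
decreasing_by exact κ.2

/-- The coefficients `β` in `β₀ φ^{n+1} = ∑_κ β_κ 𝔼_κ φ^n`, scaled by `β₀ = s!`.  The temporal
differences `𝔼_κ` are the combinations of the stages with `𝔼_0 = 1` and `𝔼_κ = τ L 𝔼_{κ-1}`, so that
`𝔼_κ` corresponds to the monomial `X ^ κ`. -/
noncomputable def evolutionCoeff (s κ : ℕ) : ℚ :=
  (s.factorial : ℚ) * (stagePoly s s).coeff κ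

/-- The temporal matrices `ℂ^{(l)}` generated from the vector `β`; entries with an index above `s`
are `0`.  The matrices are symmetric, and the recursion is given for the larger index `P` and the
smaller index `Q`. -/
def temporalMatrix (s : ℕ) (β : ℕ → ℚ) : ℕ → ℕ → ℕ → ℚ
  | 0, p, q => if (p = 0 ∧ q = 0) ∨ s < p ∨ s < q then 0 else β p * β q
  | l + 1, p, q =>
    let P := max p q
    let Q := min p q
    if Q ≤ l then 0
    else if P = l + 1 ∧ Q = l + 1 then
      temporalMatrix s β l P Q - 2 * temporalMatrix s β l (P + 1) (Q - 1)
    else if l + 2 ≤ P ∧ P < s ∧ Q = l + 1 then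
      temporalMatrix s β l P Q - temporalMatrix s β l (P + 1) (Q - 1)
    else temporalMatrix s β l P Q

/-- The spatial matrices `ℍ^{(l)}` generated from the vector `β`. -/
def spatialMatrix (s : ℕ) (β : ℕ → ℚ) : ℕ → ℕ → ℕ → ℚ
  | 0, _, _ => 0
  | l + 1, p, q =>
    let P := max p q
    let Q := min p q
    if Q = l ∧ P < s then 2 * temporalMatrix s β l (P + 1) Q
    else spatialMatrix s β l P Q

/-- The termination index `ζ`: the first `l ≥ 1` with `c_{ll}^{(l)} ≠ 0`.  It exists and is at most
`s`, since `c_{ss}^{(s)} = β_s ^ 2`. -/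
noncomputable def terminationIndex (s : ℕ) : ℕ :=
  sInf {l | 1 ≤ l ∧ temporalMatrix s (evolutionCoeff s) l l l ≠ 0}

/-- The value `c_{ζζ}^{(ζ)}`. -/
noncomputable def terminationValue (s : ℕ) : ℚ :=
  temporalMatrix s (evolutionCoeff s) (terminationIndex s) (terminationIndex s)
    (terminationIndex s)

/-- The determinant of the leading principal submatrix of order `κ + 1` of `ℍ^{(ζ)}`. -/
noncomputable def leadingMinor (s κ : ℕ) : ℚ :=
  (Matrix.of fun p q : Fin (κ + 1) =>
    spatialMatrix s (evolutionCoeff s) (terminationIndex s) p q).det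

open Classical in
/-- The contribution (indicator) index `ρ`: the least `κ ≤ ζ - 1` for which the leading principal
minor of order `κ + 1` of `ℍ^{(ζ)}` is `≤ 0`, and `ζ` if there is none. -/
noncomputable def contributionIndex (s : ℕ) : ℕ :=
  if {κ | κ < terminationIndex s ∧ leadingMinor s κ ≤ 0}.Nonempty then
    sInf {κ | κ < terminationIndex s ∧ leadingMinor s κ ≤ 0}
  else terminationIndex s

/-! ### Subdivision points and meshes -/

/-- The Legendre polynomial of degree `n` on `[-1,1]` (Rodrigues' formula). -/
noncomputable def legendre (n : ℕ) : ℝ[X] :=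
  C (1 / (2 ^ n * (n.factorial : ℝ))) * derivative^[n] ((X ^ 2 - 1) ^ n)

/-- The two families of spectral volume schemes: LSV (Gauss-Legendre points) and RRSV (right-Radau
points). -/
inductive SVKind
  | LSV
  | RRSV

/-- The polynomial whose zeros in `(-1,1)` are the interior subdivision points. -/
noncomputable def SVKind.poly (kind : SVKind) (k : ℕ) : ℝ[X] :=
  match kind with
  | .LSV => legendre k
  | .RRSV => legendre (k + 1) - legendre k

/-- `-1 = y₀ < y₁ < ⋯ < y_k < y_{k+1} = 1` are the subdivision points on the reference element. -/
structure IsSubdivision (kind : SVKind) (k : ℕ) (y : ℕ → ℝ) : Prop where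
  left : y 0 = -1
  right : y (k + 1) = 1
  lt : ∀ j ≤ k, y j < y (j + 1)
  root : ∀ j, 1 ≤ j → j ≤ k → (kind.poly k).IsRoot (y j)

/-- A partition of `[a,b]` into `N` spectral volumes `[node i, node (i+1)]`, `i < N`. -/
structure Mesh (a b : ℝ) (N : ℕ) where
  node : ℕ → ℝ
  first : node 0 = a
  last : node N = b
  lt : ∀ i < N, node i < node (i + 1)

namespace Mesh

variable {a b : ℝ} {N : ℕ}

/-- The length of the `i`-th spectral volume. -/
def len (m : Mesh a b N) (i : ℕ) : ℝ := m.node (i + 1) - m.node i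

/-- The mesh size `h = max_i h_i`. -/
noncomputable def h (m : Mesh a b N) : ℝ := ⨆ i : Fin N, m.len i

/-- The smallest length `min_i h_i`. -/
noncomputable def hmin (m : Mesh a b N) : ℝ := ⨅ i : Fin N, m.len i

/-- Regularity of the partition with constant `α`. -/
def Regular (m : Mesh a b N) (α : ℝ) : Prop := α * m.h ≤ m.hmin

/-- The points `x_{i,j}`, images of the reference points `y_j`. -/
noncomputable def point (m : Mesh a b N) (y : ℕ → ℝ) (i j : ℕ) : ℝ :=
  m.len i / 2 * y j + (m.node i + m.node (i + 1)) / 2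

/-- The function on `[a,b]` whose restriction to the `i`-th element is the polynomial `p i`. -/
noncomputable def broken (m : Mesh a b N) (p : ℕ → ℝ[X]) (x : ℝ) : ℝ :=
  ∑ i ∈ Finset.range N,
    (Ioc (m.node i) (m.node (i + 1))).indicator (fun z => (p i).eval z) x

end Mesh

/-! ### The equation -/

/-- The boundary condition: `u(a,t) = 0`, or `u(a,t) = u(b,t)`. -/
inductive BC
  | inflow
  | periodic

/-- `u` (as a function of `x` and `t`) is a classical solution of `u_t + u_x = 0` on
`[a,b] × (0,T]` with initial value `u₀` and the given boundary condition. -/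
structure IsSolution (bc : BC) (a b T : ℝ) (u₀ : ℝ → ℝ) (u : ℝ → ℝ → ℝ) : Prop where
  cont : ContinuousOn (fun z : ℝ × ℝ => u z.1 z.2) (Icc a b ×ˢ Icc 0 T)
  pde : ∀ x ∈ Icc a b, ∀ t ∈ Ioc 0 T, ∃ ux ut : ℝ,
    HasDerivWithinAt (fun z => u z t) ux (Icc a b) x ∧
    HasDerivWithinAt (fun r => u x r) ut (Icc 0 T) t ∧ ut + ux = 0
  init : ∀ x ∈ Icc a b, u x 0 = u₀ x
  boundary : ∀ t ∈ Icc 0 T,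
    match bc with
    | .inflow => u a t = 0
    | .periodic => u a t = u b t

/-- `w` is the `j`-th weak derivative of `v` on `(a,b)`. -/
def IsWeakDeriv (a b : ℝ) (j : ℕ) (v w : ℝ → ℝ) : Prop :=
  LocallyIntegrableOn v (Ioo a b) ∧ LocallyIntegrableOn w (Ioo a b) ∧
  ∀ φ : ℝ → ℝ, ContDiff ℝ ∞ φ → HasCompactSupport φ → tsupport φ ⊆ Ioo a b →
    ∫ x in Ioo a b, v x * iteratedDeriv j φ x = (-1) ^ j * ∫ x in Ioo a b, w x * φ x

/-- The norm of `W^{m,∞}(a,b)`, with value `∞` off this space. -/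
noncomputable def sobolevNorm (a b : ℝ) (m : ℕ) (v : ℝ → ℝ) : ℝ≥0∞ :=
  ⨅ (D : ℕ → ℝ → ℝ) (_ : ∀ j ≤ m, IsWeakDeriv a b j v (D j)),
    ⨆ (j : ℕ) (_ : j ≤ m), eLpNorm (D j) ∞ (volume.restrict (Ioo a b))

/-- `‖u‖_{m,∞} = sup_{0 ≤ t ≤ T} ‖u(·,t)‖_{W^{m,∞}(a,b)}`. -/
noncomputable def solutionNorm (a b T : ℝ) (m : ℕ) (u : ℝ → ℝ → ℝ) : ℝ≥0∞ :=
  ⨆ (t : ℝ) (_ : t ∈ Icc 0 T), sobolevNorm a b m (fun x => u x t)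

/-- The `L²(a,b)` norm. -/
noncomputable def l2Norm (a b : ℝ) (v : ℝ → ℝ) : ℝ≥0∞ :=
  eLpNorm v 2 (volume.restrict (Icc a b))

/-! ### The fully discrete scheme -/

section Scheme

variable {a b : ℝ} {N : ℕ}

/-- The left limit `v⁻_{i,j}` at `x_{i,j}` of the piecewise polynomial `p`; at the inflow end `a` it
is supplied by the boundary condition. -/
noncomputable def leftTrace (bc : BC) (m : Mesh a b N) (y : ℕ → ℝ) (p : ℕ → ℝ[X]) (i j : ℕ) : ℝ :=
  if j = 0 then
    if i = 0 then
      match bc with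
      | .inflow => 0
      | .periodic => (p (N - 1)).eval b
    else (p (i - 1)).eval (m.node i)
  else (p i).eval (m.point y i j)

/-- `U n l i` is the restriction to the `i`-th element of the stage solution `u_h^{n,l}` of the
RKSV(s,k) scheme with time step `τ` and `M` time levels; `u_h^n = u_h^{n,0}`. -/
structure IsRKSV (s k : ℕ) (bc : BC) (m : Mesh a b N) (y : ℕ → ℝ) (τ : ℝ) (M : ℕ)
    (U : ℕ → ℕ → ℕ → ℝ[X]) : Prop where
  degree : ∀ n < M, ∀ l ≤ s, ∀ i < N, (U n l i).natDegree ≤ k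
  stage : ∀ n < M, ∀ l < s, ∀ i < N, ∀ j ≤ k,
    ∫ x in (m.point y i j)..(m.point y i (j + 1)), (U n (l + 1) i).eval x =
      ∑ κ ∈ Finset.range (l + 1),
        ((rkC s l κ : ℝ) * (∫ x in (m.point y i j)..(m.point y i (j + 1)), (U n κ i).eval x) -
          τ * (rkD s l κ : ℝ) *
            (leftTrace bc m y (U n κ) i (j + 1) - leftTrace bc m y (U n κ) i j))
  step : ∀ n < M, ∀ i < N, U (n + 1) 0 i = U n s i

/-- `p` is the Lagrange interpolant of `v` at the points `x_{i,j}`, `1 ≤ j ≤ k + 1`. -/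
def IsInterpolant (k : ℕ) (m : Mesh a b N) (y : ℕ → ℝ) (v : ℝ → ℝ) (p : ℕ → ℝ[X]) : Prop :=
  ∀ i < N, (p i).natDegree ≤ k ∧
    ∀ j, 1 ≤ j → j ≤ k + 1 → (p i).eval (m.point y i j) = v (m.point y i j)

end Scheme

/-- The estimate `‖u^n - u_h^n‖ ≤ C (h^{k+1} + τ^s) ‖u‖_{k+2,∞}`, `0 ≤ n ≤ M`, for all partitions that
are regular with constant `α`, all time steps `τ = T / M` with `cfl τ h`, all solutions `u`, and all
discrete solutions whose initial value is the Lagrange interpolant of `u₀`, or any other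
approximation of `u₀` of the same order, with constant `C₀`. -/
def OptimalEstimate (s k : ℕ) (bc : BC) (y : ℕ → ℝ) (α a b T C₀ C : ℝ) (cfl : ℝ → ℝ → Prop) :
    Prop :=
  ∀ (N : ℕ) (m : Mesh a b N), m.Regular α →
  ∀ (M : ℕ), 0 < M → ∀ τ : ℝ, τ = T / M → cfl τ m.h →
  ∀ (u₀ : ℝ → ℝ) (u : ℝ → ℝ → ℝ), IsSolution bc a b T u₀ u →
  ∀ U : ℕ → ℕ → ℕ → ℝ[X], IsRKSV s k bc m y τ M U →
  (IsInterpolant k m y u₀ (U 0 0) ∨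
    l2Norm a b (fun x => u₀ x - m.broken (U 0 0) x) ≤
      ENNReal.ofReal (C₀ * (m.h ^ (k + 1) + τ ^ s)) * solutionNorm a b T (k + 2) u) →
  ∀ n ≤ M,
    l2Norm a b (fun x => u x (n * τ) - m.broken (U n 0) x) ≤
      ENNReal.ofReal (C * (m.h ^ (k + 1) + τ ^ s)) * solutionNorm a b T (k + 2) u

end RKSV

/-!
The error of the scheme is measured against the interpolant of a smooth solution of the same
equation. The estimate is then the sum of a stability bound for one time step and a bound of the
truncation error, combined by Gronwall's inequality.

**The scheme as an operator.** After the pullback of every element to `[-1,1]`, the balance laws on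
the control volumes say that a forward Euler step is `v ↦ v + τ A v`, where `A = svOp` is minus the
derivative plus, on each element, the jump at its left end times `-R'` (`integral_svOp`). Here
`R` is the polynomial of degree at most `k + 1` that vanishes at all subdivision points except `-1`.
Since the Runge-Kutta parameters make the last stage the truncated exponential
(`stagePoly_eq_expPoly`), a full step is `∑_{p ≤ s} (τ A)^p / p!` (`IsRKSV.toRef_step`).

**Energy.** For both families of points there is a `γ ≥ 0` such that, in the inner product
`∫ p q + γ p_k q_k`, the polynomial `R'` represents the evaluation at `-1`. This is the orthogonality
of the Legendre polynomials (`exists_isCorrection`). Hence `A` is skew-symmetric up to a form in the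
jumps (`energy_svOp_add`), exactly as for the upwind discontinuous Galerkin method.

**Stability.** The matrix transferring process is nothing but repeated use of this integration by
parts: every transfer of a temporal coefficient towards the diagonal produces a coefficient of the
jump form (`pairing_temporalMatrix_zero`). When the process stops, the temporal matrix starts with
the order `ζ`, and by Sylvester's criterion the jump form is coercive in the orders below `ρ`, so
that the jump terms which can do harm have order at least `ρ` (`exists_energy_estimate`). By the
inverse estimates, differences of order `p` are bounded by the `p`-th power of the Courant number
(`exists_inverse_estimate`). The energy thus grows at most by the factor `1 + C τ` in a step
(`exists_stableStep_of_neg`, `exists_stableStep_of_pow`).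

**Consistency.** The interpolation error of a polynomial of degree `k + 1` at the subdivision points
other than `-1` is a multiple of `R`, so its derivative is what the jump correction in `A` adds
(`IsNodeInterp.derivative_add`). Therefore the powers of `A`, applied to interpolants, reproduce the
derivatives of Taylor polynomials of degree `k + 1` (`exists_svOp_pow_error`), and the truncated
exponential reproduces the shift by `τ` (`exists_truncation_error`).

**Regularity of the solution.** The norm `‖u‖_{k+2,∞}` controls only weak derivatives in space, and
the partial derivatives of `u` need not be continuous. The bound on the second space derivative
nevertheless makes `∂ₓu` continuous in time, so that `u` is constant along characteristics
(`IsSolution.eq_of_characteristic`). Hence `u` is a translated profile `G (x - t)`; mollifying `G`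
gives smooth solutions with the same boundary condition and the same bounds, as close to `u` as
desired (`IsSolution.exists_smooth`). The distance is chosen of the order of the error.
-/

namespace RKSV

/-! ### The Runge-Kutta polynomial -/

lemma sspParam_top (m : ℕ) : sspParam m m = 1 / ((m + 1).factorial : ℚ) := by
  cases m with
  | zero => simp [sspParam]
  | succ m => rw [sspParam]; simp

lemma sspParam_succ_of_mem (m j : ℕ) (h1 : 1 ≤ j) (h2 : j ≤ m) :
    sspParam (m + 1) j = sspParam m (j - 1) / (j : ℚ) := by
  rw [sspParam]
  simp only
  rw [if_neg (by omega), if_neg (by omega), if_pos ⟨h1, h2⟩]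

lemma sum_sspParam (m : ℕ) : ∑ l ∈ Finset.range (m + 1), sspParam m l = 1 := by
  cases m with
  | zero => simp [sspParam]
  | succ m =>
    have h0 : sspParam (m + 1) 0 = 1 - ∑ j ∈ Finset.Icc 1 (m + 1), sspParam (m + 1) j := by
      rw [sspParam]
      simp only [if_true]
      congr 1
      refine Finset.sum_congr rfl fun j hj => ?_
      have := (Finset.mem_Icc.1 hj).1
      rw [sspParam]
      simp only
      rw [if_neg (show ¬ j = 0 by omega)]
    have hI : Finset.Icc 1 (m + 1) = Finset.Ico 1 (m + 1 + 1) := by ext; simp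
    rw [Finset.sum_range_succ', h0, hI, Finset.sum_Ico_eq_sum_range]
    simp [add_comm 1]

/-- The polynomial of the whole step, before it is recognised as a truncated exponential. -/
noncomputable def sspPoly (m : ℕ) : ℚ[X] :=
  ∑ l ∈ Finset.range m, C (sspParam m l) * (1 + X) ^ l
    + C (1 / ((m + 1).factorial : ℚ)) * (1 + X) ^ (m + 1)

/-- The Taylor polynomial of degree `n` of the exponential function. -/
noncomputable def expPoly (n : ℕ) : ℚ[X] :=
  ∑ κ ∈ Finset.range (n + 1), C (1 / (κ.factorial : ℚ)) * X ^ κ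

lemma coeff_expPoly (n κ : ℕ) :
    (expPoly n).coeff κ = if κ ≤ n then 1 / (κ.factorial : ℚ) else 0 := by
  simp only [expPoly, finsetSum_coeff, coeff_C_mul, coeff_X_pow]
  simp

lemma stagePoly_of_lt (s l : ℕ) (hl : l < s) : stagePoly s l = (1 + X) ^ l := by
  induction l with
  | zero => rw [stagePoly]; simp
  | succ l ih =>
    rw [stagePoly]
    rw [Fin.sum_univ_eq_sum_range (fun κ => (C (rkC s l κ) + C (rkD s l κ) * X) * stagePoly s κ)]
    rw [Finset.sum_eq_single l]
    · rw [ih (by omega)]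
      simp [rkC, rkD, show l + 1 ≠ s by omega]
      ring
    · intro κ _ h
      simp [rkC, rkD, show l + 1 ≠ s by omega, h]
    · simp

lemma stagePoly_self (m : ℕ) : stagePoly (m + 1) (m + 1) = sspPoly m := by
  rw [stagePoly]
  rw [Fin.sum_univ_eq_sum_range
    (fun κ => (C (rkC (m + 1) m κ) + C (rkD (m + 1) m κ) * X) * stagePoly (m + 1) κ)]
  rw [Finset.sum_range_succ, sspPoly]
  congr 1
  · refine Finset.sum_congr rfl fun κ hκ => ?_
    have := Finset.mem_range.1 hκ
    rw [stagePoly_of_lt _ _ (by omega)]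
    simp [rkC, rkD, show κ ≠ m by omega]
  · rw [stagePoly_of_lt _ _ (by omega)]
    simp [rkC, rkD, sspParam_top]
    ring

lemma eq_of_derivative_eq {p q : ℚ[X]} (h : derivative p = derivative q)
    (h0 : p.eval 0 = q.eval 0) : p = q := by
  have h1 : derivative (p - q) = 0 := by rw [derivative_sub, h, sub_self]
  have h2 := derivative_eq_zero.1 h1
  rw [natDegree_eq_zero] at h2
  obtain ⟨c, hc⟩ := h2
  have : c = 0 := by
    have := congrArg (eval 0) hc
    simpa [h0] using this
  rw [this] at hc
  simpa [sub_eq_zero] using hc.symm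

lemma derivative_expPoly (n : ℕ) : derivative (expPoly (n + 1)) = expPoly n := by
  ext κ
  rw [coeff_derivative, coeff_expPoly, coeff_expPoly]
  by_cases h : κ ≤ n
  · rw [if_pos (by omega), if_pos h, Nat.factorial_succ]
    push_cast
    field_simp
  · rw [if_neg (by omega), if_neg h]; simp

lemma eval_zero_sspPoly (m : ℕ) : (sspPoly m).eval 0 = 1 := by
  have := sum_sspParam m
  rw [Finset.sum_range_succ, sspParam_top] at this
  simp [sspPoly, eval_finsetSum]
  simpa using this

/-- Differentiation maps the polynomial of the `(m+2)`-stage method to that of the `(m+1)`-stage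
method; this is what the recursion `g_{m,l} = g_{m-1,l-1} / l` is made for. -/
lemma derivative_sspPoly (m : ℕ) : derivative (sspPoly (m + 1)) = sspPoly m := by
  rw [sspPoly, sspPoly, derivative_add, derivative_sum, Finset.sum_range_succ']
  have e1 : derivative (1 + X : ℚ[X]) = 1 := by simp
  congr 1
  · simp only [pow_zero, mul_one, derivative_C, add_zero]
    refine Finset.sum_congr rfl fun l hl => ?_
    rw [sspParam_succ_of_mem m (l + 1) (by omega) (by have := Finset.mem_range.1 hl; omega),
      derivative_C_mul, derivative_pow, e1, mul_one, ← mul_assoc, ← C_mul]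
    congr 2
    simp only [Nat.add_sub_cancel]
    field_simp
  · rw [derivative_C_mul, derivative_pow, e1, mul_one, ← mul_assoc, ← C_mul]
    congr 2
    rw [Nat.factorial_succ (m + 1)]
    push_cast
    field_simp

lemma sspPoly_eq_expPoly (m : ℕ) : sspPoly m = expPoly (m + 1) := by
  induction m with
  | zero => simp [sspPoly, expPoly, Finset.sum_range_succ]
  | succ m ih =>
    refine eq_of_derivative_eq (by rw [derivative_sspPoly, derivative_expPoly, ih]) ?_
    rw [eval_zero_sspPoly, ← coeff_zero_eq_eval_zero, coeff_expPoly]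
    simp

/-- The `s`-stage method reproduces the exponential function up to order `s`. -/
lemma stagePoly_eq_expPoly (s : ℕ) (hs : 1 ≤ s) : stagePoly s s = expPoly s := by
  obtain ⟨m, rfl⟩ := Nat.exists_eq_add_of_le' hs
  rw [stagePoly_self, sspPoly_eq_expPoly]

lemma evolutionCoeff_eq (s : ℕ) (hs : 1 ≤ s) (κ : ℕ) :
    evolutionCoeff s κ = if κ ≤ s then (s.factorial : ℚ) / κ.factorial else 0 := by
  rw [evolutionCoeff, stagePoly_eq_expPoly s hs, coeff_expPoly]
  split_ifs <;> simp [div_eq_mul_inv]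

/-! ### The energy identity of the matrix transferring process -/

section Transfer

variable (s : ℕ) (β : ℕ → ℚ)

lemma temporalMatrix_comm (l p q : ℕ) : temporalMatrix s β l p q = temporalMatrix s β l q p := by
  cases l with
  | zero =>
    rw [temporalMatrix, temporalMatrix, mul_comm]
    congr 1
    simp only [eq_iff_iff]
    tauto
  | succ l => rw [temporalMatrix, temporalMatrix, max_comm, min_comm]

lemma temporalMatrix_eq_zero_of_lt {l p q : ℕ} (h : q < l) : temporalMatrix s β l p q = 0 := by
  cases l with
  | zero => omega
  | succ l =>
    rw [temporalMatrix, if_pos (by omega)]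

lemma temporalMatrix_eq_zero_of_gt (l p q : ℕ) (h : s < p) : temporalMatrix s β l p q = 0 := by
  induction l generalizing p q with
  | zero => rw [temporalMatrix, if_pos (by omega)]
  | succ l ih =>
    rw [temporalMatrix, ih (max p q) _ (by omega), ih (max p q + 1) _ (by omega)]
    simp

lemma temporalMatrix_succ {l p q : ℕ} (h : q ≤ p) :
    temporalMatrix s β (l + 1) p q =
      if q ≤ l then 0
      else if p = l + 1 ∧ q = l + 1 then
        temporalMatrix s β l p q - 2 * temporalMatrix s β l (p + 1) (q - 1)
      else if l + 2 ≤ p ∧ p < s ∧ q = l + 1 then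
        temporalMatrix s β l p q - temporalMatrix s β l (p + 1) (q - 1)
      else temporalMatrix s β l p q := by
  rw [temporalMatrix]
  simp only [max_eq_left h, min_eq_right h]

lemma spatialMatrix_succ {l p q : ℕ} (h : q ≤ p) :
    spatialMatrix s β (l + 1) p q =
      if q = l ∧ p < s then 2 * temporalMatrix s β l (p + 1) q else spatialMatrix s β l p q := by
  rw [spatialMatrix]
  simp only [max_eq_left h, min_eq_right h]

lemma spatialMatrix_comm (l p q : ℕ) : spatialMatrix s β l p q = spatialMatrix s β l q p := by
  cases l with
  | zero => rfl
  | succ l => rw [spatialMatrix, spatialMatrix, max_comm, min_comm]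

lemma spatialMatrix_eq_zero (l p q : ℕ) (h : q ≤ p) (hq : l ≤ q) : spatialMatrix s β l p q = 0 := by
  induction l generalizing p q with
  | zero => rfl
  | succ l ih => rw [spatialMatrix_succ s β h, if_neg (by omega), ih _ _ h (by omega)]

/-- The symmetric matrix with entries `1` at `(x,y)` and `(y,x)`, or `2` at `(x,x)` if `x = y`. -/
def symmUnit (x y p q : ℕ) : ℚ :=
  (if p = x ∧ q = y then 1 else 0) + (if p = y ∧ q = x then 1 else 0)

lemma symmUnit_comm (x y p q : ℕ) : symmUnit x y p q = symmUnit x y q p := by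
  simp only [symmUnit, and_comm, add_comm]

/-- The weight with which the pair `(r+1,l)` is moved to `(r,l+1)`: the pair `(l+1,l)` is its own
mirror image under this move and counts half. -/
def transferWeight (l r : ℕ) : ℚ := if r = l then 1 / 2 else 1

/-- One step of the process moves the entries `(r+1, l)` of column `l`, with their mirror images, to
`(r, l+1)`, and so empties row and column `l`. -/
lemma temporalMatrix_sub_succ (l p q : ℕ) (h0 : temporalMatrix s β l l l = 0) :
    temporalMatrix s β l p q - temporalMatrix s β (l + 1) p q =
      ∑ r ∈ Finset.Ico l s, transferWeight l r * temporalMatrix s β l (r + 1) l *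
        (symmUnit (r + 1) l p q + symmUnit r (l + 1) p q) := by
  wlog hqp : q ≤ p generalizing p q
  · rw [temporalMatrix_comm s β l p q, temporalMatrix_comm s β (l + 1) p q, this q p (by omega)]
    refine Finset.sum_congr rfl fun r _ => ?_
    rw [symmUnit_comm (r + 1) l, symmUnit_comm r (l + 1)]
  rw [temporalMatrix_succ s β hqp]
  have hz : ∀ x y, s < x → temporalMatrix s β l x y = 0 := fun x y h =>
    temporalMatrix_eq_zero_of_gt s β l x y h
  -- the pair `(p,q)` occurs in at most one term of the sum, the one with `r = r₀`
  have key : ∀ r₀ : ℕ, l ≤ r₀ → (∀ r, l ≤ r → r ≠ r₀ →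
        symmUnit (r + 1) l p q = 0 ∧ symmUnit r (l + 1) p q = 0) →
      ∑ r ∈ Finset.Ico l s, transferWeight l r * temporalMatrix s β l (r + 1) l *
        (symmUnit (r + 1) l p q + symmUnit r (l + 1) p q) =
      transferWeight l r₀ * temporalMatrix s β l (r₀ + 1) l *
        (symmUnit (r₀ + 1) l p q + symmUnit r₀ (l + 1) p q) := by
    intro r₀ h1 h2
    refine Finset.sum_eq_single r₀ (fun r hr hne => ?_) (fun h => ?_)
    · obtain ⟨e1, e2⟩ := h2 r (Finset.mem_Ico.1 hr).1 hne
      rw [e1, e2]; ring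
    · rw [hz (r₀ + 1) l (by simp at h; omega)]; ring
  have off : ∀ x y, ¬ (p = x ∧ q = y) → ¬ (p = y ∧ q = x) → symmUnit x y p q = 0 := by
    intro x y h1 h2
    rw [symmUnit, if_neg h1, if_neg h2, add_zero]
  rcases lt_trichotomy q l with hq | hq | hq
  · rw [key l le_rfl (fun r h1 h2 => ⟨off _ _ (by omega) (by omega), off _ _ (by omega) (by omega)⟩),
      off (l + 1) l (by omega) (by omega), off l (l + 1) (by omega) (by omega), if_pos (by omega),
      temporalMatrix_eq_zero_of_lt s β hq]
    ring
  · subst hq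
    rw [if_pos le_rfl]
    rcases Nat.lt_or_ge q p with hp | hp
    · rw [key (p - 1) (by omega)
        (fun r h1 h2 => ⟨off _ _ (by omega) (by omega), off _ _ (by omega) (by omega)⟩)]
      rw [show p - 1 + 1 = p by omega]
      rcases Nat.eq_or_lt_of_le (show q + 1 ≤ p from hp) with h | h
      · subst h
        simp [symmUnit, transferWeight]
        ring
      · rw [off (p - 1) (q + 1) (by omega) (by omega)]
        simp [symmUnit, transferWeight, show p - 1 ≠ q by omega, show q ≠ p by omega]
    · obtain rfl : p = q := by omega
      rw [h0, key p le_rfl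
        (fun r h1 h2 => ⟨off _ _ (by omega) (by omega), off _ _ (by omega) (by omega)⟩),
        off _ _ (by omega) (by omega), off _ _ (by omega) (by omega)]
      ring
  · rw [if_neg (by omega)]
    rcases Nat.eq_or_lt_of_le (show l + 1 ≤ q from hq) with h | h
    · subst h
      rw [key p (by omega)
        (fun r h1 h2 => ⟨off _ _ (by omega) (by omega), off _ _ (by omega) (by omega)⟩),
        off (p + 1) l (by omega) (by omega)]
      rcases Nat.eq_or_lt_of_le hqp with h | h
      · subst h
        simp [symmUnit, transferWeight]
        ring
      · rw [if_neg (by omega)]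
        simp only [symmUnit, transferWeight]
        rw [if_neg (show ¬ p = l by omega), if_pos (⟨trivial, trivial⟩ : True ∧ True),
          if_neg (show ¬ (p = l + 1 ∧ l + 1 = p) by omega)]
        split_ifs with h1
        · simp
        · rw [hz (p + 1) l (by by_contra h2; exact h1 ⟨h, by omega, trivial⟩)]; ring
    · rw [if_neg (by omega), if_neg (by omega), key l le_rfl
        (fun r h1 h2 => ⟨off _ _ (by omega) (by omega), off _ _ (by omega) (by omega)⟩),
        off (l + 1) l (by omega) (by omega), off l (l + 1) (by omega) (by omega)]
      ring

/-- The step that moves the temporal entry `(r+1, l)` records twice this entry at `(r, l)` in the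
spatial matrix. -/
lemma spatialMatrix_succ_sub (l p q : ℕ) :
    spatialMatrix s β (l + 1) p q - spatialMatrix s β l p q =
      ∑ r ∈ Finset.Ico l s, transferWeight l r * (2 * temporalMatrix s β l (r + 1) l) *
        symmUnit r l p q := by
  wlog hqp : q ≤ p generalizing p q
  · rw [spatialMatrix_comm s β l p q, spatialMatrix_comm s β (l + 1) p q, this q p (by omega)]
    refine Finset.sum_congr rfl fun r _ => ?_
    rw [symmUnit_comm r l]
  rw [spatialMatrix_succ s β hqp]
  have off : ∀ x y, ¬ (p = x ∧ q = y) → ¬ (p = y ∧ q = x) → symmUnit x y p q = 0 := by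
    intro x y h1 h2
    rw [symmUnit, if_neg h1, if_neg h2, add_zero]
  split_ifs with h
  · obtain ⟨rfl, hp⟩ := h
    rw [Finset.sum_eq_single p, spatialMatrix_eq_zero s β q p q hqp le_rfl]
    · by_cases h : p = q
      · subst h; simp [symmUnit, transferWeight]; ring
      · simp [symmUnit, transferWeight, h]
    · intro r hr hne
      have := (Finset.mem_Ico.1 hr).1
      rw [off r q (by omega) (by omega), mul_zero]
    · intro h; simp at h; omega
  · rw [sub_self, Finset.sum_eq_zero]
    intro r hr
    have := Finset.mem_Ico.1 hr
    rw [off r l (by omega) (by omega), mul_zero]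

/-- The value on a rational matrix of the linear functional with real weights `a`. -/
def pairing (c : ℕ → ℕ → ℚ) (a : ℕ → ℕ → ℝ) : ℝ :=
  ∑ p ∈ Finset.range (s + 1), ∑ q ∈ Finset.range (s + 1), (c p q : ℝ) * a p q

lemma pairing_sum {ι : Type*} (t : Finset ι) (w : ι → ℚ) (c : ι → ℕ → ℕ → ℚ) (a : ℕ → ℕ → ℝ) :
    pairing s (fun p q => ∑ i ∈ t, w i * c i p q) a = ∑ i ∈ t, (w i : ℝ) * pairing s (c i) a := by
  simp only [pairing, Rat.cast_sum, Rat.cast_mul, Finset.sum_mul, Finset.mul_sum]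
  symm
  rw [Finset.sum_comm]
  refine Finset.sum_congr rfl fun p _ => ?_
  rw [Finset.sum_comm]
  exact Finset.sum_congr rfl fun q _ => Finset.sum_congr rfl fun i _ => by ring

lemma pairing_sub (c d : ℕ → ℕ → ℚ) (a : ℕ → ℕ → ℝ) :
    pairing s (fun p q => c p q - d p q) a = pairing s c a - pairing s d a := by
  simp only [pairing, Rat.cast_sub, sub_mul, Finset.sum_sub_distrib]

lemma pairing_add (c d : ℕ → ℕ → ℚ) (a : ℕ → ℕ → ℝ) :
    pairing s (fun p q => c p q + d p q) a = pairing s c a + pairing s d a := by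
  simp only [pairing, Rat.cast_add, add_mul, Finset.sum_add_distrib]

lemma pairing_symmUnit (x y : ℕ) (hx : x ≤ s) (hy : y ≤ s) (a : ℕ → ℕ → ℝ)
    (ha : ∀ p q, a p q = a q p) : pairing s (symmUnit x y) a = 2 * a x y := by
  have h1 : ∀ x y : ℕ, x ≤ s → y ≤ s →
      pairing s (fun p q => if p = x ∧ q = y then 1 else 0) a = a x y := by
    intro x y hx hy
    rw [pairing, Finset.sum_eq_single x, Finset.sum_eq_single y]
    · simp
    · intro q _ h; simp [h]
    · intro h; simp at h; omega
    · intro p _ h; simp [h]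
    · intro h; simp at h; omega
  have := pairing_add s (fun p q => if p = x ∧ q = y then 1 else 0)
    (fun p q => if p = y ∧ q = x then 1 else 0) a
  rw [h1 x y hx hy, h1 y x hy hx, ha y x] at this
  rw [two_mul, ← this]
  rfl

/-- Summation of the transfers: if `a` and `j` are tied by the discrete integration by parts
`a (p+1) q + a p (q+1) = - j p q`, then `∑ c⁽⁰⁾ a = ∑ c⁽ˡ⁾ a - ½ ∑ h⁽ˡ⁾ j`, as long as no diagonal
entry has stopped the process. -/
lemma pairing_temporalMatrix_zero (a j : ℕ → ℕ → ℝ) (ha : ∀ p q, a p q = a q p)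
    (hj : ∀ p q, j p q = j q p) (haj : ∀ p q, a (p + 1) q + a p (q + 1) = - j p q) (l : ℕ)
    (hl : l ≤ s) (h0 : ∀ i < l, temporalMatrix s β i i i = 0) :
    pairing s (temporalMatrix s β 0) a =
      pairing s (temporalMatrix s β l) a - 1 / 2 * pairing s (spatialMatrix s β l) j := by
  induction l with
  | zero =>
    have : pairing s (spatialMatrix s β 0) j = 0 := by simp [pairing, spatialMatrix]
    rw [this]; ring
  | succ l ih =>
    rw [ih (by omega) fun i hi => h0 i (by omega)]
    have e1 := pairing_sub s (temporalMatrix s β l) (temporalMatrix s β (l + 1)) a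
    have e2 := pairing_sub s (spatialMatrix s β (l + 1)) (spatialMatrix s β l) j
    simp only [temporalMatrix_sub_succ s β l _ _ (h0 l (by omega))] at e1
    simp only [spatialMatrix_succ_sub s β l] at e2
    rw [pairing_sum] at e1 e2
    have e3 : ∑ i ∈ Finset.Ico l s,
        ((transferWeight l i * temporalMatrix s β l (i + 1) l : ℚ) : ℝ) *
          pairing s (fun p q => symmUnit (i + 1) l p q + symmUnit i (l + 1) p q) a =
        -(1 / 2) * ∑ i ∈ Finset.Ico l s,
        ((transferWeight l i * (2 * temporalMatrix s β l (i + 1) l) : ℚ) : ℝ) *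
          pairing s (symmUnit i l) j := by
      rw [Finset.mul_sum]
      refine Finset.sum_congr rfl fun i hi => ?_
      have hi := Finset.mem_Ico.1 hi
      rw [pairing_add, pairing_symmUnit s _ _ (by omega) (by omega) a ha,
        pairing_symmUnit s _ _ (by omega) (by omega) a ha,
        pairing_symmUnit s _ _ (by omega) (by omega) j hj, ← mul_add, haj]
      push_cast
      ring
    rw [e1] at e3
    rw [e2] at e3
    linarith

end Transfer

/-! ### Positive definite forms -/

/-- A continuous positive function on `ℝⁿ`, homogeneous of degree two, dominates the Euclidean
norm. -/
lemma exists_pos_mul_sum_sq_le {n : ℕ} (f : (Fin n → ℝ) → ℝ) (hf : Continuous f)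
    (hom : ∀ (c : ℝ) x, f (c • x) = c ^ 2 * f x) (pos : ∀ x, x ≠ 0 → 0 < f x) :
    ∃ ε : ℝ, 0 < ε ∧ ∀ x, ε * ∑ i, x i ^ 2 ≤ f x := by
  have h0 : f 0 = 0 := by simpa using hom 0 0
  rcases Nat.eq_zero_or_pos n with hn | hn
  · subst hn
    exact ⟨1, one_pos, fun x => by rw [Subsingleton.elim x 0, h0]; simp⟩
  have : Nonempty (Fin n) := ⟨⟨0, hn⟩⟩
  have hS : IsCompact (Metric.sphere (0 : Fin n → ℝ) 1) := isCompact_sphere _ _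
  obtain ⟨z, hz, hmin⟩ := hS.exists_isMinOn (NormedSpace.sphere_nonempty.2 zero_le_one)
    hf.continuousOn
  have hz0 : z ≠ 0 := by
    rintro rfl
    simp at hz
  have hn' : (0 : ℝ) < n := by exact_mod_cast hn
  refine ⟨f z / n, div_pos (pos z hz0) hn', fun x => ?_⟩
  by_cases hx : x = 0
  · subst hx; simp [h0]
  have hxn : 0 < ‖x‖ := norm_pos_iff.2 hx
  have h1 : f z ≤ f (‖x‖⁻¹ • x) := by
    refine hmin ?_
    simp [norm_smul, hxn.ne']
  rw [hom] at h1
  have h2 : ∑ i, x i ^ 2 ≤ n * ‖x‖ ^ 2 := by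
    calc ∑ i, x i ^ 2 ≤ ∑ _i : Fin n, ‖x‖ ^ 2 := by
          refine Finset.sum_le_sum fun i _ => ?_
          have := norm_le_pi_norm x i
          rw [Real.norm_eq_abs] at this
          rw [← sq_abs]
          gcongr
      _ = n * ‖x‖ ^ 2 := by simp
  calc f z / n * ∑ i, x i ^ 2 ≤ f z / n * (n * ‖x‖ ^ 2) := by
        have := (pos z hz0).le
        gcongr
    _ = f z * ‖x‖ ^ 2 := by field_simp
    _ ≤ (‖x‖⁻¹ ^ 2 * f x) * ‖x‖ ^ 2 := by gcongr
    _ = f x := by field_simp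

/-- Sylvester's criterion: a real symmetric matrix whose leading principal minors are positive is
positive definite. -/
lemma posDef_of_leading_minors_pos (H : ℕ → ℕ → ℝ) (hH : ∀ p q, H p q = H q p) (n : ℕ)
    (hdet : ∀ κ < n, 0 < (Matrix.of fun p q : Fin (κ + 1) => H p q).det) :
    (Matrix.of fun p q : Fin n => H p q).PosDef := by
  induction n with
  | zero =>
    refine ⟨by ext i; exact i.elim0, fun x hx => (hx (Subsingleton.elim _ _)).elim⟩
  | succ n ih =>
    have hA := ih fun κ hκ => hdet κ (by omega)
    set A : Matrix (Fin n) (Fin n) ℝ := Matrix.of fun p q : Fin n => H p q with hAdef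
    set M : Matrix (Fin (n + 1)) (Fin (n + 1)) ℝ := Matrix.of fun p q : Fin (n + 1) => H p q
      with hM
    let B : Matrix (Fin n) (Fin 1) ℝ := Matrix.of fun p _ => H p n
    let D : Matrix (Fin 1) (Fin 1) ℝ := Matrix.of fun _ _ => H n n
    have hblock : M.submatrix finSumFinEquiv finSumFinEquiv
        = Matrix.fromBlocks A B B.conjTranspose D := by
      ext i j
      rcases i with i | i <;> rcases j with j | j <;>
        simp [hM, hAdef, B, D, hH]
    have hMdet := hdet n (by omega)
    rw [← hM, ← Matrix.det_submatrix_equiv_self finSumFinEquiv, hblock] at hMdet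
    have hAdet := hA.det_pos
    have : Invertible A := Matrix.invertibleOfIsUnitDet A (isUnit_iff_ne_zero.2 hAdet.ne')
    rw [Matrix.det_fromBlocks₁₁, Matrix.invOf_eq_nonsing_inv] at hMdet
    have hS : 0 < (D - B.conjTranspose * A⁻¹ * B).det := (mul_pos_iff_of_pos_left hAdet).1 hMdet
    have hSpsd : (D - B.conjTranspose * A⁻¹ * B).PosSemidef := by
      rw [Matrix.det_fin_one] at hS
      have : D - B.conjTranspose * A⁻¹ * B
          = Matrix.diagonal fun _ => (D - B.conjTranspose * A⁻¹ * B) 0 0 := by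
        ext i j
        rw [Subsingleton.elim i 0, Subsingleton.elim j 0]
        simp
      rw [this]
      exact Matrix.PosSemidef.diagonal fun _ => hS.le
    have hpsd : M.PosSemidef := by
      rw [← Matrix.posSemidef_submatrix_equiv finSumFinEquiv, hblock]
      exact (Matrix.PosDef.fromBlocks₁₁ B D hA).2 hSpsd
    exact hpsd.posDef_iff_det_ne_zero.2 (hdet n (by omega)).ne'

/-- The coercive form of Sylvester's criterion. -/
lemma exists_coercive_of_leading_minors_pos (H : ℕ → ℕ → ℝ) (hH : ∀ p q, H p q = H q p) (n : ℕ)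
    (hdet : ∀ κ < n, 0 < (Matrix.of fun p q : Fin (κ + 1) => H p q).det) :
    ∃ ε : ℝ, 0 < ε ∧ ∀ x : ℕ → ℝ, ε * ∑ p ∈ Finset.range n, x p ^ 2 ≤
      ∑ p ∈ Finset.range n, ∑ q ∈ Finset.range n, H p q * (x p * x q) := by
  have hP := posDef_of_leading_minors_pos H hH n hdet
  obtain ⟨ε, hε, h⟩ := exists_pos_mul_sum_sq_le
    (fun x : Fin n → ℝ => ∑ p : Fin n, ∑ q : Fin n, H p q * (x p * x q)) (by fun_prop)
    (fun c x => by
      simp only [Pi.smul_apply, smul_eq_mul, Finset.mul_sum]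
      exact Finset.sum_congr rfl fun p _ => Finset.sum_congr rfl fun q _ => by ring)
    (fun x hx => by
      have := hP.dotProduct_mulVec_pos hx
      simp only [dotProduct, Matrix.mulVec, Finset.mul_sum, Matrix.of_apply] at this
      refine this.trans_le (le_of_eq ?_)
      exact Finset.sum_congr rfl fun p _ => Finset.sum_congr rfl fun q _ => by
        simp; ring)
  refine ⟨ε, hε, fun x => ?_⟩
  have := h fun i => x i
  rw [Fin.sum_univ_eq_sum_range (fun i => x i ^ 2) n,
    Fin.sum_univ_eq_sum_range (fun p => ∑ q : Fin n, H p q * (x p * x q)) n] at this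
  simpa only [fun p => Fin.sum_univ_eq_sum_range (fun q => H p q * (x p * x q)) n] using this

/-! ### The termination and contribution indices -/

lemma temporalMatrix_self_self (s : ℕ) (hs : 1 ≤ s) (β : ℕ → ℚ) (l : ℕ) :
    temporalMatrix s β l s s = if l ≤ s then β s * β s else 0 := by
  induction l with
  | zero => rw [temporalMatrix, if_neg (by omega), if_pos (by omega)]
  | succ l ih =>
    rw [temporalMatrix_succ s β le_rfl, ih, temporalMatrix_eq_zero_of_gt s β l (s + 1) _ (by omega)]
    split_ifs <;> first | omega | simp

lemma terminationIndex_spec (s : ℕ) (hs : 1 ≤ s) :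
    1 ≤ terminationIndex s ∧ terminationIndex s ≤ s ∧
      ∀ i < terminationIndex s, temporalMatrix s (evolutionCoeff s) i i i = 0 := by
  have hmem : s ∈ {l | 1 ≤ l ∧ temporalMatrix s (evolutionCoeff s) l l l ≠ 0} := by
    refine ⟨hs, ?_⟩
    rw [temporalMatrix_self_self s hs, if_pos le_rfl, evolutionCoeff_eq s hs, if_pos le_rfl,
      div_self (by exact_mod_cast s.factorial_ne_zero)]
    norm_num
  have hz : terminationIndex s ∈ {l | 1 ≤ l ∧ temporalMatrix s (evolutionCoeff s) l l l ≠ 0} :=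
    Nat.sInf_mem ⟨s, hmem⟩
  refine ⟨hz.1, Nat.sInf_le hmem, fun i hi => ?_⟩
  rcases Nat.eq_zero_or_pos i with rfl | h
  · rw [temporalMatrix, if_pos (by omega)]
  · by_contra hne
    exact Nat.notMem_of_lt_sInf hi ⟨h, hne⟩

lemma contributionIndex_spec (s : ℕ) :
    contributionIndex s ≤ terminationIndex s ∧ ∀ κ < contributionIndex s, 0 < leadingMinor s κ := by
  rw [contributionIndex]
  split_ifs with h
  · have hm := Nat.sInf_mem h
    refine ⟨hm.1.le, fun κ hκ => ?_⟩
    by_contra hn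
    exact Nat.notMem_of_lt_sInf hκ ⟨hκ.trans hm.1, not_lt.1 hn⟩
  · refine ⟨le_rfl, fun κ hκ => ?_⟩
    by_contra hn
    exact h ⟨κ, hκ, not_lt.1 hn⟩

/-! ### The abstract energy estimate -/

/-- A quadratic form that is coercive in the first `ρ` variables is bounded below by the remaining
variables. -/
lemma exists_neg_mul_le_of_coercive (n ρ : ℕ) (hρ : ρ ≤ n) (H : ℕ → ℕ → ℝ) (ε : ℝ) (hε : 0 < ε)
    (hH : ∀ x : ℕ → ℝ, ε * ∑ p ∈ Finset.range ρ, x p ^ 2 ≤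
      ∑ p ∈ Finset.range ρ, ∑ q ∈ Finset.range ρ, H p q * (x p * x q)) :
    ∃ C : ℝ, 0 ≤ C ∧ ∀ x : ℕ → ℝ, -(C * ∑ p ∈ Finset.Ico ρ n, x p ^ 2) ≤
      ∑ p ∈ Finset.range n, ∑ q ∈ Finset.range n, H p q * (x p * x q) := by
  rcases Nat.eq_zero_or_pos n with hn | hn
  · subst hn; exact ⟨0, le_rfl, fun x => by simp⟩
  have hn' : (0 : ℝ) < n := by exact_mod_cast hn
  set B : ℝ := ∑ p ∈ Finset.range n, ∑ q ∈ Finset.range n, |H p q| with hB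
  have hB0 : 0 ≤ B := Finset.sum_nonneg fun p _ => Finset.sum_nonneg fun q _ => abs_nonneg _
  have hHB : ∀ p < n, ∀ q < n, |H p q| ≤ B := by
    intro p hp q hq
    calc |H p q| ≤ ∑ q ∈ Finset.range n, |H p q| :=
          Finset.single_le_sum (f := fun q => |H p q|) (fun _ _ => abs_nonneg _)
            (Finset.mem_range.2 hq)
      _ ≤ B := Finset.single_le_sum (f := fun p => ∑ q ∈ Finset.range n, |H p q|)
            (fun _ _ => Finset.sum_nonneg fun _ _ => abs_nonneg _) (Finset.mem_range.2 hp)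
  set δ : ℝ := ε / (2 * n) with hδ
  have hδ0 : 0 < δ := by positivity
  set K : ℝ := B + B ^ 2 / δ with hK
  have hK0 : 0 ≤ K := by positivity
  refine ⟨2 * n * K, by positivity, fun x => ?_⟩
  let u : ℕ → ℝ := fun p => if p < ρ then x p ^ 2 else 0
  let w : ℕ → ℝ := fun p => if p < ρ then 0 else x p ^ 2
  have hpair : ∀ c X Y : ℝ, |c| ≤ B → -(δ * X ^ 2 + K * Y ^ 2) ≤ c * (X * Y) := by
    intro c X Y hc
    have h1 : -(B * (|X| * |Y|)) ≤ c * (X * Y) := by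
      have : |c * (X * Y)| ≤ B * (|X| * |Y|) := by
        rw [abs_mul, abs_mul]; gcongr
      exact (neg_le_neg this).trans (neg_abs_le _)
    have h2 : B * (|X| * |Y|) ≤ δ * X ^ 2 + K * Y ^ 2 := by
      have h3 : 0 ≤ (δ * |X| - B * |Y|) ^ 2 / δ := by positivity
      have h4 : (δ * |X| - B * |Y|) ^ 2 / δ
          = δ * X ^ 2 - 2 * (B * (|X| * |Y|)) + B ^ 2 / δ * Y ^ 2 := by
        rw [← sq_abs X, ← sq_abs Y]
        field_simp
        ring
      have h5 : 0 ≤ B * (|X| * |Y|) := by positivity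
      have h6 : 0 ≤ B * Y ^ 2 := by positivity
      rw [h4] at h3
      rw [hK]
      linarith
    linarith
  have hterm : ∀ p ∈ Finset.range n, ∀ q ∈ Finset.range n,
      (if p < ρ then (if q < ρ then H p q * (x p * x q) else 0) else 0) -
        (δ * u p + δ * u q + (K * w p + K * w q)) ≤ H p q * (x p * x q) := by
    intro p hp q hq
    have hc := hHB p (Finset.mem_range.1 hp) q (Finset.mem_range.1 hq)
    have h1 := hpair _ (x p) (x q) hc
    have h2 := hpair _ (x q) (x p) hc
    have h3 : 0 ≤ x p ^ 2 := sq_nonneg _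
    have h4 : 0 ≤ x q ^ 2 := sq_nonneg _
    simp only [u, w]
    by_cases hp' : p < ρ <;> by_cases hq' : q < ρ <;> simp only [hp', hq', if_true, if_false]
    · nlinarith
    · linarith
    · rw [mul_comm (x q) (x p)] at h2; linarith
    · have h5 : |H p q * (x p * x q)| ≤ B * ((x p ^ 2 + x q ^ 2)) := by
        rw [abs_mul, abs_mul]
        have : |x p| * |x q| ≤ x p ^ 2 + x q ^ 2 := by
          rw [← sq_abs (x p), ← sq_abs (x q)]
          nlinarith [sq_nonneg (|x p| - |x q|), sq_nonneg (|x p|), sq_nonneg (|x q|)]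
        gcongr
      have h6 := neg_abs_le (H p q * (x p * x q))
      have h7 : B ≤ K := by rw [hK]; have : 0 ≤ B ^ 2 / δ := by positivity
                            linarith
      nlinarith
  have hsum := Finset.sum_le_sum fun p hp => Finset.sum_le_sum fun q hq => hterm p hp q hq
  refine le_trans ?_ hsum
  have hu : ∑ p ∈ Finset.range n, u p = ∑ p ∈ Finset.range ρ, x p ^ 2 := by
    rw [← Finset.sum_range_add_sum_Ico _ hρ]
    rw [Finset.sum_congr rfl fun p hp => if_pos (Finset.mem_range.1 hp),
      Finset.sum_eq_zero (s := Finset.Ico ρ n) fun p hp =>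
        if_neg (not_lt.2 (Finset.mem_Ico.1 hp).1), add_zero]
  have hw : ∑ p ∈ Finset.range n, w p = ∑ p ∈ Finset.Ico ρ n, x p ^ 2 := by
    rw [← Finset.sum_range_add_sum_Ico _ hρ]
    rw [Finset.sum_eq_zero (s := Finset.range ρ) fun p hp => if_pos (Finset.mem_range.1 hp),
      Finset.sum_congr rfl fun p hp => if_neg (not_lt.2 (Finset.mem_Ico.1 hp).1), zero_add]
  have htrunc : ∀ f : ℕ → ℝ, ∑ p ∈ Finset.range n, (if p < ρ then f p else 0)
      = ∑ p ∈ Finset.range ρ, f p := by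
    intro f
    rw [← Finset.sum_range_add_sum_Ico _ hρ,
      Finset.sum_congr rfl fun p hp => if_pos (Finset.mem_range.1 hp),
      Finset.sum_eq_zero (s := Finset.Ico ρ n) fun p hp =>
        if_neg (not_lt.2 (Finset.mem_Ico.1 hp).1), add_zero]
  have hmain : ∑ p ∈ Finset.range n, ∑ q ∈ Finset.range n,
      (if p < ρ then (if q < ρ then H p q * (x p * x q) else 0) else 0)
      = ∑ p ∈ Finset.range ρ, ∑ q ∈ Finset.range ρ, H p q * (x p * x q) := by
    rw [← htrunc]
    refine Finset.sum_congr rfl fun p _ => ?_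
    split_ifs
    · exact htrunc _
    · simp
  simp only [Finset.sum_sub_distrib, Finset.sum_add_distrib, Finset.sum_const, Finset.card_range,
    ← Finset.mul_sum, nsmul_eq_mul, hmain, hu, hw]
  have h1 := hH x
  have h2 : 2 * n * δ = ε := by rw [hδ]; field_simp
  rw [← h2] at h1
  linarith

/-- The net change of the energy `a 0 0` in one step of the method.  The array `a p q` stands for
the inner products of the temporal differences of order `p` and `q`, and `b i p` for their jumps;
`μ` is the Courant number up to a factor. -/
lemma exists_energy_estimate (s : ℕ) (hs : 1 ≤ s) (Λ : ℝ) :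
    ∃ C : ℝ, 0 ≤ C ∧ ∀ (μ ϖ : ℝ) (S : Finset ℕ) (b : ℕ → ℕ → ℝ) (a : ℕ → ℕ → ℝ),
      0 ≤ μ → μ ≤ Λ → 0 ≤ ϖ → (∀ p q, a p q = a q p) → (∀ p, 0 ≤ a p p) →
      (∀ p q, a p q ^ 2 ≤ a p p * a q q) → (∀ p, a (p + 1) (p + 1) ≤ μ ^ 2 * a p p) →
      (∀ p q, a (p + 1) q + a p (q + 1) = -(ϖ * ∑ i ∈ S, b i p * b i q)) →
      (∀ p, ϖ * ∑ i ∈ S, b i p ^ 2 ≤ μ * a p p) →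
      pairing s (temporalMatrix s (evolutionCoeff s) 0) a ≤
        (terminationValue s + C * μ) * a (terminationIndex s) (terminationIndex s) +
          C * μ * a (contributionIndex s) (contributionIndex s) := by
  obtain ⟨hζ1, hζs, hζ0⟩ := terminationIndex_spec s hs
  obtain ⟨hρζ, hρ⟩ := contributionIndex_spec s
  set ζ := terminationIndex s with hζ
  set ρ := contributionIndex s with hρdef
  set T := temporalMatrix s (evolutionCoeff s) ζ with hT
  set H := spatialMatrix s (evolutionCoeff s) ζ with hH
  have hval : terminationValue s = T ζ ζ := rfl
  obtain ⟨ε, hε, hcoer⟩ := exists_coercive_of_leading_minors_pos (fun p q => (H p q : ℝ))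
    (fun p q => by rw [hH, spatialMatrix_comm]) ρ (fun κ hκ => by
      have h1 := hρ κ hκ
      have h2 : (Matrix.of fun p q : Fin (κ + 1) => (H p q : ℝ)).det = (leadingMinor s κ : ℝ) := by
        rw [leadingMinor, ← Rat.coe_castHom, RingHom.map_det]
        rfl
      rw [h2]
      exact_mod_cast h1)
  obtain ⟨C₁, hC₁, hlow⟩ := exists_neg_mul_le_of_coercive (s + 1) ρ (by omega) _ ε hε hcoer
  set B : ℝ := ∑ p ∈ Finset.range (s + 1), ∑ q ∈ Finset.range (s + 1), |(T p q : ℝ)| with hB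
  set L : ℝ := (1 + |Λ|) ^ (2 * s) with hL
  have hL1 : 1 ≤ L := one_le_pow₀ (by linarith [abs_nonneg Λ])
  have hB0 : 0 ≤ B := Finset.sum_nonneg fun p _ => Finset.sum_nonneg fun q _ => abs_nonneg _
  refine ⟨B * L + C₁ * (s + 1) * L, by positivity, ?_⟩
  intro μ ϖ S b a hμ hμΛ hϖ hsymm hnn hcs hgrow hparts hjump
  have hμpow : ∀ m : ℕ, 1 ≤ m → m ≤ 2 * s → μ ^ m ≤ μ * L := by
    intro m h1 h2
    obtain ⟨m, rfl⟩ := Nat.exists_eq_add_of_le' h1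
    rw [pow_succ, mul_comm]
    refine mul_le_mul_of_nonneg_left ?_ hμ
    calc μ ^ m ≤ (1 + |Λ|) ^ m := by
          gcongr; linarith [le_abs_self Λ]
      _ ≤ L := pow_le_pow_right₀ (by linarith [abs_nonneg Λ]) (by omega)
  have hpow : ∀ p d, a (p + d) (p + d) ≤ (μ ^ d) ^ 2 * a p p := by
    intro p d
    induction d with
    | zero => simp
    | succ d ih =>
      calc a (p + d + 1) (p + d + 1) ≤ μ ^ 2 * a (p + d) (p + d) := hgrow _
        _ ≤ μ ^ 2 * ((μ ^ d) ^ 2 * a p p) := by gcongr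
        _ = _ := by ring
  have hjsymm : ∀ p q, ϖ * ∑ i ∈ S, b i p * b i q = ϖ * ∑ i ∈ S, b i q * b i p := fun p q => by
    congr 1; exact Finset.sum_congr rfl fun i _ => mul_comm _ _
  rw [pairing_temporalMatrix_zero s _ a (fun p q => ϖ * ∑ i ∈ S, b i p * b i q) hsymm hjsymm
    hparts ζ hζs hζ0]
  -- the temporal part: only the entry at `(ζ,ζ)` comes without a power of `μ`
  have htemp : pairing s T a ≤ (terminationValue s + B * L * μ) * a ζ ζ := by
    have hterm : ∀ p ∈ Finset.range (s + 1), ∀ q ∈ Finset.range (s + 1),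
        (T p q : ℝ) * a p q ≤ (if p = ζ then (if q = ζ then (T ζ ζ : ℝ) * a ζ ζ else 0) else 0) +
          |(T p q : ℝ)| * (L * μ * a ζ ζ) := by
      intro p hp q hq
      have hp := Finset.mem_range.1 hp
      have hq := Finset.mem_range.1 hq
      have hR : 0 ≤ |(T p q : ℝ)| * (L * μ * a ζ ζ) := by have := hnn ζ; positivity
      by_cases hpq : p = ζ ∧ q = ζ
      · obtain ⟨rfl, rfl⟩ := hpq
        simp only [if_true]
        linarith
      · have h0 : (if p = ζ then (if q = ζ then (T ζ ζ : ℝ) * a ζ ζ else 0) else 0) = 0 := by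
          split_ifs <;> first | rfl | (exfalso; tauto)
        rw [h0, zero_add]
        by_cases hq' : q < ζ
        · have : T p q = 0 := temporalMatrix_eq_zero_of_lt s _ hq'
          rw [this]; simp
        by_cases hp' : p < ζ
        · have : T p q = 0 := by
            rw [hT, temporalMatrix_comm]; exact temporalMatrix_eq_zero_of_lt s _ hp'
          rw [this]; simp
        obtain ⟨d, rfl⟩ := Nat.exists_eq_add_of_le (not_lt.1 hp')
        obtain ⟨e, rfl⟩ := Nat.exists_eq_add_of_le (not_lt.1 hq')
        have h1 : |a (ζ + d) (ζ + e)| ≤ μ ^ (d + e) * a ζ ζ := by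
          refine abs_le_of_sq_le_sq ?_ (by have := hnn ζ; positivity)
          calc a (ζ + d) (ζ + e) ^ 2 ≤ a (ζ + d) (ζ + d) * a (ζ + e) (ζ + e) := hcs _ _
            _ ≤ ((μ ^ d) ^ 2 * a ζ ζ) * ((μ ^ e) ^ 2 * a ζ ζ) := by
                gcongr
                · exact hnn _
                · have := hnn ζ; positivity
                · exact hpow _ _
                · exact hpow _ _
            _ = _ := by rw [pow_add]; ring
        have h2 : μ ^ (d + e) ≤ μ * L := hμpow _ (by omega) (by omega)
        calc (T (ζ + d) (ζ + e) : ℝ) * a (ζ + d) (ζ + e)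
            ≤ |(T (ζ + d) (ζ + e) : ℝ)| * |a (ζ + d) (ζ + e)| := by
              rw [← abs_mul]; exact le_abs_self _
          _ ≤ |(T (ζ + d) (ζ + e) : ℝ)| * ((μ * L) * a ζ ζ) := by
              gcongr
              exact h1.trans (mul_le_mul_of_nonneg_right h2 (hnn ζ))
          _ = _ := by ring
    have := Finset.sum_le_sum fun p hp => Finset.sum_le_sum fun q hq => hterm p hp q hq
    refine this.trans (le_of_eq ?_)
    simp only [Finset.sum_add_distrib, ← Finset.sum_mul]
    rw [← hB]
    have hi : ∑ p ∈ Finset.range (s + 1), ∑ q ∈ Finset.range (s + 1),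
        (if p = ζ then (if q = ζ then (T ζ ζ : ℝ) * a ζ ζ else 0) else 0) = (T ζ ζ : ℝ) * a ζ ζ := by
      rw [Finset.sum_eq_single ζ, Finset.sum_eq_single ζ]
      · simp
      · intro q _ h; simp [h]
      · intro h; simp at h; omega
      · intro p _ h; simp [h]
      · intro h; simp at h; omega
    rw [hi, hval]
    ring
  -- the spatial part: only the jumps of order `≥ ρ` have the wrong sign
  have hspat : -(C₁ * (s + 1) * L * μ * a ρ ρ) ≤
      pairing s H (fun p q => ϖ * ∑ i ∈ S, b i p * b i q) := by
    have h1 : pairing s H (fun p q => ϖ * ∑ i ∈ S, b i p * b i q) = ϖ * ∑ i ∈ S,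
        ∑ p ∈ Finset.range (s + 1), ∑ q ∈ Finset.range (s + 1), (H p q : ℝ) * (b i p * b i q) := by
      rw [Finset.sum_comm, pairing, Finset.mul_sum]
      refine Finset.sum_congr rfl fun p _ => ?_
      rw [Finset.sum_comm, Finset.mul_sum]
      refine Finset.sum_congr rfl fun q _ => ?_
      rw [← Finset.mul_sum]
      ring
    have h2 : ∀ p ∈ Finset.Ico ρ (s + 1), ϖ * ∑ i ∈ S, b i p ^ 2 ≤ L * μ * a ρ ρ := by
      intro p hp
      have hp := Finset.mem_Ico.1 hp
      obtain ⟨d, rfl⟩ := Nat.exists_eq_add_of_le hp.1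
      have h3 : μ * (μ ^ d) ^ 2 ≤ μ * L := by
        rcases Nat.eq_zero_or_pos d with hd | hd
        · subst hd; simp; nlinarith
        · refine mul_le_mul_of_nonneg_left ?_ hμ
          rw [← pow_mul]
          calc μ ^ (d * 2) ≤ (1 + |Λ|) ^ (d * 2) := by
                gcongr; linarith [le_abs_self Λ]
            _ ≤ L := pow_le_pow_right₀ (by linarith [abs_nonneg Λ]) (by omega)
      calc ϖ * ∑ i ∈ S, b i (ρ + d) ^ 2 ≤ μ * a (ρ + d) (ρ + d) := hjump _
        _ ≤ μ * ((μ ^ d) ^ 2 * a ρ ρ) := by gcongr; exact hpow _ _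
        _ = μ * (μ ^ d) ^ 2 * a ρ ρ := by ring
        _ ≤ μ * L * a ρ ρ := mul_le_mul_of_nonneg_right h3 (hnn ρ)
        _ = _ := by ring
    have h3 : ϖ * ∑ i ∈ S, ∑ p ∈ Finset.Ico ρ (s + 1), b i p ^ 2 ≤ (s + 1) * (L * μ * a ρ ρ) := by
      rw [Finset.sum_comm, Finset.mul_sum]
      refine (Finset.sum_le_sum h2).trans ?_
      rw [Finset.sum_const, nsmul_eq_mul]
      have : ((Finset.Ico ρ (s + 1)).card : ℝ) ≤ s + 1 := by
        rw [Nat.card_Ico]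
        exact_mod_cast Nat.sub_le _ _
      have := hnn ρ
      gcongr
    have h4 := Finset.sum_le_sum fun i (_ : i ∈ S) => hlow (b i)
    have h5 := mul_le_mul_of_nonneg_left h4 hϖ
    rw [h1]
    refine le_trans ?_ h5
    rw [Finset.sum_neg_distrib, ← Finset.mul_sum]
    have h6 := mul_le_mul_of_nonneg_left h3 hC₁
    linarith
  have hnz := hnn ζ
  have hnr := hnn ρ
  have e1 : 0 ≤ C₁ * (s + 1) * L * μ * a ζ ζ := by positivity
  have e2 : 0 ≤ B * L * μ * a ρ ρ := by positivity
  have e3 : 0 ≤ C₁ * (s + 1) * L * μ * a ρ ρ := by positivity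
  rw [← hT, ← hH]
  linarith

/-! ### Legendre polynomials and the correction polynomial -/

/-- The integral of a polynomial over the reference element `[-1,1]`. -/
noncomputable def refInt (p : ℝ[X]) : ℝ := ∫ x in (-1 : ℝ)..1, p.eval x

lemma intervalIntegrable_eval (p : ℝ[X]) (a b : ℝ) :
    IntervalIntegrable (fun x => p.eval x) volume a b :=
  p.continuous.intervalIntegrable _ _

lemma integral_derivative_eval (p : ℝ[X]) (a b : ℝ) :
    ∫ x in a..b, (derivative p).eval x = p.eval b - p.eval a :=
  intervalIntegral.integral_eq_sub_of_hasDerivAt (fun x _ => p.hasDerivAt x)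
    (intervalIntegrable_eval _ _ _)

lemma refInt_add (p q : ℝ[X]) : refInt (p + q) = refInt p + refInt q := by
  simp only [refInt, eval_add]
  exact intervalIntegral.integral_add (intervalIntegrable_eval _ _ _) (intervalIntegrable_eval _ _ _)

lemma refInt_C_mul (c : ℝ) (p : ℝ[X]) : refInt (C c * p) = c * refInt p := by
  simp only [refInt, eval_mul, eval_C]
  exact intervalIntegral.integral_const_mul _ _

lemma refInt_sub (p q : ℝ[X]) : refInt (p - q) = refInt p - refInt q := by
  have := refInt_add (p - q) q
  rw [sub_add_cancel] at this
  linarith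

lemma refInt_zero : refInt 0 = 0 := by simp [refInt]

lemma refInt_derivative (p : ℝ[X]) : refInt (derivative p) = p.eval 1 - p.eval (-1) :=
  integral_derivative_eval p _ _

lemma refInt_mul_self_nonneg (p : ℝ[X]) : 0 ≤ refInt (p * p) :=
  intervalIntegral.integral_nonneg (by norm_num) fun x _ => by
    rw [eval_mul]; exact mul_self_nonneg _

lemma eval_iterate_derivative_eq_zero {n m : ℕ} (h : m < n) {a : ℝ} {W : ℝ[X]}
    (hW : (X - C a) ^ n ∣ W) : (derivative^[m] W).eval a = 0 := by
  obtain ⟨g, hg⟩ := pow_sub_dvd_iterate_derivative_of_pow_dvd m hW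
  rw [hg, eval_mul, eval_pow, eval_sub, eval_X, eval_C, sub_self, zero_pow (by omega), zero_mul]

/-- Integration by parts `m` times against a function with zeros of order `n ≥ m` at both ends. -/
lemma refInt_iterate_derivative_mul {n : ℕ} {W : ℝ[X]} (h1 : (X - C 1) ^ n ∣ W)
    (h2 : (X - C (-1)) ^ n ∣ W) (m : ℕ) (hm : m ≤ n) (q : ℝ[X]) (hq : q.natDegree < m) :
    refInt (derivative^[m] W * q) = 0 := by
  induction m generalizing q with
  | zero => omega
  | succ m ih =>
    have e : derivative^[m + 1] W * q
        = derivative (derivative^[m] W * q) - derivative^[m] W * derivative q := by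
      rw [Function.iterate_succ_apply', derivative_mul]; ring
    rw [e, refInt_sub, refInt_derivative, eval_mul, eval_mul,
      eval_iterate_derivative_eq_zero (by omega) h1, eval_iterate_derivative_eq_zero (by omega) h2]
    have : refInt (derivative^[m] W * derivative q) = 0 := by
      by_cases h : q.natDegree = 0
      · rw [derivative_eq_zero.2 h, mul_zero, refInt_zero]
      · refine ih (by omega) _ ?_
        have := natDegree_derivative_lt h
        omega
    rw [this]; ring

lemma sq_sub_one_pow (n : ℕ) :
    ((X : ℝ[X]) ^ 2 - 1) ^ n = (X - C 1) ^ n * (X - C (-1)) ^ n := by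
  rw [← mul_pow]
  congr 1
  simp only [map_one, map_neg]
  ring

lemma refInt_legendre_mul (n : ℕ) (q : ℝ[X]) (hq : q.natDegree < n) :
    refInt (legendre n * q) = 0 := by
  rw [legendre, mul_assoc, refInt_C_mul, refInt_iterate_derivative_mul (n := n) _ _ n le_rfl q hq,
    mul_zero]
  · rw [sq_sub_one_pow]; exact dvd_mul_right _ _
  · rw [sq_sub_one_pow]; exact dvd_mul_left _ _

lemma monic_sq_sub_one_pow (n : ℕ) : (((X : ℝ[X]) ^ 2 - 1) ^ n).Monic := by
  rw [sq_sub_one_pow]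
  exact ((monic_X_sub_C _).pow _).mul ((monic_X_sub_C _).pow _)

lemma natDegree_sq_sub_one_pow (n : ℕ) : (((X : ℝ[X]) ^ 2 - 1) ^ n).natDegree = n + n := by
  rw [sq_sub_one_pow, Monic.natDegree_mul ((monic_X_sub_C _).pow _) ((monic_X_sub_C _).pow _),
    natDegree_pow, natDegree_pow, natDegree_X_sub_C, natDegree_X_sub_C, mul_one]

lemma natDegree_legendre_le (n : ℕ) : (legendre n).natDegree ≤ n := by
  refine (natDegree_C_mul_le _ _).trans ((natDegree_iterate_derivative _ _).trans ?_)
  rw [natDegree_sq_sub_one_pow]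
  omega

lemma coeff_legendre_self_ne_zero (n : ℕ) : (legendre n).coeff n ≠ 0 := by
  rw [legendre, coeff_C_mul, coeff_iterate_derivative]
  have : ((X ^ 2 - 1 : ℝ[X]) ^ n).coeff (n + n) = 1 := by
    have := monic_sq_sub_one_pow n
    rwa [Monic, leadingCoeff, natDegree_sq_sub_one_pow] at this
  rw [this]
  have h : (n + n).descFactorial n ≠ 0 := by
    rw [Ne, Nat.descFactorial_eq_zero_iff_lt]; omega
  have hf := n.factorial_ne_zero
  simp [h, hf]

lemma eval_iterate_derivative_pow_mul (n : ℕ) (a : ℝ) (g : ℝ[X]) :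
    (derivative^[n] ((X - C a) ^ n * g)).eval a = n.factorial * g.eval a := by
  induction n generalizing g with
  | zero => simp
  | succ n ih =>
    have : derivative ((X - C a) ^ (n + 1) * g)
        = (X - C a) ^ n * (C ((n : ℝ) + 1) * g + (X - C a) * derivative g) := by
      rw [derivative_mul, derivative_X_sub_C_pow]
      simp only [Nat.add_sub_cancel, Nat.cast_add, Nat.cast_one, map_add, map_natCast, map_one]
      ring
    rw [Function.iterate_succ_apply, this, ih, Nat.factorial_succ]
    simp
    ring

lemma legendre_eval_one (n : ℕ) : (legendre n).eval 1 = 1 := by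
  rw [legendre, eval_mul, eval_C, sq_sub_one_pow, eval_iterate_derivative_pow_mul]
  have hf : (n.factorial : ℝ) ≠ 0 := by exact_mod_cast n.factorial_ne_zero
  simp only [eval_pow, eval_sub, eval_X, eval_C]
  norm_num
  field_simp

/-- By orthogonality to lower degrees, only the leading coefficient of `q` counts. -/
lemma refInt_legendre_mul_of_le (n : ℕ) (q : ℝ[X]) (hq : q.natDegree ≤ n) :
    refInt (legendre n * q) = q.coeff n * refInt (legendre n * X ^ n) := by
  rcases Nat.eq_zero_or_pos n with hn | hn
  · subst hn
    rw [eq_C_of_natDegree_le_zero hq, mul_comm, refInt_C_mul]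
    simp
  · have h : refInt (legendre n * (q - C (q.coeff n) * X ^ n)) = 0 := by
      refine refInt_legendre_mul n _ ?_
      rw [Nat.lt_iff_le_pred hn]
      refine natDegree_le_pred ((natDegree_sub_le _ _).trans
        (max_le hq (natDegree_C_mul_X_pow_le _ _))) ?_
      simp
    rw [mul_sub, refInt_sub, mul_left_comm, refInt_C_mul] at h
    linarith

/-- The quotient equals `∫ Lₙ²` divided by the square of the leading coefficient of `Lₙ`; it gives
`γ` its sign in the Gauss case. -/
lemma refInt_legendre_div_nonneg (n : ℕ) :
    0 ≤ refInt (legendre n * X ^ n) / (legendre n).coeff n := by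
  have h := refInt_mul_self_nonneg (legendre n)
  rw [refInt_legendre_mul_of_le n _ (natDegree_legendre_le n)] at h
  have h0 := coeff_legendre_self_ne_zero n
  have : refInt (legendre n * X ^ n) / (legendre n).coeff n
      = (legendre n).coeff n * refInt (legendre n * X ^ n) / (legendre n).coeff n ^ 2 := by
    field_simp
  rw [this]
  positivity

namespace IsSubdivision

variable {kind : SVKind} {k : ℕ} {y : ℕ → ℝ}

lemma strictMono (hy : IsSubdivision kind k y) {i j : ℕ} (hij : i < j) (hj : j ≤ k + 1) :
    y i < y j := by
  induction j with
  | zero => omega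
  | succ j ih =>
    rcases Nat.eq_or_lt_of_le (Nat.lt_succ_iff.1 hij) with h | h
    · subst h; exact hy.lt _ (by omega)
    · exact (ih h (by omega)).trans (hy.lt _ (by omega))

lemma injective (hy : IsSubdivision kind k y) :
    Function.Injective fun j : Fin (k + 2) => y j := by
  intro i j h
  rcases lt_trichotomy i j with h1 | h1 | h1
  · exact absurd h (hy.strictMono (Fin.lt_def.1 h1) (by omega)).ne
  · exact h1
  · exact absurd h (hy.strictMono (Fin.lt_def.1 h1) (by omega)).ne'

lemma mem_Icc (hy : IsSubdivision kind k y) {j : ℕ} (hj : j ≤ k + 1) : y j ∈ Icc (-1 : ℝ) 1 := by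
  constructor
  · rcases Nat.eq_zero_or_pos j with h | h
    · subst h; exact hy.left.ge
    · rw [← hy.left]; exact (hy.strictMono h hj).le
  · rcases Nat.eq_or_lt_of_le hj with h | h
    · subst h; exact hy.right.le
    · rw [← hy.right]; exact (hy.strictMono h le_rfl).le

end IsSubdivision

/-- A polynomial of degree at most `k + 1` with zeros at all subdivision points but `-1` does not
vanish at `-1`, unless it is `0`. -/
lemma eval_neg_one_ne_zero {kind : SVKind} {k : ℕ} {y : ℕ → ℝ} (hy : IsSubdivision kind k y)
    (S : ℝ[X]) (hS : S ≠ 0) (hdeg : S.natDegree ≤ k + 1)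
    (h : ∀ j, 1 ≤ j → j ≤ k + 1 → S.eval (y j) = 0) : S.eval (-1) ≠ 0 := by
  intro h0
  refine hS (eq_zero_of_natDegree_lt_card_of_eval_eq_zero S hy.injective (fun j => ?_) ?_)
  · by_cases hj : (j : ℕ) = 0
    · rw [hj, hy.left, h0]
    · exact h j (by omega) (by omega)
  · rw [Fintype.card_fin]; omega

/-- `R` is the correction polynomial of the scheme and `γ` the weight of the leading coefficients in
the energy inner product `∫ p q + γ p_k q_k`: `R` vanishes at the subdivision points other than
`-1`, and the last property makes `R'` represent the evaluation at `-1` in this inner product. -/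
structure IsCorrection (k : ℕ) (y : ℕ → ℝ) (R : ℝ[X]) (γ : ℝ) : Prop where
  nonneg : 0 ≤ γ
  degree : R.natDegree ≤ k + 1
  root : ∀ j, 1 ≤ j → j ≤ k + 1 → R.eval (y j) = 0
  left : R.eval (-1) = -1
  moment : ∀ q : ℝ[X], q.natDegree ≤ k →
    refInt (R * derivative q) = γ * ((derivative R).coeff k * q.coeff k)

lemma natDegree_derivative_le_of_le {k : ℕ} {q : ℝ[X]} (hq : q.natDegree ≤ k) :
    (derivative q).natDegree ≤ k - 1 :=
  (natDegree_derivative_le q).trans (by omega)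

/-- A nonzero polynomial with the required zeros and moments can be scaled to the value `-1` at
`-1`, since it already has `k + 1` other zeros. -/
lemma exists_isCorrection_of {kind : SVKind} {k : ℕ} {y : ℕ → ℝ} (hy : IsSubdivision kind k y)
    (S : ℝ[X]) (γ : ℝ) (hγ : 0 ≤ γ) (hS : S ≠ 0) (hdeg : S.natDegree ≤ k + 1)
    (h : ∀ j, 1 ≤ j → j ≤ k + 1 → S.eval (y j) = 0)
    (hm : ∀ q : ℝ[X], q.natDegree ≤ k →
      refInt (S * derivative q) = γ * ((derivative S).coeff k * q.coeff k)) :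
    ∃ R γ, IsCorrection k y R γ := by
  have h0 := eval_neg_one_ne_zero hy S hS hdeg h
  refine ⟨C (-1 / S.eval (-1)) * S, γ, hγ, (natDegree_C_mul_le _ _).trans hdeg,
    fun j h1 h2 => ?_, ?_, fun q hq => ?_⟩
  · rw [eval_mul, h j h1 h2, mul_zero]
  · rw [eval_mul, eval_C]; field_simp
  · rw [mul_assoc, refInt_C_mul, hm q hq, derivative_C_mul, coeff_C_mul]; ring

/-- In the Gauss case `R` is a multiple of `(X - 1) L_k`; its moments against derivatives see only
the leading coefficients, and this is what `γ` compensates. In the Radau case `R` is a multiple of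
`L_{k+1} - L_k`, which is orthogonal to degrees below `k`, and `γ = 0`. -/
lemma exists_isCorrection {kind : SVKind} {k : ℕ} {y : ℕ → ℝ} (hk : 1 ≤ k)
    (hy : IsSubdivision kind k y) : ∃ R γ, IsCorrection k y R γ := by
  cases kind with
  | LSV =>
    have hroot : ∀ j, 1 ≤ j → j ≤ k → (legendre k).eval (y j) = 0 := fun j h1 h2 =>
      hy.root j h1 h2
    have hL0 : legendre k ≠ 0 := fun h => coeff_legendre_self_ne_zero k (by rw [h, coeff_zero])
    have hcoef : ((X - C (1 : ℝ)) * legendre k).coeff (k + 1) = (legendre k).coeff k := by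
      rw [sub_mul, coeff_sub, coeff_X_mul, coeff_C_mul,
        coeff_eq_zero_of_natDegree_lt (Nat.lt_succ_of_le (natDegree_legendre_le k))]
      ring
    refine exists_isCorrection_of hy ((X - C 1) * legendre k)
      (k / (k + 1) * (refInt (legendre k * X ^ k) / (legendre k).coeff k))
      (mul_nonneg (by positivity) (refInt_legendre_div_nonneg k))
      (mul_ne_zero (X_sub_C_ne_zero 1) hL0) ?_ (fun j h1 h2 => ?_) (fun q hq => ?_)
    · refine natDegree_mul_le.trans ?_
      rw [natDegree_X_sub_C]
      have := natDegree_legendre_le k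
      omega
    · rw [eval_mul]
      rcases Nat.eq_or_lt_of_le h2 with h | h
      · subst h; rw [hy.right]; simp
      · rw [hroot j h1 (by omega), mul_zero]
    · have hq' := natDegree_derivative_le_of_le hq
      have e : (X - C 1) * legendre k * derivative q = legendre k * ((X - C 1) * derivative q) := by
        ring
      rw [e, refInt_legendre_mul_of_le, coeff_derivative, hcoef]
      · have e1 : ((X - C (1 : ℝ)) * derivative q).coeff k = k * q.coeff k := by
          obtain ⟨k, rfl⟩ := Nat.exists_eq_add_of_le' hk
          rw [sub_mul, coeff_sub, coeff_X_mul, coeff_C_mul, coeff_derivative,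
            coeff_eq_zero_of_natDegree_lt (p := derivative q) (by omega)]
          push_cast
          ring
        rw [e1]
        have := coeff_legendre_self_ne_zero k
        field_simp
      · refine natDegree_mul_le.trans ?_
        rw [natDegree_X_sub_C]
        omega
  | RRSV =>
    have hcoef : (legendre (k + 1) - legendre k).coeff (k + 1) ≠ 0 := by
      rw [coeff_sub, coeff_eq_zero_of_natDegree_lt (Nat.lt_succ_of_le (natDegree_legendre_le k)),
        sub_zero]
      exact coeff_legendre_self_ne_zero _
    refine exists_isCorrection_of hy (legendre (k + 1) - legendre k) 0 le_rfl
      (fun h => hcoef (by rw [h, coeff_zero])) ?_ (fun j h1 h2 => ?_) (fun q hq => ?_)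
    · exact (natDegree_sub_le _ _).trans (max_le (natDegree_legendre_le _)
        ((natDegree_legendre_le _).trans (by omega)))
    · rcases Nat.eq_or_lt_of_le h2 with h | h
      · subst h
        rw [hy.right, eval_sub, legendre_eval_one, legendre_eval_one, sub_self]
      · exact hy.root j h1 (by omega)
    · have hq' := natDegree_derivative_le_of_le hq
      rw [sub_mul, refInt_sub, refInt_legendre_mul _ _ (by omega),
        refInt_legendre_mul _ _ (by omega)]
      ring

/-! ### The energy inner product on the reference element -/

/-- The inner product `∫ p q + γ p_k q_k` on polynomials of degree at most `k`. -/
noncomputable def refInner (k : ℕ) (γ : ℝ) (p q : ℝ[X]) : ℝ :=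
  refInt (p * q) + γ * (p.coeff k * q.coeff k)

section RefInner

variable {k : ℕ} {γ : ℝ}

lemma refInner_comm (p q : ℝ[X]) : refInner k γ p q = refInner k γ q p := by
  rw [refInner, refInner, mul_comm p q, mul_comm (p.coeff k)]

lemma refInner_add_left (p p' q : ℝ[X]) :
    refInner k γ (p + p') q = refInner k γ p q + refInner k γ p' q := by
  simp only [refInner, add_mul, refInt_add, coeff_add]; ring

lemma refInner_C_mul_left (c : ℝ) (p q : ℝ[X]) :
    refInner k γ (C c * p) q = c * refInner k γ p q := by
  simp only [refInner, mul_assoc, refInt_C_mul, coeff_C_mul]; ring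

lemma refInner_self_nonneg (hγ : 0 ≤ γ) (p : ℝ[X]) : 0 ≤ refInner k γ p p :=
  add_nonneg (refInt_mul_self_nonneg p) (mul_nonneg hγ (mul_self_nonneg _))

/-- The extra term of the inner product does not disturb integration by parts, because derivatives
have no coefficient of degree `k`. -/
lemma refInner_derivative (hk : 1 ≤ k) {p q : ℝ[X]} (hp : p.natDegree ≤ k) (hq : q.natDegree ≤ k) :
    refInner k γ (derivative p) q + refInner k γ p (derivative q) =
      p.eval 1 * q.eval 1 - p.eval (-1) * q.eval (-1) := by
  have h1 := refInt_derivative (p * q)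
  rw [derivative_mul, refInt_add, eval_mul, eval_mul] at h1
  have h2 := natDegree_derivative_le_of_le hp
  have h3 := natDegree_derivative_le_of_le hq
  rw [refInner, refInner, coeff_eq_zero_of_natDegree_lt (p := derivative p) (by omega),
    coeff_eq_zero_of_natDegree_lt (p := derivative q) (by omega), ← h1]
  ring

/-- The derivative of the correction polynomial represents the evaluation at `-1`. -/
lemma IsCorrection.refInner_derivative {y : ℕ → ℝ} {R : ℝ[X]} (hR : IsCorrection k y R γ)
    (hy1 : y (k + 1) = 1) {q : ℝ[X]} (hq : q.natDegree ≤ k) :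
    refInner k γ (derivative R) q = q.eval (-1) := by
  have h1 := refInt_derivative (R * q)
  have h2 := hR.root (k + 1) (by omega) le_rfl
  rw [hy1] at h2
  rw [derivative_mul, refInt_add, eval_mul, eval_mul, h2, hR.left, hR.moment q hq] at h1
  rw [refInner]
  linarith

end RefInner

/-! ### Norms of polynomials of bounded degree -/

/-- The sum of the absolute values of the coefficients of order at most `k`. -/
noncomputable def coeffNorm (k : ℕ) (p : ℝ[X]) : ℝ := ∑ i ∈ Finset.range (k + 1), |p.coeff i|

section CoeffNorm

variable {k : ℕ}

lemma coeffNorm_nonneg (p : ℝ[X]) : 0 ≤ coeffNorm k p :=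
  Finset.sum_nonneg fun _ _ => abs_nonneg _

lemma coeffNorm_add_le (p q : ℝ[X]) : coeffNorm k (p + q) ≤ coeffNorm k p + coeffNorm k q := by
  rw [coeffNorm, coeffNorm, coeffNorm, ← Finset.sum_add_distrib]
  exact Finset.sum_le_sum fun i _ => by rw [coeff_add]; exact abs_add_le _ _

lemma coeffNorm_C_mul (c : ℝ) (p : ℝ[X]) : coeffNorm k (C c * p) = |c| * coeffNorm k p := by
  simp only [coeffNorm, coeff_C_mul, abs_mul, Finset.mul_sum]

lemma abs_coeff_le_coeffNorm (p : ℝ[X]) {i : ℕ} (hi : i ≤ k) : |p.coeff i| ≤ coeffNorm k p :=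
  Finset.single_le_sum (f := fun i => |p.coeff i|) (fun _ _ => abs_nonneg _)
    (Finset.mem_range.2 (by omega))

lemma abs_eval_le_coeffNorm {p : ℝ[X]} (hp : p.natDegree ≤ k) {x : ℝ} (hx : |x| ≤ 1) :
    |p.eval x| ≤ coeffNorm k p := by
  rw [eval_eq_sum_range' (Nat.lt_succ_of_le hp), coeffNorm]
  refine (Finset.abs_sum_le_sum_abs _ _).trans (Finset.sum_le_sum fun i _ => ?_)
  rw [abs_mul, abs_pow]
  exact mul_le_of_le_one_right (abs_nonneg _) (pow_le_one₀ (abs_nonneg _) hx)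

lemma coeffNorm_derivative_le {p : ℝ[X]} (hp : p.natDegree ≤ k) :
    coeffNorm k (derivative p) ≤ (k + 1) * ((k + 1) * coeffNorm k p) := by
  rw [coeffNorm]
  have : ∀ i ∈ Finset.range (k + 1), |(derivative p).coeff i| ≤ (k + 1) * coeffNorm k p := by
    intro i hi
    have hi := Finset.mem_range.1 hi
    rw [coeff_derivative, abs_mul, mul_comm]
    by_cases h : i + 1 ≤ k
    · have h1 := abs_coeff_le_coeffNorm p h
      have h2 : |(i : ℝ) + 1| ≤ k + 1 := by
        rw [abs_of_nonneg (by positivity)]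
        exact_mod_cast (by omega : i + 1 ≤ k + 1)
      gcongr
    · rw [coeff_eq_zero_of_natDegree_lt (by omega)]
      have := coeffNorm_nonneg (k := k) p
      simp; positivity
  refine (Finset.sum_le_sum this).trans ?_
  simp

lemma refInner_self_le {γ : ℝ} (hγ : 0 ≤ γ) {p : ℝ[X]} (hp : p.natDegree ≤ k) :
    refInner k γ p p ≤ (2 + γ) * coeffNorm k p ^ 2 := by
  have h1 : refInt (p * p) ≤ 2 * coeffNorm k p ^ 2 := by
    have := intervalIntegral.integral_mono_on (a := -1) (b := 1) (μ := volume) (by norm_num)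
      (intervalIntegrable_eval (p * p) _ _)
      (intervalIntegrable_const (c := coeffNorm k p ^ 2)) (fun x hx => by
        rw [eval_mul, ← sq, ← sq_abs]
        have := abs_eval_le_coeffNorm hp (abs_le.2 hx)
        gcongr)
    rw [intervalIntegral.integral_const] at this
    rw [refInt]
    refine this.trans (le_of_eq ?_)
    rw [smul_eq_mul]; norm_num
  have h2 : p.coeff k * p.coeff k ≤ coeffNorm k p ^ 2 := by
    rw [← sq, ← sq_abs]
    have := abs_coeff_le_coeffNorm p (le_refl k)
    gcongr
  rw [refInner, add_mul]
  gcongr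

/-- The polynomial with the given coefficients. -/
noncomputable def ofCoeffs (x : Fin (k + 1) → ℝ) : ℝ[X] := ∑ i, C (x i) * X ^ (i : ℕ)

lemma coeff_ofCoeffs (x : Fin (k + 1) → ℝ) (i : Fin (k + 1)) : (ofCoeffs x).coeff i = x i := by
  rw [ofCoeffs, finsetSum_coeff, Finset.sum_eq_single i]
  · simp
  · intro j _ h
    rw [coeff_C_mul_X_pow, if_neg (fun h' => h (Fin.ext h'.symm))]
  · simp

lemma natDegree_ofCoeffs_le (x : Fin (k + 1) → ℝ) : (ofCoeffs x).natDegree ≤ k :=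
  natDegree_sum_le_of_forall_le _ _ fun i _ =>
    (natDegree_C_mul_X_pow_le _ _).trans (Nat.lt_succ_iff.1 i.2)

lemma ofCoeffs_coeff {p : ℝ[X]} (hp : p.natDegree ≤ k) :
    ofCoeffs (k := k) (fun i => p.coeff i) = p := by
  conv_rhs => rw [as_sum_range_C_mul_X_pow' p (Nat.lt_succ_of_le hp)]
  exact Fin.sum_univ_eq_sum_range (fun i => C (p.coeff i) * X ^ i) (k + 1)

lemma ofCoeffs_smul (c : ℝ) (x : Fin (k + 1) → ℝ) : ofCoeffs (c • x) = C c * ofCoeffs x := by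
  simp only [ofCoeffs, Finset.mul_sum, Pi.smul_apply, smul_eq_mul, C_mul, mul_assoc]

/-- All positive definite quadratic forms on polynomials of degree at most `k` are equivalent. -/
lemma exists_coeffNorm_sq_le (f : ℝ[X] → ℝ)
    (hf : Continuous fun x : Fin (k + 1) → ℝ => f (ofCoeffs x))
    (hom : ∀ (c : ℝ) p, f (C c * p) = c ^ 2 * f p)
    (pos : ∀ p : ℝ[X], p.natDegree ≤ k → p ≠ 0 → 0 < f p) :
    ∃ K : ℝ, 0 < K ∧ ∀ p : ℝ[X], p.natDegree ≤ k → coeffNorm k p ^ 2 ≤ K * f p := by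
  obtain ⟨ε, hε, h⟩ := exists_pos_mul_sum_sq_le (fun x : Fin (k + 1) → ℝ => f (ofCoeffs x)) hf
    (fun c x => by rw [ofCoeffs_smul, hom])
    (fun x hx => pos _ (natDegree_ofCoeffs_le x) fun h0 => hx (by
      ext i
      rw [← coeff_ofCoeffs x i, h0]; simp))
  refine ⟨(k + 1) / ε, by positivity, fun p hp => ?_⟩
  have h1 := h fun i => p.coeff i
  simp only [ofCoeffs_coeff hp] at h1
  rw [Fin.sum_univ_eq_sum_range (fun i => p.coeff i ^ 2) (k + 1)] at h1
  have h2 : coeffNorm k p ^ 2 ≤ (k + 1) * ∑ i ∈ Finset.range (k + 1), p.coeff i ^ 2 := by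
    have := sq_sum_le_card_mul_sum_sq (s := Finset.range (k + 1)) (f := fun i => |p.coeff i|)
    simpa [coeffNorm] using this
  rw [div_mul_eq_mul_div, le_div_iff₀ hε]
  nlinarith

lemma exists_eval_ne_zero {p : ℝ[X]} (hp : p ≠ 0) : ∃ x ∈ Icc (-1 : ℝ) 1, p.eval x ≠ 0 := by
  by_contra! h
  refine hp (eq_zero_of_infinite_isRoot p ((Icc_infinite (by norm_num : (-1 : ℝ) < 1)).mono ?_))
  exact fun x hx => h x hx

lemma exists_coeffNorm_sq_le_refInt (k : ℕ) :
    ∃ K : ℝ, 0 < K ∧ ∀ p : ℝ[X], p.natDegree ≤ k → coeffNorm k p ^ 2 ≤ K * refInt (p * p) := by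
  refine exists_coeffNorm_sq_le (fun p => refInt (p * p)) ?_ (fun c p => ?_) (fun p _ h => ?_)
  · have hsum : ∀ (t : Finset (Fin (k + 1))) (g : Fin (k + 1) → ℝ[X]),
        refInt (∑ i ∈ t, g i) = ∑ i ∈ t, refInt (g i) := fun t g =>
      map_sum (⟨⟨refInt, refInt_zero⟩, refInt_add⟩ : ℝ[X] →+ ℝ) g t
    have : (fun x : Fin (k + 1) → ℝ => refInt (ofCoeffs x * ofCoeffs x)) = fun x =>
        ∑ i : Fin (k + 1), ∑ j : Fin (k + 1), x i * x j * refInt (X ^ (i : ℕ) * X ^ (j : ℕ)) := by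
      ext x
      rw [ofCoeffs, Finset.sum_mul_sum, hsum]
      refine Finset.sum_congr rfl fun i _ => ?_
      rw [hsum]
      refine Finset.sum_congr rfl fun j _ => ?_
      rw [← refInt_C_mul, C_mul]
      congr 1; ring
    rw [this]
    fun_prop
  · have : C c * p * (C c * p) = C (c ^ 2) * (p * p) := by rw [C_pow]; ring
    rw [this, refInt_C_mul]
  · obtain ⟨x, hx, hne⟩ := exists_eval_ne_zero h
    refine intervalIntegral.integral_pos (by norm_num) (p * p).continuous.continuousOn
      (fun z _ => by rw [eval_mul]; exact mul_self_nonneg _) ⟨x, hx, ?_⟩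
    rw [eval_mul]
    exact mul_self_pos.2 hne

/-- Polynomials of degree at most `k` are controlled by their values at `k + 1` points. -/
lemma exists_coeffNorm_le_of_nodes {kind : SVKind} {y : ℕ → ℝ} (hy : IsSubdivision kind k y) :
    ∃ K : ℝ, 0 < K ∧ ∀ (p : ℝ[X]) (B : ℝ), p.natDegree ≤ k →
      (∀ j, 1 ≤ j → j ≤ k + 1 → |p.eval (y j)| ≤ B) → coeffNorm k p ≤ K * B := by
  obtain ⟨K, hK, h⟩ := exists_coeffNorm_sq_le (k := k)
    (fun p => ∑ j : Fin (k + 1), p.eval (y (j + 1)) ^ 2) (by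
      simp only [ofCoeffs, eval_finsetSum, eval_mul, eval_C, eval_pow, eval_X]
      fun_prop)
    (fun c p => by simp only [eval_mul, eval_C, mul_pow, Finset.mul_sum])
    (fun p hp hne => by
      refine lt_of_le_of_ne (Finset.sum_nonneg fun _ _ => sq_nonneg _) fun h0 => hne ?_
      rw [eq_comm, Finset.sum_eq_zero_iff_of_nonneg fun _ _ => sq_nonneg _] at h0
      have hinj : Function.Injective fun j : Fin (k + 1) => y (j + 1) := by
        intro i j hij
        have := hy.injective (a₁ := i.succ) (a₂ := j.succ) (by simpa using hij)
        exact Fin.succ_injective _ this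
      refine eq_zero_of_natDegree_lt_card_of_eval_eq_zero p hinj (fun j => ?_) ?_
      · exact pow_eq_zero_iff (two_ne_zero) |>.1 (h0 j (Finset.mem_univ _))
      · rw [Fintype.card_fin]; omega)
  refine ⟨K * (k + 1) + 1, by positivity, fun p B hp hB => ?_⟩
  have hB0 : 0 ≤ B := (abs_nonneg _).trans (hB 1 le_rfl (by omega))
  have h1 : ∑ j : Fin (k + 1), p.eval (y (j + 1)) ^ 2 ≤ (k + 1) * B ^ 2 := by
    refine (Finset.sum_le_sum (g := fun _ => B ^ 2) fun j _ => ?_).trans (by simp)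
    have := hB (j + 1) (by omega) (by omega)
    rw [← sq_abs]
    gcongr
  refine (le_abs_self _).trans (abs_le_of_sq_le_sq ?_ (by positivity))
  calc coeffNorm k p ^ 2 ≤ K * ∑ j : Fin (k + 1), p.eval (y (j + 1)) ^ 2 := h p hp
    _ ≤ K * ((k + 1) * B ^ 2) := by gcongr
    _ ≤ ((K * (k + 1) + 1) * B) ^ 2 := by
        have : 0 ≤ K * (k + 1) := by positivity
        nlinarith [sq_nonneg B, mul_nonneg this (sq_nonneg B)]

end CoeffNorm

/-! ### The spatial operator on reference polynomials -/

section Operator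

variable (bc : BC) (N : ℕ) (len : ℕ → ℝ) (r : ℝ[X])

/-- The value that enters the `i`-th element from the left.  The sequence `v` consists of the
pullbacks to `[-1,1]` of the restrictions of a piecewise polynomial. -/
noncomputable def upwindTrace (v : ℕ → ℝ[X]) (i : ℕ) : ℝ :=
  if i = 0 then
    match bc with
    | .inflow => 0
    | .periodic => (v (N - 1)).eval 1
  else (v (i - 1)).eval 1

lemma upwindTrace_add (v w : ℕ → ℝ[X]) (i : ℕ) :
    upwindTrace bc N (v + w) i = upwindTrace bc N v i + upwindTrace bc N w i := by
  cases bc <;> simp only [upwindTrace, Pi.add_apply, eval_add] <;> split_ifs <;> simp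

lemma upwindTrace_smul (c : ℝ) (v : ℕ → ℝ[X]) (i : ℕ) :
    upwindTrace bc N (c • v) i = c * upwindTrace bc N v i := by
  cases bc <;> simp only [upwindTrace, Pi.smul_apply, eval_smul, smul_eq_mul] <;>
    split_ifs <;> simp

/-- The discrete advection operator `-∂ₓ`: on each element it is minus the derivative, corrected by
the jump at the left end times `r`, which is the derivative of the correction polynomial. -/
noncomputable def svOp : Module.End ℝ (ℕ → ℝ[X]) where
  toFun v i :=
    if i < N then
      C (-(2 / len i)) *
        (derivative (v i) + C ((v i).eval (-1) - upwindTrace bc N v i) * r)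
    else 0
  map_add' v w := by
    ext1 i
    simp only [Pi.add_apply, upwindTrace_add, derivative_add, eval_add]
    split_ifs
    · simp only [map_add, map_sub]; ring
    · simp
  map_smul' c v := by
    ext1 i
    simp only [Pi.smul_apply, upwindTrace_smul, RingHom.id_apply, smul_eq_C_mul,
      derivative_C_mul, eval_mul, eval_C]
    split_ifs
    · simp only [map_sub, map_mul]; ring
    · simp

variable {bc N len r}

lemma svOp_apply {v : ℕ → ℝ[X]} {i : ℕ} (hi : i < N) :
    svOp bc N len r v i = C (-(2 / len i)) *
        (derivative (v i) + C ((v i).eval (-1) - upwindTrace bc N v i) * r) :=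
  if_pos hi

variable {k : ℕ}

lemma natDegree_svOp_le (hr : r.natDegree ≤ k) {v : ℕ → ℝ[X]} (hv : ∀ i, (v i).natDegree ≤ k)
    (i : ℕ) : (svOp bc N len r v i).natDegree ≤ k := by
  by_cases hi : i < N
  · rw [svOp_apply hi]
    refine (natDegree_C_mul_le _ _).trans ((natDegree_add_le _ _).trans (max_le ?_ ?_))
    · exact (natDegree_derivative_le _).trans ((Nat.sub_le _ _).trans (hv i))
    · exact (natDegree_C_mul_le _ _).trans hr
  · have : svOp bc N len r v i = 0 := if_neg hi
    rw [this]; simp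

/-- The set of sequences of polynomials of degree at most `k`. -/
def degSubmodule (k : ℕ) : Submodule ℝ (ℕ → ℝ[X]) where
  carrier := {v | ∀ i, (v i).natDegree ≤ k}
  add_mem' hv hw i := (natDegree_add_le _ _).trans (max_le (hv i) (hw i))
  zero_mem' i := by simp
  smul_mem' c _ hv i := (natDegree_smul_le _ _).trans (hv i)

lemma svOp_mem (hr : r.natDegree ≤ k) {v : ℕ → ℝ[X]} (hv : v ∈ degSubmodule k) :
    svOp bc N len r v ∈ degSubmodule k := natDegree_svOp_le hr hv

lemma smul_svOp_pow_mem (hr : r.natDegree ≤ k) (τ : ℝ) {v : ℕ → ℝ[X]} (hv : v ∈ degSubmodule k)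
    (p : ℕ) : ((τ • svOp bc N len r) ^ p) v ∈ degSubmodule k := by
  induction p with
  | zero => simpa using hv
  | succ p ih =>
    rw [pow_succ', Module.End.mul_apply, LinearMap.smul_apply]
    exact Submodule.smul_mem _ _ (svOp_mem hr ih)

/-- The jump at the left end of the `i`-th element; for `i = N` the outflow value in the case of
the inflow boundary condition. -/
noncomputable def jump (bc : BC) (N : ℕ) (v : ℕ → ℝ[X]) (i : ℕ) : ℝ :=
  if i < N then (v i).eval (-1) - upwindTrace bc N v i
  else
    match bc with
    | .inflow => (v (N - 1)).eval 1
    | .periodic => 0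

lemma jump_of_lt {v : ℕ → ℝ[X]} {i : ℕ} (hi : i < N) :
    jump bc N v i = (v i).eval (-1) - upwindTrace bc N v i := if_pos hi

/-- Every right end value enters the next element or leaves the interval. -/
lemma sum_upwindTrace_mul (hN : 0 < N) (v w : ℕ → ℝ[X]) :
    ∑ i ∈ Finset.range N, upwindTrace bc N v i * upwindTrace bc N w i
      + jump bc N v N * jump bc N w N = ∑ i ∈ Finset.range N, (v i).eval 1 * (w i).eval 1 := by
  obtain ⟨n, rfl⟩ := Nat.exists_eq_add_of_le' hN
  rw [Finset.sum_range_succ', Finset.sum_range_succ]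
  cases bc <;> simp [upwindTrace, jump]

/-! ### The energy -/

/-- The energy inner product, equivalent to the `L²` inner product up to a factor of order one. -/
noncomputable def energy (k : ℕ) (γ : ℝ) (N : ℕ) (len : ℕ → ℝ) (v w : ℕ → ℝ[X]) : ℝ :=
  ∑ i ∈ Finset.range N, len i * refInner k γ (v i) (w i)

variable {γ : ℝ}

lemma energy_comm (v w : ℕ → ℝ[X]) : energy k γ N len v w = energy k γ N len w v :=
  Finset.sum_congr rfl fun i _ => by rw [refInner_comm]

lemma energy_add_left (v v' w : ℕ → ℝ[X]) :
    energy k γ N len (v + v') w = energy k γ N len v w + energy k γ N len v' w := by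
  simp only [energy, Pi.add_apply, refInner_add_left, mul_add, Finset.sum_add_distrib]

lemma energy_smul_left (c : ℝ) (v w : ℕ → ℝ[X]) :
    energy k γ N len (c • v) w = c * energy k γ N len v w := by
  simp only [energy, Pi.smul_apply, smul_eq_C_mul, refInner_C_mul_left, Finset.mul_sum]
  exact Finset.sum_congr rfl fun i _ => by ring

lemma energy_add_right (v w w' : ℕ → ℝ[X]) :
    energy k γ N len v (w + w') = energy k γ N len v w + energy k γ N len v w' := by
  rw [energy_comm, energy_add_left, energy_comm w, energy_comm w']

lemma energy_smul_right (c : ℝ) (v w : ℕ → ℝ[X]) :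
    energy k γ N len v (c • w) = c * energy k γ N len v w := by
  rw [energy_comm, energy_smul_left, energy_comm]

lemma energy_sum_left {ι : Type*} (t : Finset ι) (f : ι → ℕ → ℝ[X]) (w : ℕ → ℝ[X]) :
    energy k γ N len (∑ i ∈ t, f i) w = ∑ i ∈ t, energy k γ N len (f i) w :=
  map_sum (⟨⟨fun v => energy k γ N len v w, by
    have := energy_smul_left (k := k) (γ := γ) (N := N) (len := len) 0 0 w
    simpa using this⟩, fun v v' => energy_add_left v v' w⟩ : (ℕ → ℝ[X]) →+ ℝ) f t

lemma energy_sum_right {ι : Type*} (t : Finset ι) (f : ι → ℕ → ℝ[X]) (w : ℕ → ℝ[X]) :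
    energy k γ N len w (∑ i ∈ t, f i) = ∑ i ∈ t, energy k γ N len w (f i) := by
  rw [energy_comm, energy_sum_left]
  exact Finset.sum_congr rfl fun i _ => energy_comm _ _

lemma energy_self_nonneg (hγ : 0 ≤ γ) (hlen : ∀ i < N, 0 < len i) (v : ℕ → ℝ[X]) :
    0 ≤ energy k γ N len v v :=
  Finset.sum_nonneg fun i hi =>
    mul_nonneg (hlen i (Finset.mem_range.1 hi)).le (refInner_self_nonneg hγ _)

lemma energy_sq_le (hγ : 0 ≤ γ) (hlen : ∀ i < N, 0 < len i) (v w : ℕ → ℝ[X]) :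
    energy k γ N len v w ^ 2 ≤ energy k γ N len v v * energy k γ N len w w := by
  have h : ∀ x : ℝ, 0 ≤ energy k γ N len w w * (x * x) + 2 * energy k γ N len v w * x
      + energy k γ N len v v := by
    intro x
    have := energy_self_nonneg (k := k) hγ hlen (v + x • w)
    simp only [energy_add_left, energy_add_right, energy_smul_left, energy_smul_right,
      energy_comm w v] at this
    linarith
  have := discrim_le_zero h
  rw [discrim] at this
  linarith

/-- Young's inequality for the energy. -/
lemma energy_add_self_le (hγ : 0 ≤ γ) (hlen : ∀ i < N, 0 < len i) (v w : ℕ → ℝ[X]) {t : ℝ}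
    (ht : 0 < t) : energy k γ N len (v + w) (v + w) ≤
      (1 + t) * energy k γ N len v v + (1 + 1 / t) * energy k γ N len w w := by
  have := energy_self_nonneg (k := k) hγ hlen (t • v + (-1 : ℝ) • w)
  simp only [energy_add_left, energy_add_right, energy_smul_left, energy_smul_right,
      energy_comm w v] at this ⊢
  have h2 : 2 * energy k γ N len v w ≤ t * energy k γ N len v v + 1 / t * energy k γ N len w w := by
    have h3 : t * (2 * energy k γ N len v w) ≤
        t * (t * energy k γ N len v v + 1 / t * energy k γ N len w w) := by
      have : t * (1 / t * energy k γ N len w w) = energy k γ N len w w := by field_simp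
      rw [mul_add, this]
      linarith
    exact le_of_mul_le_mul_left h3 ht
  linarith

/-- Discrete integration by parts: the operator is skew-symmetric up to the jumps. -/
lemma energy_svOp_add {y : ℕ → ℝ} {R : ℝ[X]} (hk : 1 ≤ k) (hR : IsCorrection k y R γ)
    (hy1 : y (k + 1) = 1) (hN : 0 < N) (hlen : ∀ i < N, 0 < len i) {v w : ℕ → ℝ[X]}
    (hv : v ∈ degSubmodule k) (hw : w ∈ degSubmodule k) :
    energy k γ N len (svOp bc N len (derivative R) v) w
      + energy k γ N len v (svOp bc N len (derivative R) w) =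
      -(2 * ∑ i ∈ Finset.range (N + 1), jump bc N v i * jump bc N w i) := by
  have hone : ∀ i ∈ Finset.range N,
      len i * refInner k γ (svOp bc N len (derivative R) v i) (w i)
        + len i * refInner k γ (v i) (svOp bc N len (derivative R) w i) =
      -2 * ((v i).eval 1 * (w i).eval 1) + 2 * (upwindTrace bc N v i * upwindTrace bc N w i)
        - 2 * (jump bc N v i * jump bc N w i) := by
    intro i hi
    have hi := Finset.mem_range.1 hi
    have h1 := refInner_derivative (γ := γ) hk (hv i) (hw i)
    have h2 := hR.refInner_derivative hy1 (hw i)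
    have h3 := hR.refInner_derivative hy1 (hv i)
    have hl := (hlen i hi).ne'
    rw [refInner_comm (v i) (derivative (w i))] at h1
    rw [refInner_comm (v i), svOp_apply hi, svOp_apply hi, refInner_C_mul_left,
      refInner_C_mul_left, refInner_add_left, refInner_add_left, refInner_C_mul_left,
      refInner_C_mul_left, h2, h3, jump_of_lt hi, jump_of_lt hi]
    have h4 : refInner k γ (derivative (v i)) (w i) = (v i).eval 1 * (w i).eval 1
        - (v i).eval (-1) * (w i).eval (-1) - refInner k γ (derivative (w i)) (v i) := by linarith
    rw [h4]
    field_simp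
    ring
  rw [energy, energy, ← Finset.sum_add_distrib, Finset.sum_congr rfl hone,
    Finset.sum_sub_distrib, Finset.sum_add_distrib, ← Finset.mul_sum, ← Finset.mul_sum,
    ← Finset.mul_sum, ← sum_upwindTrace_mul (bc := bc) hN v w, Finset.sum_range_succ]
  ring

/-! ### Inverse estimates -/

/-- The lengths of the elements lie between `α h` and `h`. -/
structure QuasiUniform (N : ℕ) (len : ℕ → ℝ) (α h : ℝ) : Prop where
  card_pos : 0 < N
  α_pos : 0 < α
  h_pos : 0 < h
  le_len : ∀ i < N, α * h ≤ len i
  len_le : ∀ i < N, len i ≤ h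

lemma QuasiUniform.len_pos {α h : ℝ} (H : QuasiUniform N len α h) : ∀ i < N, 0 < len i :=
  fun i hi => (mul_pos H.α_pos H.h_pos).trans_le (H.le_len i hi)

lemma sum_upwindTrace_sq_le (hN : 0 < N) {v : ℕ → ℝ[X]} (hv : v ∈ degSubmodule k) :
    ∑ i ∈ Finset.range N, upwindTrace bc N v i ^ 2 ≤
      ∑ i ∈ Finset.range N, coeffNorm k (v i) ^ 2 := by
  have h := sum_upwindTrace_mul (bc := bc) hN v v
  have h1 : ∑ i ∈ Finset.range N, (v i).eval 1 * (v i).eval 1 ≤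
      ∑ i ∈ Finset.range N, coeffNorm k (v i) ^ 2 := Finset.sum_le_sum fun i _ => by
    have := abs_eval_le_coeffNorm (hv i) (x := 1) (by simp)
    rw [← sq, ← sq_abs]
    gcongr
  have h2 := mul_self_nonneg (jump bc N v N)
  simp only [sq (upwindTrace _ _ _ _)]
  linarith

lemma sum_jump_sq_le (hN : 0 < N) {v : ℕ → ℝ[X]} (hv : v ∈ degSubmodule k) :
    ∑ i ∈ Finset.range (N + 1), jump bc N v i ^ 2 ≤
      4 * ∑ i ∈ Finset.range N, coeffNorm k (v i) ^ 2 := by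
  have h1 : ∑ i ∈ Finset.range N, (v i).eval 1 * (v i).eval 1 ≤
      ∑ i ∈ Finset.range N, coeffNorm k (v i) ^ 2 := Finset.sum_le_sum fun i _ => by
    have := abs_eval_le_coeffNorm (hv i) (x := 1) (by simp)
    rw [← sq, ← sq_abs]
    gcongr
  have h := sum_upwindTrace_mul (bc := bc) hN v v
  have h2 : ∑ i ∈ Finset.range N, jump bc N v i ^ 2 ≤ ∑ i ∈ Finset.range N,
      (2 * coeffNorm k (v i) ^ 2 + 2 * (upwindTrace bc N v i * upwindTrace bc N v i)) :=
    Finset.sum_le_sum fun i hi => by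
      rw [jump_of_lt (Finset.mem_range.1 hi)]
      have h3 := abs_eval_le_coeffNorm (hv i) (x := -1) (by simp)
      have h4 : (v i).eval (-1) ^ 2 ≤ coeffNorm k (v i) ^ 2 := by
        rw [← sq_abs]; gcongr
      nlinarith [sq_nonneg ((v i).eval (-1) + upwindTrace bc N v i)]
  rw [Finset.sum_add_distrib, ← Finset.mul_sum, ← Finset.mul_sum] at h2
  rw [Finset.sum_range_succ]
  have h5 := mul_self_nonneg (jump bc N v N)
  have h6 : 0 ≤ ∑ i ∈ Finset.range N, upwindTrace bc N v i * upwindTrace bc N v i :=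
    Finset.sum_nonneg fun _ _ => mul_self_nonneg _
  nlinarith

/-- The bound of the operator on one element, before scaling by the length of the element. -/
lemma coeffNorm_correctedDeriv_le {p : ℝ[X]} (hp : p.natDegree ≤ k) (c : ℝ) :
    coeffNorm k (derivative p + C c * r) ≤
      ((k + 1) * (k + 1) + coeffNorm k r) * (coeffNorm k p + |c|) := by
  have h1 := coeffNorm_add_le (k := k) (derivative p) (C c * r)
  rw [coeffNorm_C_mul] at h1
  have h2 := coeffNorm_derivative_le hp
  have h3 := coeffNorm_nonneg (k := k) r
  have h4 := coeffNorm_nonneg (k := k) p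
  have h5 : 0 ≤ ((k : ℝ) + 1) * (k + 1) * |c| := by positivity
  have h6 : 0 ≤ coeffNorm k r * coeffNorm k p := by positivity
  nlinarith

/-- The inverse estimates for the operator and for the jumps. -/
lemma exists_inverse_estimate (k : ℕ) {γ α : ℝ} (hγ : 0 ≤ γ) (hα : 0 < α) {r : ℝ[X]}
    (hr : r.natDegree ≤ k) :
    ∃ c : ℝ, 0 < c ∧ ∀ (bc : BC) (N : ℕ) (len : ℕ → ℝ) (h : ℝ), QuasiUniform N len α h →
      ∀ v ∈ degSubmodule k,
        energy k γ N len (svOp bc N len r v) (svOp bc N len r v) ≤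
          (c / h) ^ 2 * energy k γ N len v v ∧
        2 * ∑ i ∈ Finset.range (N + 1), jump bc N v i ^ 2 ≤ c / h * energy k γ N len v v := by
  obtain ⟨K, hK, hKp⟩ := exists_coeffNorm_sq_le_refInt k
  set A : ℝ := (k + 1) * (k + 1) + coeffNorm k r with hA
  have hA0 : 0 ≤ A := add_nonneg (by positivity) (coeffNorm_nonneg _)
  set c₂ : ℝ := 4 * ((2 + γ) * A ^ 2 * 10) * K / α ^ 2 with hc₂
  set c₁ : ℝ := 8 * K / α with hc₁
  have hc₂0 : 0 ≤ c₂ := by positivity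
  have hc₁0 : 0 < c₁ := by positivity
  refine ⟨1 + c₁ + c₂, by positivity, fun bc N len h H v hv => ?_⟩
  have hh := H.h_pos
  have hαh : 0 < α * h := mul_pos hα hh
  -- the unweighted sum is bounded by the energy
  have hsum : (∑ i ∈ Finset.range N, coeffNorm k (v i) ^ 2) ≤
      K / (α * h) * energy k γ N len v v := by
    rw [energy, Finset.mul_sum]
    refine Finset.sum_le_sum fun i hi => ?_
    have hi := Finset.mem_range.1 hi
    have h1 : coeffNorm k (v i) ^ 2 ≤ K * refInner k γ (v i) (v i) := by
      refine (hKp _ (hv i)).trans ?_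
      rw [refInner]
      have := mul_nonneg hγ (mul_self_nonneg ((v i).coeff k))
      gcongr
      linarith
    have h2 := refInner_self_nonneg (k := k) hγ (v i)
    have h3 : 1 ≤ len i / (α * h) := by
      rw [le_div_iff₀ hαh]; linarith [H.le_len i hi]
    calc coeffNorm k (v i) ^ 2 ≤ K * refInner k γ (v i) (v i) * 1 := by rw [mul_one]; exact h1
      _ ≤ K * refInner k γ (v i) (v i) * (len i / (α * h)) := by gcongr
      _ = _ := by ring
  have hE := energy_self_nonneg (k := k) hγ H.len_pos v
  constructor
  · have hterm : ∀ i ∈ Finset.range N,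
        len i * refInner k γ (svOp bc N len r v i) (svOp bc N len r v i) ≤
        4 / (α * h) * ((2 + γ) * A ^ 2) *
          (6 * coeffNorm k (v i) ^ 2 + 4 * upwindTrace bc N v i ^ 2) := by
      intro i hi
      have hi := Finset.mem_range.1 hi
      have hl := H.len_pos i hi
      set g := derivative (v i) + C ((v i).eval (-1) - upwindTrace bc N v i) * r with hg
      have hgdeg : g.natDegree ≤ k := by
        refine (natDegree_add_le _ _).trans (max_le ?_ ?_)
        · exact (natDegree_derivative_le _).trans ((Nat.sub_le _ _).trans (hv i))
        · exact (natDegree_C_mul_le _ _).trans hr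
      have e1 : len i * refInner k γ (svOp bc N len r v i) (svOp bc N len r v i)
          = 4 / len i * refInner k γ g g := by
        rw [svOp_apply hi, ← hg, refInner_C_mul_left, refInner_comm g, refInner_C_mul_left]
        field_simp
        ring
      have h1 := refInner_self_le hγ hgdeg
      have h2 := coeffNorm_correctedDeriv_le (r := r) (hv i)
        ((v i).eval (-1) - upwindTrace bc N v i)
      rw [← hg, ← hA] at h2
      have h3 := abs_eval_le_coeffNorm (hv i) (x := -1) (by simp)
      have h4 : coeffNorm k (v i) + |(v i).eval (-1) - upwindTrace bc N v i| ≤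
          2 * coeffNorm k (v i) + |upwindTrace bc N v i| := by
        have := abs_sub ((v i).eval (-1)) (upwindTrace bc N v i)
        linarith
      have h5 := coeffNorm_nonneg (k := k) g
      have h6 := coeffNorm_nonneg (k := k) (v i)
      have h7 : coeffNorm k g ^ 2 ≤
          A ^ 2 * (6 * coeffNorm k (v i) ^ 2 + 4 * upwindTrace bc N v i ^ 2) := by
        calc coeffNorm k g ^ 2 ≤ (A * (2 * coeffNorm k (v i) + |upwindTrace bc N v i|)) ^ 2 := by
              gcongr
              exact h2.trans (by gcongr)
          _ = A ^ 2 * (2 * coeffNorm k (v i) + |upwindTrace bc N v i|) ^ 2 := by ring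
          _ ≤ _ := by
              refine mul_le_mul_of_nonneg_left ?_ (sq_nonneg A)
              rw [← sq_abs (upwindTrace bc N v i)]
              nlinarith [sq_nonneg (coeffNorm k (v i) - |upwindTrace bc N v i|),
                sq_nonneg (|upwindTrace bc N v i|)]
      have h8 := refInner_self_nonneg (k := k) hγ g
      rw [e1]
      calc 4 / len i * refInner k γ g g ≤ 4 / (α * h) * refInner k γ g g := by
            have := H.le_len i hi
            gcongr
        _ ≤ 4 / (α * h) * ((2 + γ) * (A ^ 2 * (6 * coeffNorm k (v i) ^ 2
              + 4 * upwindTrace bc N v i ^ 2))) := by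
            gcongr
            exact h1.trans (by gcongr)
        _ = _ := by ring
    rw [energy]
    refine (Finset.sum_le_sum hterm).trans ?_
    rw [← Finset.mul_sum, Finset.sum_add_distrib, ← Finset.mul_sum, ← Finset.mul_sum]
    have h1 := sum_upwindTrace_sq_le (bc := bc) H.card_pos hv
    calc 4 / (α * h) * ((2 + γ) * A ^ 2) * (6 * ∑ i ∈ Finset.range N, coeffNorm k (v i) ^ 2
          + 4 * ∑ i ∈ Finset.range N, upwindTrace bc N v i ^ 2)
        ≤ 4 / (α * h) * ((2 + γ) * A ^ 2) *
          (10 * (K / (α * h) * energy k γ N len v v)) := by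
          gcongr
          linarith
      _ = c₂ / h ^ 2 * energy k γ N len v v := by rw [hc₂]; field_simp
      _ ≤ ((1 + c₁ + c₂) / h) ^ 2 * energy k γ N len v v := by
          rw [div_pow]
          gcongr
          nlinarith
  · have h1 := sum_jump_sq_le (bc := bc) H.card_pos hv
    calc 2 * ∑ i ∈ Finset.range (N + 1), jump bc N v i ^ 2
        ≤ 2 * (4 * (K / (α * h) * energy k γ N len v v)) := by linarith
      _ = c₁ / h * energy k γ N len v v := by rw [hc₁]; field_simp; ring
      _ ≤ (1 + c₁ + c₂) / h * energy k γ N len v v := by gcongr; linarith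

end Operator

/-! ### Stability of the fully discrete scheme -/

/-- One step of the Runge-Kutta method for `φ' = L φ`, with `E = τ L`: the truncated exponential
of `E`. -/
noncomputable def rkStep (s : ℕ) (E : Module.End ℝ (ℕ → ℝ[X])) : Module.End ℝ (ℕ → ℝ[X]) :=
  ∑ κ ∈ Finset.range (s + 1), (1 / (κ.factorial : ℝ)) • E ^ κ

lemma rkStep_apply (s : ℕ) (E : Module.End ℝ (ℕ → ℝ[X])) (v : ℕ → ℝ[X]) :
    rkStep s E v = ∑ κ ∈ Finset.range (s + 1), (1 / (κ.factorial : ℝ)) • (E ^ κ) v := by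
  simp [rkStep, LinearMap.sum_apply]

section

variable {bc : BC} {N : ℕ} {len : ℕ → ℝ} {k : ℕ} {γ : ℝ}

/-- The energy of the new value, written with the initial matrix `c⁽⁰⁾` of the process: as
`β_p = s!/p!`, its entries are the products of the coefficients of the truncated exponential, up to
the factor `(s!)²`. -/
lemma pairing_temporalMatrix_eq (s : ℕ) (hs : 1 ≤ s) (E : Module.End ℝ (ℕ → ℝ[X]))
    (v : ℕ → ℝ[X]) :
    energy k γ N len (rkStep s E v) (rkStep s E v) = energy k γ N len v v +
      1 / (s.factorial : ℝ) ^ 2 * pairing s (temporalMatrix s (evolutionCoeff s) 0)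
        (fun p q => energy k γ N len ((E ^ p) v) ((E ^ q) v)) := by
  set a : ℕ → ℕ → ℝ := fun p q => energy k γ N len ((E ^ p) v) ((E ^ q) v) with ha
  have hs0 : (s.factorial : ℝ) ≠ 0 := by exact_mod_cast s.factorial_ne_zero
  have h1 : energy k γ N len (rkStep s E v) (rkStep s E v) =
      ∑ p ∈ Finset.range (s + 1), ∑ q ∈ Finset.range (s + 1),
        (1 / (p.factorial : ℝ)) * (1 / (q.factorial : ℝ)) * a p q := by
    rw [rkStep_apply, energy_sum_left]
    refine Finset.sum_congr rfl fun p _ => ?_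
    rw [energy_sum_right]
    refine Finset.sum_congr rfl fun q _ => ?_
    rw [energy_smul_left, energy_smul_right, mul_assoc]
  have h2 : ∀ p ∈ Finset.range (s + 1), ∀ q ∈ Finset.range (s + 1),
      (1 / (p.factorial : ℝ)) * (1 / (q.factorial : ℝ)) * a p q =
        (if p = 0 then (if q = 0 then a 0 0 else 0) else 0) + 1 / (s.factorial : ℝ) ^ 2 *
          ((temporalMatrix s (evolutionCoeff s) 0 p q : ℝ) * a p q) := by
    intro p hp q hq
    have hp := Finset.mem_range.1 hp
    have hq := Finset.mem_range.1 hq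
    by_cases h : p = 0 ∧ q = 0
    · obtain ⟨rfl, rfl⟩ := h
      simp [temporalMatrix]
    · have h0 : (if p = 0 then (if q = 0 then a 0 0 else 0) else 0) = 0 := by
        split_ifs <;> first | rfl | (exfalso; tauto)
      rw [h0, temporalMatrix, if_neg (by omega), evolutionCoeff_eq s hs, evolutionCoeff_eq s hs,
        if_pos (by omega), if_pos (by omega)]
      push_cast
      have hp0 : (p.factorial : ℝ) ≠ 0 := by exact_mod_cast p.factorial_ne_zero
      have hq0 : (q.factorial : ℝ) ≠ 0 := by exact_mod_cast q.factorial_ne_zero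
      field_simp
      ring
  rw [h1, Finset.sum_congr rfl fun p hp => Finset.sum_congr rfl fun q hq => h2 p hp q hq]
  simp only [Finset.sum_add_distrib, ← Finset.mul_sum]
  congr 1
  rw [Finset.sum_eq_single 0, Finset.sum_eq_single 0]
  · simp [ha]
  · intro q _ h; simp [h]
  · simp
  · intro p _ h; simp [h]
  · simp

end

/-- The change of the energy in one step, in terms of the Courant number `μ = c τ / h`. -/
lemma exists_energy_step_estimate (s : ℕ) (hs : 1 ≤ s) {k : ℕ} (hk : 1 ≤ k) {y : ℕ → ℝ} {R : ℝ[X]}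
    {γ α : ℝ} (hα : 0 < α) (hR : IsCorrection k y R γ) (hy1 : y (k + 1) = 1) :
    ∃ c : ℝ, 0 < c ∧ ∀ Λ : ℝ, ∃ C : ℝ, 0 ≤ C ∧ ∀ (bc : BC) (N : ℕ) (len : ℕ → ℝ) (h τ : ℝ),
      QuasiUniform N len α h → 0 ≤ τ → c * (τ / h) ≤ Λ → ∀ v ∈ degSubmodule k, ∃ a : ℕ → ℝ,
        (∀ p, 0 ≤ a p ∧ a p ≤ (c * (τ / h)) ^ (2 * p) * energy k γ N len v v) ∧
        energy k γ N len (rkStep s (τ • svOp bc N len (derivative R)) v)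
          (rkStep s (τ • svOp bc N len (derivative R)) v) ≤ energy k γ N len v v +
          1 / (s.factorial : ℝ) ^ 2 *
          ((terminationValue s + C * (c * (τ / h))) * a (terminationIndex s) +
            C * (c * (τ / h)) * a (contributionIndex s)) := by
  have hr : (derivative R).natDegree ≤ k :=
    (natDegree_derivative_le _).trans (by have := hR.degree; omega)
  obtain ⟨c, hc, hinv⟩ := exists_inverse_estimate k hR.nonneg hα hr
  refine ⟨c, hc, fun Λ => ?_⟩
  obtain ⟨C, hC, hest⟩ := exists_energy_estimate s hs Λ
  refine ⟨C, hC, fun bc N len h τ H hτ hΛ v hv => ?_⟩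
  set E := τ • svOp bc N len (derivative R) with hE
  have hh := H.h_pos
  have hμ : 0 ≤ c * (τ / h) := by positivity
  have hmem : ∀ p, (E ^ p) v ∈ degSubmodule k := smul_svOp_pow_mem hr τ hv
  have hsucc : ∀ p, (E ^ (p + 1)) v = τ • svOp bc N len (derivative R) ((E ^ p) v) := fun p => by
    rw [pow_succ', Module.End.mul_apply, hE, LinearMap.smul_apply]
  have hnn : ∀ p, 0 ≤ energy k γ N len ((E ^ p) v) ((E ^ p) v) := fun p =>
    energy_self_nonneg hR.nonneg H.len_pos _
  have hgrow : ∀ p, energy k γ N len ((E ^ (p + 1)) v) ((E ^ (p + 1)) v) ≤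
      (c * (τ / h)) ^ 2 * energy k γ N len ((E ^ p) v) ((E ^ p) v) := by
    intro p
    rw [hsucc, energy_smul_left, energy_smul_right]
    have := (hinv bc N len h H _ (hmem p)).1
    calc _ ≤ τ * (τ * ((c / h) ^ 2 * energy k γ N len ((E ^ p) v) ((E ^ p) v))) := by gcongr
      _ = _ := by ring
  refine ⟨fun p => energy k γ N len ((E ^ p) v) ((E ^ p) v), fun p => ⟨hnn p, ?_⟩, ?_⟩
  · induction p with
    | zero => simp
    | succ p ih =>
      refine (hgrow p).trans ?_
      calc _ ≤ (c * (τ / h)) ^ 2 * ((c * (τ / h)) ^ (2 * p) * energy k γ N len v v) := by gcongr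
        _ = _ := by ring
  · rw [pairing_temporalMatrix_eq s hs]
    gcongr
    refine hest (c * (τ / h)) (2 * τ) (Finset.range (N + 1)) (fun i p => jump bc N ((E ^ p) v) i)
      (fun p q => energy k γ N len ((E ^ p) v) ((E ^ q) v)) hμ hΛ (by positivity)
      (fun p q => energy_comm _ _) hnn (fun p q => energy_sq_le hR.nonneg H.len_pos _ _) hgrow
      (fun p q => ?_) (fun p => ?_)
    · have := energy_svOp_add (bc := bc) hk hR hy1 H.card_pos H.len_pos (hmem p) (hmem q)
      rw [hsucc, hsucc, energy_smul_left, energy_smul_right, ← mul_add, this]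
      ring
    · have := (hinv bc N len h H _ (hmem p)).2
      calc _ = τ * (2 * ∑ i ∈ Finset.range (N + 1), jump bc N ((E ^ p) v) i ^ 2) := by ring
        _ ≤ τ * (c / h * energy k γ N len ((E ^ p) v) ((E ^ p) v)) := by gcongr
        _ = _ := by ring

/-- One step of the scheme on the given mesh amplifies the energy at most by `1 + C τ`. -/
def StableStep (s k : ℕ) (bc : BC) (R : ℝ[X]) (γ : ℝ) (N : ℕ) (len : ℕ → ℝ) (τ C : ℝ) : Prop :=
  ∀ v ∈ degSubmodule k,
    energy k γ N len (rkStep s (τ • svOp bc N len (derivative R)) v)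
      (rkStep s (τ • svOp bc N len (derivative R)) v) ≤ (1 + C * τ) * energy k γ N len v v

lemma pow_le_mul_pow {μ Λ : ℝ} (hμ : 0 ≤ μ) (hΛ : μ ≤ Λ) {e m M : ℕ} (h1 : e ≤ m) (h2 : m ≤ M) :
    μ ^ m ≤ (1 + Λ) ^ M * μ ^ e := by
  obtain ⟨d, rfl⟩ := Nat.exists_eq_add_of_le h1
  rw [pow_add, mul_comm]
  gcongr
  calc μ ^ d ≤ (1 + Λ) ^ d := by gcongr; linarith
    _ ≤ (1 + Λ) ^ M := pow_le_pow_right₀ (by linarith) (by omega)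

/-- If the jumps do no harm below the order `ζ`, then for a small Courant number the negative term of
order `ζ` absorbs everything else, and the energy does not grow. -/
lemma exists_stableStep_of_neg (s : ℕ) (hs : 1 ≤ s) {k : ℕ} (hk : 1 ≤ k) {y : ℕ → ℝ} {R : ℝ[X]}
    {γ α : ℝ} (hα : 0 < α) (hR : IsCorrection k y R γ) (hy1 : y (k + 1) = 1)
    (hneg : terminationValue s < 0)
    (hρ : contributionIndex s = terminationIndex s) :
    ∃ lam : ℝ, 0 < lam ∧ ∀ (bc : BC) (N : ℕ) (len : ℕ → ℝ) (h τ : ℝ), QuasiUniform N len α h →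
      0 ≤ τ → τ / h ≤ lam → StableStep s k bc R γ N len τ 0 := by
  obtain ⟨c, hc, hΛ⟩ := exists_energy_step_estimate s hs hk hα hR hy1
  obtain ⟨C, hC, hest⟩ := hΛ 1
  have hneg' : (terminationValue s : ℝ) < 0 := by exact_mod_cast hneg
  set t : ℝ := -(terminationValue s : ℝ) with ht
  have ht0 : 0 < t := by linarith
  refine ⟨min (1 / c) (t / (2 * C + 1) / c), by positivity, fun bc N len h τ H hτ hlam v hv => ?_⟩
  have h1 : c * (τ / h) ≤ 1 := by
    have := hlam.trans (min_le_left _ _)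
    rw [le_div_iff₀ hc] at this; linarith
  have h2 : c * (τ / h) * (2 * C + 1) ≤ t := by
    have := hlam.trans (min_le_right _ _)
    rw [le_div_iff₀ hc, le_div_iff₀ (by positivity)] at this; linarith
  obtain ⟨a, ha, hle⟩ := hest bc N len h τ H hτ h1 v hv
  refine hle.trans ?_
  rw [hρ, zero_mul, add_zero, one_mul]
  have hh := H.h_pos
  have hμ : 0 ≤ c * (τ / h) := by positivity
  have h3 : ((terminationValue s : ℝ) + C * (c * (τ / h))) * a (terminationIndex s) +
      C * (c * (τ / h)) * a (terminationIndex s) ≤ 0 := by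
    rw [← add_mul]
    refine mul_nonpos_of_nonpos_of_nonneg ?_ (ha _).1
    nlinarith
  have : 0 ≤ 1 / (s.factorial : ℝ) ^ 2 := by positivity
  nlinarith

/-- Stability under a restriction `(τ/h) ^ e ≤ K τ`, where `e ≤ 2ρ + 1`, and `e ≤ 2ζ` unless the
value at the termination index is negative. -/
lemma exists_stableStep_of_pow (s : ℕ) (hs : 1 ≤ s) {k : ℕ} (hk : 1 ≤ k) {y : ℕ → ℝ} {R : ℝ[X]}
    {γ α : ℝ} (hα : 0 < α) (hR : IsCorrection k y R γ) (hy1 : y (k + 1) = 1)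
    (e : ℕ) (he : 1 ≤ e) (he1 : e ≤ 2 * contributionIndex s + 1)
    (he2 : terminationValue s < 0 ∨ e ≤ 2 * terminationIndex s) (T K : ℝ) (hT : 0 < T) :
    ∃ lam C : ℝ, 0 < lam ∧ 0 ≤ C ∧
      ∀ (bc : BC) (N : ℕ) (len : ℕ → ℝ) (h τ : ℝ), QuasiUniform N len α h →
      0 ≤ τ → τ ≤ T → (τ / h) ^ e ≤ K * τ → τ / h ≤ lam ∧ StableStep s k bc R γ N len τ C := by
  obtain ⟨c, hc, hΛ⟩ := exists_energy_step_estimate s hs hk hα hR hy1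
  set lam : ℝ := 1 + |K| * T with hlam
  have hlam1 : 1 ≤ lam := by
    have := mul_nonneg (abs_nonneg K) hT.le
    linarith
  obtain ⟨C, hC, hest⟩ := hΛ (c * lam)
  have hρζ := (contributionIndex_spec s).1
  set ζ := terminationIndex s with hζ
  set ρ := contributionIndex s with hρdef
  set t : ℝ := max 0 (terminationValue s : ℝ) with ht
  set L : ℝ := (1 + c * lam) ^ (2 * ζ + 1) with hL
  have ht0 : 0 ≤ t := le_max_left _ _
  have hL0 : 0 ≤ L := by positivity
  refine ⟨lam, (t + 2 * C) * L * c ^ e * |K|, by linarith, by positivity,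
    fun bc N len h τ H hτ hτT hcfl => ?_⟩
  have hh := H.h_pos
  have hlam0 : 0 ≤ τ / h := by positivity
  have hKτ : K * τ ≤ |K| * τ := by gcongr; exact le_abs_self K
  have h1 : τ / h ≤ lam := by
    by_contra! hlt
    have h2 : τ / h ≤ (τ / h) ^ e := le_self_pow₀ (by linarith) (by omega)
    have h3 : |K| * τ ≤ |K| * T := by gcongr
    linarith
  refine ⟨h1, fun v hv => ?_⟩
  have hμΛ : c * (τ / h) ≤ c * lam := by gcongr
  obtain ⟨a, ha, hle⟩ := hest bc N len h τ H hτ hμΛ v hv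
  set μ := c * (τ / h) with hμdef
  have hμ : 0 ≤ μ := by positivity
  set A := energy k γ N len v v with hA
  have hA0 : 0 ≤ A := energy_self_nonneg hR.nonneg H.len_pos _
  have hpow : ∀ m, e ≤ m → m ≤ 2 * ζ + 1 → μ ^ m * A ≤ L * μ ^ e * A := fun m h1 h2 => by
    have := pow_le_mul_pow hμ hμΛ h1 h2
    gcongr
  have hterm1 : t * a ζ ≤ t * (L * μ ^ e * A) := by
    rcases he2 with h2 | h2
    · have : t = 0 := max_eq_left (by exact_mod_cast h2.le)
      rw [this]; simp
    · gcongr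
      exact (ha ζ).2.trans (hpow _ h2 (by omega))
  have hterm2 : ∀ p, ρ ≤ p → p ≤ ζ → μ * a p ≤ L * μ ^ e * A := by
    intro p h2 h3
    calc μ * a p ≤ μ * (μ ^ (2 * p) * A) := by gcongr; exact (ha p).2
      _ = μ ^ (2 * p + 1) * A := by ring
      _ ≤ _ := hpow _ (by omega) (by omega)
  have h4 : ((terminationValue s : ℝ) + C * μ) * a ζ + C * μ * a ρ ≤
      (t + 2 * C) * (L * μ ^ e * A) := by
    have h5 : (terminationValue s : ℝ) * a ζ ≤ t * a ζ := by
      have := (ha ζ).1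
      gcongr
      exact le_max_right _ _
    have h6 := mul_le_mul_of_nonneg_left (hterm2 ζ hρζ le_rfl) hC
    have h7 := mul_le_mul_of_nonneg_left (hterm2 ρ le_rfl hρζ) hC
    linarith
  have h8 : (t + 2 * C) * (L * μ ^ e * A) ≤ (t + 2 * C) * L * c ^ e * |K| * τ * A := by
    have : μ ^ e ≤ c ^ e * (|K| * τ) := by
      rw [hμdef, mul_pow]
      gcongr
      exact hcfl.trans hKτ
    calc (t + 2 * C) * (L * μ ^ e * A) ≤ (t + 2 * C) * (L * (c ^ e * (|K| * τ)) * A) := by gcongr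
      _ = _ := by ring
  have h9 : 1 / (s.factorial : ℝ) ^ 2 ≤ 1 := by
    rw [div_le_one (by positivity)]
    have : (1 : ℝ) ≤ s.factorial := by exact_mod_cast s.factorial_pos
    exact one_le_pow₀ this
  have h10 : 0 ≤ (t + 2 * C) * (L * μ ^ e * A) := by positivity
  have h11 : 1 / (s.factorial : ℝ) ^ 2 *
      (((terminationValue s : ℝ) + C * μ) * a ζ + C * μ * a ρ) ≤ (t + 2 * C) * (L * μ ^ e * A) := by
    calc _ ≤ 1 / (s.factorial : ℝ) ^ 2 * ((t + 2 * C) * (L * μ ^ e * A)) := by gcongr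
      _ ≤ _ := mul_le_of_le_one_left h10 h9
  linarith

/-! ### Taylor polynomials -/

/-- The Taylor polynomial of degree less than `m` of `f` at `z`. -/
noncomputable def taylorPoly (m : ℕ) (f : ℝ → ℝ) (z : ℝ) : ℝ[X] :=
  ∑ l ∈ Finset.range m, C (iteratedDeriv l f z / l.factorial) * (X - C z) ^ l

lemma natDegree_taylorPoly_le (m : ℕ) (f : ℝ → ℝ) (z : ℝ) :
    (taylorPoly (m + 1) f z).natDegree ≤ m :=
  natDegree_sum_le_of_forall_le _ _ fun l hl => by
    refine (natDegree_C_mul_le _ _).trans ((natDegree_pow_le).trans ?_)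
    rw [natDegree_X_sub_C]
    have := Finset.mem_range.1 hl
    omega

lemma iterate_derivative_taylorPoly_eq_zero {m κ : ℕ} (h : m ≤ κ) (f : ℝ → ℝ) (z : ℝ) :
    derivative^[κ] (taylorPoly m f z) = 0 := by
  cases m with
  | zero => simp [taylorPoly]
  | succ m =>
    exact iterate_derivative_eq_zero ((natDegree_taylorPoly_le m f z).trans_lt (by omega))

lemma eval_iterate_derivative_taylorPoly {m κ : ℕ} (h : κ < m) (f : ℝ → ℝ) (z : ℝ) :
    (derivative^[κ] (taylorPoly m f z)).eval z = iteratedDeriv κ f z := by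
  rw [taylorPoly, iterate_derivative_sum, eval_finsetSum, Finset.sum_eq_single κ]
  · rw [iterate_derivative_C_mul, iterate_derivative_X_sub_pow_self]
    have : (κ.factorial : ℝ) ≠ 0 := by exact_mod_cast κ.factorial_ne_zero
    simp
    field_simp
  · intro l _ hl
    rw [iterate_derivative_C_mul, iterate_derivative_X_sub_pow]
    rcases lt_or_gt_of_ne hl with h1 | h1
    · rw [Nat.descFactorial_eq_zero_iff_lt.2 h1]; simp
    · simp [show l - κ ≠ 0 by omega]
  · intro h1
    exact absurd (Finset.mem_range.2 h) h1

lemma eval_taylorPoly (m : ℕ) (f : ℝ → ℝ) (z x : ℝ) :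
    (taylorPoly m f z).eval x =
      ∑ l ∈ Finset.range m, iteratedDeriv l f z / l.factorial * (x - z) ^ l := by
  simp [taylorPoly, eval_finsetSum]

lemma hasDerivAt_iteratedDeriv {f : ℝ → ℝ} (hf : ContDiff ℝ ∞ f) (κ : ℕ) (x : ℝ) :
    HasDerivAt (iteratedDeriv κ f) (iteratedDeriv (κ + 1) f x) x := by
  rw [iteratedDeriv_succ]
  exact ((hf.differentiable_iteratedDeriv κ (by exact_mod_cast WithTop.coe_lt_top _)) x).hasDerivAt

/-- The derivatives of the Taylor polynomial approximate those of the function. -/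
lemma abs_iteratedDeriv_sub_taylorPoly_le {f : ℝ → ℝ} (hf : ContDiff ℝ ∞ f) (m : ℕ) (z x B : ℝ)
    (hB : ∀ ξ ∈ uIcc z x, |iteratedDeriv m f ξ| ≤ B) {κ : ℕ} (hκ : κ ≤ m) :
    |iteratedDeriv κ f x - (derivative^[κ] (taylorPoly m f z)).eval x| ≤
      B * |x - z| ^ (m - κ) := by
  suffices H : ∀ d ≤ m, ∀ ξ ∈ uIcc z x,
      |iteratedDeriv (m - d) f ξ - (derivative^[m - d] (taylorPoly m f z)).eval ξ| ≤
        B * |ξ - z| ^ d by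
    have := H (m - κ) (by omega) x right_mem_uIcc
    rwa [show m - (m - κ) = κ by omega] at this
  intro d
  induction d with
  | zero =>
    intro _ ξ hξ
    rw [Nat.sub_zero, iterate_derivative_taylorPoly_eq_zero le_rfl]
    simpa using hB ξ hξ
  | succ d ih =>
    intro hd ξ hξ
    have hder : ∀ η ∈ uIcc z ξ, HasDerivWithinAt (fun η => iteratedDeriv (m - (d + 1)) f η
        - (derivative^[m - (d + 1)] (taylorPoly m f z)).eval η)
        (iteratedDeriv (m - d) f η - (derivative^[m - d] (taylorPoly m f z)).eval η)
        (uIcc z ξ) η := by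
      intro η _
      have e : m - d = m - (d + 1) + 1 := by omega
      rw [e, Function.iterate_succ_apply']
      exact ((hasDerivAt_iteratedDeriv hf _ η).sub (Polynomial.hasDerivAt _ η)).hasDerivWithinAt
    have hsub : uIcc z ξ ⊆ uIcc z x := uIcc_subset_uIcc left_mem_uIcc hξ
    have hbound : ∀ η ∈ uIcc z ξ, ‖iteratedDeriv (m - d) f η
        - (derivative^[m - d] (taylorPoly m f z)).eval η‖ ≤ B * |ξ - z| ^ d := by
      intro η hη
      have hB0 : 0 ≤ B := (abs_nonneg _).trans (hB z left_mem_uIcc)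
      refine (ih (by omega) η (hsub hη)).trans ?_
      exact mul_le_mul_of_nonneg_left
        (pow_le_pow_left₀ (abs_nonneg _) (abs_sub_left_of_mem_uIcc hη) _) hB0
    have := (convex_uIcc z ξ).norm_image_sub_le_of_norm_hasDerivWithin_le hder hbound
      left_mem_uIcc right_mem_uIcc
    rw [eval_iterate_derivative_taylorPoly (by omega), sub_self, sub_zero] at this
    rw [pow_succ, ← mul_assoc]
    exact this

/-! ### Interpolation at the subdivision points -/

/-- `p` is a polynomial of degree at most `k` that interpolates `f` at the subdivision points of the
reference element other than `-1`. -/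
def IsNodeInterp (k : ℕ) (y : ℕ → ℝ) (f : ℝ → ℝ) (p : ℝ[X]) : Prop :=
  p.natDegree ≤ k ∧ ∀ j, 1 ≤ j → j ≤ k + 1 → p.eval (y j) = f (y j)

section Interp

variable {kind : SVKind} {k : ℕ} {y : ℕ → ℝ}

lemma exists_isNodeInterp (hy : IsSubdivision kind k y) (f : ℝ → ℝ) :
    ∃ p, IsNodeInterp k y f p := by
  have hinj : Function.Injective fun j : Fin (k + 1) => y (j + 1) := by
    intro i j hij
    have := hy.injective (a₁ := i.succ) (a₂ := j.succ) (by simpa using hij)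
    exact Fin.succ_injective _ this
  refine ⟨Lagrange.interpolate Finset.univ (fun j : Fin (k + 1) => y (j + 1))
    (fun j : Fin (k + 1) => f (y (j + 1))), ?_, fun j h1 h2 => ?_⟩
  · have := Lagrange.degree_interpolate_le (s := Finset.univ)
      (v := fun j : Fin (k + 1) => y (j + 1)) (fun j : Fin (k + 1) => f (y (j + 1))) hinj.injOn
    rw [Finset.card_univ, Fintype.card_fin] at this
    exact natDegree_le_of_degree_le this
  · obtain ⟨j, rfl⟩ := Nat.exists_eq_add_of_le' h1
    exact Lagrange.eval_interpolate_at_node (s := Finset.univ)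
      (v := fun j : Fin (k + 1) => y (j + 1)) (fun j : Fin (k + 1) => f (y (j + 1))) hinj.injOn
      (i := ⟨j, by omega⟩) (Finset.mem_univ _)

/-- The corrected derivative of the interpolant of a polynomial `q` of degree at most `k + 1` is the
derivative of `q`: the interpolation error is a multiple of the correction polynomial. -/
lemma IsNodeInterp.derivative_add {R : ℝ[X]} {γ : ℝ} (hy : IsSubdivision kind k y)
    (hR : IsCorrection k y R γ) {p q : ℝ[X]} (hq : q.natDegree ≤ k + 1)
    (hp : IsNodeInterp k y (fun x => q.eval x) p) :
    derivative p + C (p.eval (-1) - q.eval (-1)) * derivative R = derivative q := by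
  have h0 : q - p - C (p.eval (-1) - q.eval (-1)) * R = 0 := by
    by_contra hne
    refine eval_neg_one_ne_zero hy _ hne ?_ (fun j h1 h2 => ?_) ?_
    · refine (natDegree_sub_le _ _).trans (max_le ((natDegree_sub_le _ _).trans (max_le hq ?_)) ?_)
      · exact hp.1.trans (by omega)
      · exact (natDegree_C_mul_le _ _).trans hR.degree
    · rw [eval_sub, eval_sub, eval_mul, hR.root j h1 h2, hp.2 j h1 h2]; simp
    · rw [eval_sub, eval_sub, eval_mul, hR.left, eval_C]; ring
  have h1 := congrArg derivative h0
  rw [derivative_sub, derivative_sub, derivative_C_mul, derivative_zero] at h1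
  linear_combination -h1

end Interp

/-! ### Smooth profiles on the mesh -/

/-- The smooth function `g`, whose restriction to the `i`-th element is `ξ ↦ g (c i + len i / 2 * ξ)`
in the reference coordinate, has derivatives bounded by `B`, and the value that enters an element
from the left matches the function and all its derivatives. -/
structure IsProfile (k : ℕ) (bc : BC) (N : ℕ) (len c : ℕ → ℝ) (g : ℝ → ℝ) (B : ℝ) : Prop where
  smooth : ContDiff ℝ ∞ g
  bound : ∀ j ≤ k + 2, ∀ i < N, ∀ x ≤ c i + len i / 2, |iteratedDeriv j g x| ≤ B
  upwind : ∀ i < N,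
    ((∀ v, upwindTrace bc N v i = 0) ∧ ∀ κ, iteratedDeriv κ g (c i - len i / 2) = 0) ∨
    ∃ j < N, (∀ v, upwindTrace bc N v i = (v j).eval 1) ∧
      ∀ κ, iteratedDeriv κ g (c j + len j / 2) = iteratedDeriv κ g (c i - len i / 2)

/-- The restriction of `g` to an element in the reference coordinate. -/
noncomputable def pullback (c l : ℝ) (g : ℝ → ℝ) (ξ : ℝ) : ℝ := g (c + l / 2 * ξ)

lemma contDiff_pullback {g : ℝ → ℝ} (hg : ContDiff ℝ ∞ g) (c l : ℝ) :
    ContDiff ℝ ∞ (pullback c l g) :=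
  hg.comp (contDiff_const.add (contDiff_const.mul contDiff_id))

lemma iteratedDeriv_pullback {g : ℝ → ℝ} (hg : ContDiff ℝ ∞ g) (c l : ℝ) (κ : ℕ) (ξ : ℝ) :
    iteratedDeriv κ (pullback c l g) ξ = (l / 2) ^ κ * iteratedDeriv κ g (c + l / 2 * ξ) := by
  have h1 : ContDiff ℝ κ fun z => g (c + z) :=
    (hg.comp (contDiff_const.add contDiff_id)).of_le (by exact_mod_cast le_top)
  have h2 := congrFun (iteratedDeriv_comp_const_mul h1 (l / 2)) ξ
  rw [iteratedDeriv_comp_const_add] at h2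
  exact h2

/-! ### Consistency of the scheme -/

section Consistency

variable {kind : SVKind} {k : ℕ} {y : ℕ → ℝ} {bc : BC} {N : ℕ} {len c : ℕ → ℝ} {g : ℝ → ℝ}
  {B α h : ℝ}

lemma coeffNorm_sub_le (p q : ℝ[X]) : coeffNorm k (p - q) ≤ coeffNorm k p + coeffNorm k q := by
  have := coeffNorm_add_le (k := k) p (C (-1) * q)
  rw [coeffNorm_C_mul] at this
  simpa [sub_eq_add_neg] using this

/-- Scaled to the reference element, the `m`-th derivative gains a factor `h ^ m`. -/
lemma IsProfile.abs_iteratedDeriv_pullback_le (P : IsProfile k bc N len c g B)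
    (H : QuasiUniform N len α h) {i m : ℕ} (hi : i < N) (hm : m ≤ k + 2) {ξ : ℝ} (hξ : ξ ≤ 1) :
    |iteratedDeriv m (pullback (c i) (len i) g) ξ| ≤ (len i / 2) ^ m * B := by
  have hl := H.len_pos i hi
  rw [iteratedDeriv_pullback P.smooth, abs_mul, abs_of_nonneg (by positivity)]
  gcongr
  exact P.bound m hm i hi _ (by nlinarith)

lemma IsProfile.nonneg (P : IsProfile k bc N len c g B) (H : QuasiUniform N len α h) : 0 ≤ B :=
  (abs_nonneg _).trans (P.bound 0 (by omega) 0 H.card_pos _ le_rfl)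

/-- The Taylor polynomial at the left end approximates the derivatives on the element. -/
lemma IsProfile.abs_pullback_sub_taylorPoly_le (P : IsProfile k bc N len c g B)
    (H : QuasiUniform N len α h) {i m κ : ℕ} (hi : i < N) (hm : m ≤ k + 2) (hκ : κ ≤ m) {ξ : ℝ}
    (hξ : ξ ∈ Icc (-1 : ℝ) 1) :
    |iteratedDeriv κ (pullback (c i) (len i) g) ξ -
      (derivative^[κ] (taylorPoly m (pullback (c i) (len i) g) (-1))).eval ξ| ≤ len i ^ m * B := by
  have hl := H.len_pos i hi
  have hB := P.nonneg H
  have h1 := abs_iteratedDeriv_sub_taylorPoly_le (contDiff_pullback P.smooth (c i) (len i)) m (-1) ξ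
    ((len i / 2) ^ m * B) (fun η hη => by
      rw [uIcc_of_le hξ.1] at hη
      exact P.abs_iteratedDeriv_pullback_le H hi hm (hη.2.trans hξ.2)) hκ
  refine h1.trans ?_
  have h2 : |ξ - -1| ^ (m - κ) ≤ 2 ^ m := by
    calc |ξ - -1| ^ (m - κ) ≤ 2 ^ (m - κ) := by
          gcongr
          rw [abs_le]
          constructor <;> linarith [hξ.1, hξ.2]
      _ ≤ 2 ^ m := pow_le_pow_right₀ (by norm_num) (by omega)
  calc (len i / 2) ^ m * B * |ξ - -1| ^ (m - κ) ≤ (len i / 2) ^ m * B * 2 ^ m := by gcongr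
    _ = len i ^ m * B := by rw [div_pow]; field_simp

/-- The interpolation error is of order `k + 1`. -/
lemma exists_interp_error (hy : IsSubdivision kind k y) :
    ∃ K : ℝ, 0 ≤ K ∧ ∀ (bc : BC) (N : ℕ) (len c : ℕ → ℝ) (g : ℝ → ℝ) (B α h : ℝ),
      IsProfile k bc N len c g B → QuasiUniform N len α h → ∀ i < N, ∀ p,
      IsNodeInterp k y (pullback (c i) (len i) g) p → ∀ ξ ∈ Icc (-1 : ℝ) 1,
      |pullback (c i) (len i) g ξ - p.eval ξ| ≤ K * h ^ (k + 1) * B := by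
  obtain ⟨K, hK, hKp⟩ := exists_coeffNorm_le_of_nodes hy
  refine ⟨1 + K, by positivity, fun bc N len c g B α h P H i hi p hp ξ hξ => ?_⟩
  set f := pullback (c i) (len i) g with hf
  set Q := taylorPoly (k + 1) f (-1) with hQ
  have hl := H.len_pos i hi
  have hB := P.nonneg H
  have happ : ∀ η ∈ Icc (-1 : ℝ) 1, |f η - Q.eval η| ≤ len i ^ (k + 1) * B := fun η hη => by
    simpa using P.abs_pullback_sub_taylorPoly_le H (m := k + 1) (κ := 0) hi (by omega) (by omega) hη
  have hdeg : (p - Q).natDegree ≤ k :=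
    (natDegree_sub_le _ _).trans (max_le hp.1 (natDegree_taylorPoly_le _ _ _))
  have h1 : coeffNorm k (p - Q) ≤ K * (len i ^ (k + 1) * B) := hKp _ _ hdeg fun j h1 h2 => by
    rw [eval_sub, hp.2 j h1 h2]
    exact happ _ (hy.mem_Icc h2)
  have h2 := abs_eval_le_coeffNorm hdeg (abs_le.2 hξ)
  have h3 : f ξ - p.eval ξ = (f ξ - Q.eval ξ) - (p - Q).eval ξ := by rw [eval_sub]; ring
  rw [h3]
  have h4 : len i ^ (k + 1) * B ≤ h ^ (k + 1) * B := by
    have := H.len_le i hi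
    gcongr
  calc _ ≤ |f ξ - Q.eval ξ| + |(p - Q).eval ξ| := abs_sub _ _
    _ ≤ h ^ (k + 1) * B + K * (h ^ (k + 1) * B) := by
        have h5 := happ ξ hξ
        have h6 : K * (len i ^ (k + 1) * B) ≤ K * (h ^ (k + 1) * B) := by gcongr
        linarith
    _ = _ := by ring

/-- Powers of the spatial operator, applied to the interpolant, reproduce the derivatives of the
Taylor polynomials of degree `k + 1` up to an error of order `k + 2`. -/
lemma exists_svOp_pow_error (hy : IsSubdivision kind k y) {R : ℝ[X]} {γ : ℝ}
    (hR : IsCorrection k y R γ) {α : ℝ} (hα : 0 < α) (κ : ℕ) :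
    ∃ K : ℝ, 0 ≤ K ∧ ∀ (bc : BC) (N : ℕ) (len c : ℕ → ℝ) (g : ℝ → ℝ) (B h : ℝ),
      IsProfile k bc N len c g B → QuasiUniform N len α h → ∀ w ∈ degSubmodule k,
      (∀ i < N, IsNodeInterp k y (pullback (c i) (len i) g) (w i)) → ∀ i < N,
      coeffNorm k (((h • svOp bc N len (derivative R)) ^ (κ + 1)) w i -
        C ((-(2 * h / len i)) ^ (κ + 1)) *
          derivative^[κ + 1] (taylorPoly (k + 2) (pullback (c i) (len i) g) (-1))) ≤
        K * (h ^ (k + 2) * B) := by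
  have hr : (derivative R).natDegree ≤ k :=
    (natDegree_derivative_le _).trans (by have := hR.degree; omega)
  set A : ℝ := (k + 1) * (k + 1) + coeffNorm k (derivative R) with hA
  have hA0 : 0 ≤ A := add_nonneg (by positivity) (coeffNorm_nonneg _)
  have hone : |(1 : ℝ)| ≤ 1 := by simp
  have hone' : |(-1 : ℝ)| ≤ 1 := by simp
  induction κ with
  | zero =>
    obtain ⟨K, hK, hKp⟩ := exists_coeffNorm_le_of_nodes hy
    refine ⟨2 / α * (A * (2 * K)), by positivity,
      fun bc N len c g B h P H w hw hint i hi => ?_⟩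
    have hh := H.h_pos
    have hl := H.len_pos i hi
    have hB := P.nonneg H
    set f := pullback (c i) (len i) g with hf
    set Q := taylorPoly (k + 2) f (-1) with hQ
    obtain ⟨p, hp⟩ := exists_isNodeInterp hy (fun x => Q.eval x)
    have hder := hp.derivative_add hy hR (natDegree_taylorPoly_le (k + 1) f (-1))
    have hQ1 : Q.eval (-1) = f (-1) := by
      simpa using eval_iterate_derivative_taylorPoly (m := k + 2) (κ := 0) (by omega) f (-1)
    -- the interpolant takes the exact value at the right end of each element
    have htr : upwindTrace bc N w i = f (-1) := by
      have e : f (-1) = g (c i - len i / 2) := by rw [hf, pullback]; congr 1; ring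
      rcases P.upwind i hi with ⟨h1, h2⟩ | ⟨j, hj, h1, h2⟩
      · rw [h1, e]; simpa using (h2 0).symm
      · have h3 := (hint j hj).2 (k + 1) (by omega) le_rfl
        rw [hy.right] at h3
        rw [h1, h3, e, pullback, mul_one]
        simpa using h2 0
    have hdeg : (w i - p).natDegree ≤ k := (natDegree_sub_le _ _).trans (max_le (hw i) hp.1)
    have hnodes : coeffNorm k (w i - p) ≤ K * (h ^ (k + 2) * B) := hKp _ _ hdeg fun j h1 h2 => by
      rw [eval_sub, (hint i hi).2 j h1 h2, hp.2 j h1 h2]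
      have := P.abs_pullback_sub_taylorPoly_le H (m := k + 2) (κ := 0) hi le_rfl (by omega)
        (hy.mem_Icc h2)
      refine (by simpa using this : _ ≤ len i ^ (k + 2) * B).trans ?_
      have := H.len_le i hi
      gcongr
    have e : ((h • svOp bc N len (derivative R)) ^ (0 + 1)) w i
        - C ((-(2 * h / len i)) ^ (0 + 1)) * derivative^[0 + 1] Q =
        C (-(2 * h / len i)) * (derivative (w i - p) + C ((w i - p).eval (-1)) * derivative R) := by
      rw [zero_add, pow_one, pow_one, LinearMap.smul_apply, Pi.smul_apply, svOp_apply hi, htr,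
        Function.iterate_one, ← hder, smul_eq_C_mul, ← mul_assoc, ← C_mul, hQ1, derivative_sub,
        eval_sub]
      have : h * -(2 / len i) = -(2 * h / len i) := by ring
      rw [this]
      simp only [map_sub]
      ring
    rw [e, coeffNorm_C_mul]
    have h1 : |-(2 * h / len i)| ≤ 2 / α := by
      rw [abs_neg, abs_of_nonneg (by positivity), div_le_div_iff₀ hl hα]
      nlinarith [H.le_len i hi]
    have h2 := coeffNorm_correctedDeriv_le (r := derivative R) hdeg ((w i - p).eval (-1))
    have h3 := abs_eval_le_coeffNorm hdeg hone'
    have h4 : coeffNorm k (derivative (w i - p) + C ((w i - p).eval (-1)) * derivative R) ≤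
        A * (2 * (K * (h ^ (k + 2) * B))) := by
      refine h2.trans ?_
      rw [← hA]
      gcongr
      linarith
    have h5 := coeffNorm_nonneg (k := k)
      (derivative (w i - p) + C ((w i - p).eval (-1)) * derivative R)
    calc _ ≤ 2 / α * (A * (2 * (K * (h ^ (k + 2) * B)))) := by gcongr
      _ = _ := by ring
  | succ κ ih =>
    obtain ⟨K, hK, ih⟩ := ih
    refine ⟨2 / α * (A * (K + (2 * K + (2 / α) ^ (κ + 1)))), by positivity,
      fun bc N len c g B h P H w hw hint i hi => ?_⟩
    have ih := ih bc N len c g B h P H w hw hint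
    have hh := H.h_pos
    have hB := P.nonneg H
    have hθ : ∀ i < N, |-(2 * h / len i)| ≤ 2 / α := by
      intro i hi
      have hl := H.len_pos i hi
      rw [abs_neg, abs_of_nonneg (by positivity), div_le_div_iff₀ hl hα]
      nlinarith [H.le_len i hi]
    set x := ((h • svOp bc N len (derivative R)) ^ (κ + 1)) w with hx
    have hxdeg : x ∈ degSubmodule k := smul_svOp_pow_mem hr h hw (κ + 1)
    let Q : ℕ → ℝ[X] := fun i => taylorPoly (k + 2) (pullback (c i) (len i) g) (-1)
    have hQdeg : ∀ i, (derivative^[κ + 1] (Q i)).natDegree ≤ k := fun i => by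
      refine (natDegree_iterate_derivative _ _).trans ?_
      have : (Q i).natDegree ≤ k + 1 := natDegree_taylorPoly_le (k + 1) _ (-1)
      omega
    let E : ℕ → ℝ[X] := fun i =>
      x i - C ((-(2 * h / len i)) ^ (κ + 1)) * derivative^[κ + 1] (Q i)
    have hE : ∀ i < N, coeffNorm k (E i) ≤ K * (h ^ (k + 2) * B) := ih
    have hEdeg : ∀ i, (E i).natDegree ≤ k := fun i =>
      (natDegree_sub_le _ _).trans (max_le (hxdeg i) ((natDegree_C_mul_le _ _).trans (hQdeg i)))
    have hxE : ∀ i, x i = C ((-(2 * h / len i)) ^ (κ + 1)) * derivative^[κ + 1] (Q i) + E i :=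
      fun i => by simp only [E]; ring
    -- at both ends of an element the main part equals a derivative of `g`, up to the order `k + 2`
    have hleft : κ + 1 < k + 2 → ∀ i < N, (C ((-(2 * h / len i)) ^ (κ + 1)) *
        derivative^[κ + 1] (Q i)).eval (-1) =
        (-h) ^ (κ + 1) * iteratedDeriv (κ + 1) g (c i - len i / 2) := by
      intro hκ i hi
      have hl := (H.len_pos i hi).ne'
      rw [eval_mul, eval_C, eval_iterate_derivative_taylorPoly hκ, iteratedDeriv_pullback P.smooth,
        ← mul_assoc, ← mul_pow]
      congr 2
      · field_simp
      · ring
    have hright : κ + 1 < k + 2 → ∀ i < N, |(C ((-(2 * h / len i)) ^ (κ + 1)) *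
        derivative^[κ + 1] (Q i)).eval 1 -
        (-h) ^ (κ + 1) * iteratedDeriv (κ + 1) g (c i + len i / 2)| ≤
        (2 / α) ^ (κ + 1) * (h ^ (k + 2) * B) := by
      intro hκ i hi
      have hl := (H.len_pos i hi).ne'
      have h1 := P.abs_pullback_sub_taylorPoly_le H (m := k + 2) (κ := κ + 1) hi le_rfl hκ.le
        (right_mem_Icc.2 (by norm_num : (-1 : ℝ) ≤ 1))
      rw [iteratedDeriv_pullback P.smooth, mul_one] at h1
      have h2 : (-h) ^ (κ + 1) * iteratedDeriv (κ + 1) g (c i + len i / 2) =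
          (-(2 * h / len i)) ^ (κ + 1) *
            ((len i / 2) ^ (κ + 1) * iteratedDeriv (κ + 1) g (c i + len i / 2)) := by
        rw [← mul_assoc, ← mul_pow]
        congr 2
        field_simp
      rw [eval_mul, eval_C, h2, ← mul_sub, abs_mul, abs_pow, abs_sub_comm]
      have h3 : len i ^ (k + 2) * B ≤ h ^ (k + 2) * B := by
        have := H.len_le i hi
        have := (H.len_pos i hi).le
        gcongr
      exact mul_le_mul (pow_le_pow_left₀ (abs_nonneg _) (hθ i hi) _) (h1.trans h3) (abs_nonneg _)
        (by positivity)
    have hseam : |(x i).eval (-1) - upwindTrace bc N x i| ≤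
        (2 * K + (2 / α) ^ (κ + 1)) * (h ^ (k + 2) * B) := by
      have h1 := (abs_eval_le_coeffNorm (hEdeg i) hone').trans (hE i hi)
      have hδ : 0 ≤ h ^ (k + 2) * B := by positivity
      by_cases hκ : κ + 1 < k + 2
      · rcases P.upwind i hi with ⟨h2, h3⟩ | ⟨j, hj, h2, h3⟩
        · rw [h2, sub_zero, hxE i, eval_add, hleft hκ i hi, h3, mul_zero, zero_add]
          refine h1.trans ?_
          have : 0 ≤ (K + (2 / α) ^ (κ + 1)) * (h ^ (k + 2) * B) := by positivity
          linarith
        · have h4 := (abs_eval_le_coeffNorm (hEdeg j) hone).trans (hE j hj)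
          have h5 := hright hκ j hj
          rw [h3] at h5
          rw [h2, hxE i, hxE j, eval_add, eval_add, hleft hκ i hi]
          rw [abs_le] at h1 h4 h5 ⊢
          constructor <;> linarith [h1.1, h1.2, h4.1, h4.2, h5.1, h5.2]
      · have hz : ∀ i, derivative^[κ + 1] (Q i) = 0 := fun i =>
          iterate_derivative_taylorPoly_eq_zero (by omega) _ _
        have hpos : 0 ≤ (2 / α) ^ (κ + 1) * (h ^ (k + 2) * B) := by positivity
        have hpos' : 0 ≤ K * (h ^ (k + 2) * B) := by positivity
        rcases P.upwind i hi with ⟨h2, h3⟩ | ⟨j, hj, h2, h3⟩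
        · rw [h2, sub_zero, hxE i, hz, mul_zero, zero_add]
          linarith
        · have h4 := (abs_eval_le_coeffNorm (hEdeg j) hone).trans (hE j hj)
          rw [h2, hxE i, hxE j, hz, hz, mul_zero, zero_add, mul_zero, zero_add]
          rw [abs_le] at h1 h4 ⊢
          constructor <;> linarith [h1.1, h1.2, h4.1, h4.2]
    have e : ((h • svOp bc N len (derivative R)) ^ (κ + 1 + 1)) w i
        - C ((-(2 * h / len i)) ^ (κ + 1 + 1)) * derivative^[κ + 1 + 1] (Q i) =
        C (-(2 * h / len i)) * (derivative (E i) +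
          C ((x i).eval (-1) - upwindTrace bc N x i) * derivative R) := by
      have h1 : derivative (E i) = derivative (x i)
          - C ((-(2 * h / len i)) ^ (κ + 1)) * derivative^[κ + 1 + 1] (Q i) := by
        simp only [E, derivative_sub, derivative_C_mul, Function.iterate_succ_apply']
      have h2 : C h * C (-(2 / len i)) = C (-(2 * h / len i)) := by rw [← C_mul]; congr 1; ring
      rw [pow_succ' _ (κ + 1), Module.End.mul_apply, ← hx, LinearMap.smul_apply, Pi.smul_apply,
        svOp_apply hi, h1, smul_eq_C_mul, ← mul_assoc, h2, pow_succ' (-(2 * h / len i)) (κ + 1),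
        C_mul]
      ring
    change coeffNorm k (((h • svOp bc N len (derivative R)) ^ (κ + 1 + 1)) w i
        - C ((-(2 * h / len i)) ^ (κ + 1 + 1)) * derivative^[κ + 1 + 1] (Q i)) ≤ _
    rw [e, coeffNorm_C_mul]
    have h2 := coeffNorm_correctedDeriv_le (r := derivative R) (hEdeg i)
      ((x i).eval (-1) - upwindTrace bc N x i)
    rw [← hA] at h2
    have h5 := coeffNorm_nonneg (k := k)
      (derivative (E i) + C ((x i).eval (-1) - upwindTrace bc N x i) * derivative R)
    calc _ ≤ 2 / α * (A * (K * (h ^ (k + 2) * B)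
          + (2 * K + (2 / α) ^ (κ + 1)) * (h ^ (k + 2) * B))) := by
          have := hθ i hi
          gcongr
          refine h2.trans ?_
          have := hE i hi
          gcongr
      _ = _ := by ring

/-- The local truncation error.  The Taylor expansion in time stops at the order `min s (k + 1)`,
since only `k + 2` derivatives are available; as `τ / h` is bounded, this does no harm. -/
lemma exists_truncation_error (hy : IsSubdivision kind k y) {R : ℝ[X]} {γ : ℝ}
    (hR : IsCorrection k y R γ) {α : ℝ} (hα : 0 < α) (s : ℕ) (Λ : ℝ) :
    ∃ K : ℝ, 0 ≤ K ∧ ∀ (bc : BC) (N : ℕ) (len c : ℕ → ℝ) (g : ℝ → ℝ) (B h τ : ℝ),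
      IsProfile k bc N len c g B → QuasiUniform N len α h → 0 ≤ τ → τ / h ≤ Λ →
      ∀ w ∈ degSubmodule k, (∀ i < N, IsNodeInterp k y (pullback (c i) (len i) g) (w i)) →
      ∀ i < N, ∀ p, IsNodeInterp k y (pullback (c i - τ) (len i) g) p →
      coeffNorm k (p - rkStep s (τ • svOp bc N len (derivative R)) w i) ≤
        K * (τ * (h ^ (k + 1) + τ ^ s) * B) := by
  choose D hD0 hD using exists_svOp_pow_error (k := k) hy hR hα
  obtain ⟨A, hA, hAp⟩ := exists_coeffNorm_le_of_nodes hy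
  have hr : (derivative R).natDegree ≤ k :=
    (natDegree_derivative_le _).trans (by have := hR.degree; omega)
  set L : ℝ := (1 + |Λ|) ^ (s + k + 1) with hL
  have hL1 : 1 ≤ L := one_le_pow₀ (by linarith [abs_nonneg Λ])
  refine ⟨A * (1 + L + s * L) + ∑ κ ∈ Finset.range s, L * D κ,
    add_nonneg (by positivity) (Finset.sum_nonneg fun κ _ => mul_nonneg (by positivity) (hD0 κ)), ?_⟩
  intro bc N len c g B h τ P H hτ hΛ w hw hint i hi p hp
  have hh := H.h_pos
  have hl := H.len_pos i hi
  have hlh := H.len_le i hi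
  have hB := P.nonneg H
  have hτΛ : τ ≤ (1 + |Λ|) * h := by
    rw [div_le_iff₀ hh] at hΛ
    have := mul_le_mul_of_nonneg_right (le_abs_self Λ) hh.le
    linarith
  have hΛ1 : 1 ≤ 1 + |Λ| := by linarith [abs_nonneg Λ]
  -- a power of `τ` beyond the first may be traded for a power of `h`
  have htrade : ∀ m n : ℕ, m ≤ s + k + 1 → τ ^ m * h ^ n ≤ L * h ^ (m + n) := by
    intro m n hm
    calc τ ^ m * h ^ n ≤ ((1 + |Λ|) * h) ^ m * h ^ n := by gcongr
      _ = (1 + |Λ|) ^ m * h ^ (m + n) := by rw [mul_pow, pow_add]; ring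
      _ ≤ L * h ^ (m + n) := by
          gcongr
          exact pow_le_pow_right₀ hΛ1 hm
  set f := pullback (c i) (len i) g with hf
  set Q := taylorPoly (k + 2) f (-1) with hQ
  set σ : ℝ := 2 * τ / len i with hσ
  have hσ0 : 0 ≤ σ := by positivity
  set δ : ℝ := τ * (h ^ (k + 1) + τ ^ s) * B with hδ
  have hδh : τ * h ^ (k + 1) * B ≤ δ := by
    rw [hδ]; gcongr; exact le_add_of_nonneg_right (by positivity)
  have hδτ : τ * τ ^ s * B ≤ δ := by
    rw [hδ]; gcongr; exact le_add_of_nonneg_left (by positivity)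
  let x : ℕ → ℝ[X] := fun κ => ((h • svOp bc N len (derivative R)) ^ κ) w i
  let E : ℕ → ℝ[X] := fun κ =>
    x (κ + 1) - C ((-(2 * h / len i)) ^ (κ + 1)) * derivative^[κ + 1] Q
  have hE : ∀ κ, coeffNorm k (E κ) ≤ D κ * (h ^ (k + 2) * B) := fun κ =>
    hD κ bc N len c g B h P H w hw hint i hi
  -- the numerical step in powers of `h • svOp`
  have hstep : rkStep s (τ • svOp bc N len (derivative R)) w i = w i +
      ∑ κ ∈ Finset.range s, C (1 / ((κ + 1).factorial : ℝ) * (τ / h) ^ (κ + 1)) * x (κ + 1) := by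
    rw [rkStep_apply, Finset.sum_apply, Finset.sum_range_succ', add_comm]
    congr 1
    · simp
    · refine Finset.sum_congr rfl fun κ _ => ?_
      have : τ • svOp bc N len (derivative R) = (τ / h) • (h • svOp bc N len (derivative R)) := by
        rw [smul_smul, div_mul_cancel₀ _ hh.ne']
      rw [this, _root_.smul_pow, LinearMap.smul_apply, Pi.smul_apply, Pi.smul_apply, smul_smul,
        smul_eq_C_mul]
  have hscale : ∀ κ : ℕ, C (1 / ((κ + 1).factorial : ℝ) * (τ / h) ^ (κ + 1)) * x (κ + 1) =
      C ((-σ) ^ (κ + 1) / ((κ + 1).factorial : ℝ)) * derivative^[κ + 1] Q +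
        C (1 / ((κ + 1).factorial : ℝ) * (τ / h) ^ (κ + 1)) * E κ := by
    intro κ
    have h1 : (-σ) ^ (κ + 1) / ((κ + 1).factorial : ℝ) =
        1 / ((κ + 1).factorial : ℝ) * (τ / h) ^ (κ + 1) * (-(2 * h / len i)) ^ (κ + 1) := by
      rw [mul_assoc, ← mul_pow, hσ, one_div_mul_eq_div]
      congr 2
      field_simp
    rw [h1]
    generalize 1 / ((κ + 1).factorial : ℝ) * (τ / h) ^ (κ + 1) = z
    simp only [E]
    rw [C_mul]
    ring
  let b : ℝ[X] := p - w i - ∑ κ ∈ Finset.range s,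
    C ((-σ) ^ (κ + 1) / ((κ + 1).factorial : ℝ)) * derivative^[κ + 1] Q
  have hsplit : p - rkStep s (τ • svOp bc N len (derivative R)) w i =
      b - ∑ κ ∈ Finset.range s, C (1 / ((κ + 1).factorial : ℝ) * (τ / h) ^ (κ + 1)) * E κ := by
    rw [hstep, Finset.sum_congr rfl fun κ _ => hscale κ, Finset.sum_add_distrib]
    simp only [b]
    ring
  have hbdeg : b.natDegree ≤ k := by
    refine (natDegree_sub_le _ _).trans (max_le ((natDegree_sub_le _ _).trans
      (max_le hp.1 (hw i))) (natDegree_sum_le_of_forall_le _ _ fun κ _ => ?_))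
    refine (natDegree_C_mul_le _ _).trans ((natDegree_iterate_derivative _ _).trans ?_)
    have : Q.natDegree ≤ k + 1 := natDegree_taylorPoly_le (k + 1) f (-1)
    omega
  -- the main part, at the nodes
  have hnode : ∀ j, 1 ≤ j → j ≤ k + 1 → |b.eval (y j)| ≤ (1 + L + s * L) * δ := by
    intro j h1 h2
    have hyj := hy.mem_Icc h2
    set r := min s (k + 1) with hrdef
    have hpe : p.eval (y j) = f (y j - σ) := by
      rw [hp.2 j h1 h2, hf, pullback, pullback]
      congr 1
      rw [hσ]
      field_simp
      ring
    have hTay : |f (y j - σ) - (taylorPoly (r + 1) f (y j)).eval (y j - σ)| ≤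
        B * τ ^ (r + 1) := by
      have h3 := abs_iteratedDeriv_sub_taylorPoly_le (contDiff_pullback P.smooth (c i) (len i))
        (r + 1) (y j) (y j - σ) ((len i / 2) ^ (r + 1) * B) (fun η hη => by
          rw [uIcc_of_ge (by linarith)] at hη
          exact P.abs_iteratedDeriv_pullback_le H hi (by omega) (hη.2.trans hyj.2))
        (κ := 0) (Nat.zero_le _)
      simp only [iteratedDeriv_zero, Function.iterate_zero, id, Nat.sub_zero] at h3
      refine h3.trans (le_of_eq ?_)
      rw [show y j - σ - y j = -σ by ring, abs_neg, abs_of_nonneg hσ0, hσ, mul_right_comm,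
        ← mul_pow]
      have : len i / 2 * (2 * τ / len i) = τ := by field_simp
      rw [this, mul_comm]
    have hTexp : (taylorPoly (r + 1) f (y j)).eval (y j - σ) = f (y j) + ∑ κ ∈ Finset.range r,
        (-σ) ^ (κ + 1) / ((κ + 1).factorial : ℝ) * iteratedDeriv (κ + 1) f (y j) := by
      rw [eval_taylorPoly, Finset.sum_range_succ', add_comm]
      congr 1
      · simp
      · refine Finset.sum_congr rfl fun κ _ => ?_
        rw [show y j - σ - y j = -σ by ring]
        ring
    have hQsum : ∑ κ ∈ Finset.range s, (-σ) ^ (κ + 1) / ((κ + 1).factorial : ℝ) *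
        (derivative^[κ + 1] Q).eval (y j) = ∑ κ ∈ Finset.range r,
        (-σ) ^ (κ + 1) / ((κ + 1).factorial : ℝ) * (derivative^[κ + 1] Q).eval (y j) := by
      symm
      refine Finset.sum_subset (Finset.range_subset_range.2 (min_le_left _ _)) fun κ h3 h4 => ?_
      have h3 := Finset.mem_range.1 h3
      rw [Finset.mem_range] at h4
      rw [hQ, iterate_derivative_taylorPoly_eq_zero (by omega)]
      simp
    have hbe : b.eval (y j) = (f (y j - σ) - (taylorPoly (r + 1) f (y j)).eval (y j - σ)) +
        ∑ κ ∈ Finset.range r, (-σ) ^ (κ + 1) / ((κ + 1).factorial : ℝ) *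
          (iteratedDeriv (κ + 1) f (y j) - (derivative^[κ + 1] Q).eval (y j)) := by
      simp only [b, eval_sub, eval_finsetSum, eval_mul, eval_C]
      rw [hpe, (hint i hi).2 j h1 h2, hQsum, hTexp]
      simp only [mul_sub, Finset.sum_sub_distrib]
      ring
    have hone : B * τ ^ (r + 1) ≤ (1 + L) * δ := by
      have hδ0 : 0 ≤ δ := by positivity
      rcases min_choice s (k + 1) with h3 | h3
      · rw [hrdef, h3]
        calc B * τ ^ (s + 1) = τ * τ ^ s * B := by ring
          _ ≤ δ := hδτ
          _ ≤ (1 + L) * δ := by nlinarith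
      · rw [hrdef, h3]
        have h4 := htrade (k + 1) 0 (by omega)
        simp only [pow_zero, mul_one, add_zero] at h4
        calc B * τ ^ (k + 1 + 1) = τ * τ ^ (k + 1) * B := by ring
          _ ≤ τ * (L * h ^ (k + 1)) * B := by gcongr
          _ = L * (τ * h ^ (k + 1) * B) := by ring
          _ ≤ L * δ := by gcongr
          _ ≤ (1 + L) * δ := by nlinarith
    have hterm : ∀ κ ∈ Finset.range r, |(-σ) ^ (κ + 1) / ((κ + 1).factorial : ℝ) *
        (iteratedDeriv (κ + 1) f (y j) - (derivative^[κ + 1] Q).eval (y j))| ≤ L * δ := by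
      intro κ hκ
      have hκ := Finset.mem_range.1 hκ
      have hκk : κ + 1 ≤ k + 1 := by omega
      -- here the Taylor bound is used in the scaled form, with the exact power of the length
      have h3 := abs_iteratedDeriv_sub_taylorPoly_le (contDiff_pullback P.smooth (c i) (len i))
        (k + 2) (-1) (y j) ((len i / 2) ^ (k + 2) * B) (fun η hη => by
          rw [uIcc_of_le hyj.1] at hη
          exact P.abs_iteratedDeriv_pullback_le H hi le_rfl (hη.2.trans hyj.2))
        (κ := κ + 1) (by omega)
      have h4 : |y j - -1| ^ (k + 2 - (κ + 1)) ≤ 2 ^ (k + 2 - (κ + 1)) := by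
        gcongr
        rw [abs_le]
        constructor <;> linarith [hyj.1, hyj.2]
      have h5 : |(-σ) ^ (κ + 1) / ((κ + 1).factorial : ℝ)| ≤ σ ^ (κ + 1) := by
        rw [abs_div, abs_pow, abs_neg, abs_of_nonneg hσ0, Nat.abs_cast]
        refine div_le_self (by positivity) ?_
        exact_mod_cast (κ + 1).factorial_pos
      have h6 : σ ^ (κ + 1) * ((len i / 2) ^ (k + 2) * B * 2 ^ (k + 2 - (κ + 1))) =
          τ * (τ ^ κ * len i ^ (k + 1 - κ)) * B := by
        obtain ⟨d, hd⟩ := Nat.exists_eq_add_of_le hκk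
        have e1 : k + 2 = κ + 1 + (d + 1) := by omega
        have e2 : k + 2 - (κ + 1) = d + 1 := by omega
        have e3 : k + 1 - κ = d + 1 := by omega
        rw [e2, e3, e1, pow_add, hσ]
        simp only [div_pow, mul_pow]
        field_simp
        ring
      rw [abs_mul]
      calc _ ≤ σ ^ (κ + 1) * ((len i / 2) ^ (k + 2) * B * 2 ^ (k + 2 - (κ + 1))) := by
            refine mul_le_mul h5 (h3.trans ?_) (abs_nonneg _) (by positivity)
            gcongr
        _ = τ * (τ ^ κ * len i ^ (k + 1 - κ)) * B := h6
        _ ≤ τ * (τ ^ κ * h ^ (k + 1 - κ)) * B := by gcongr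
        _ ≤ τ * (L * h ^ (κ + (k + 1 - κ))) * B := by
            have := htrade κ (k + 1 - κ) (by omega)
            gcongr
        _ = L * (τ * h ^ (k + 1) * B) := by
            rw [show κ + (k + 1 - κ) = k + 1 by omega]; ring
        _ ≤ L * δ := by gcongr
    have hsum := (Finset.abs_sum_le_sum_abs _ _).trans (Finset.sum_le_sum hterm)
    rw [Finset.sum_const, Finset.card_range, nsmul_eq_mul] at hsum
    have hrs : (r : ℝ) * (L * δ) ≤ s * (L * δ) := by
      have : (r : ℝ) ≤ s := by exact_mod_cast min_le_left _ _
      gcongr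
    rw [hbe]
    calc _ ≤ _ := abs_add_le _ _
      _ ≤ (1 + L) * δ + s * (L * δ) := add_le_add (hTay.trans hone) (hsum.trans hrs)
      _ = _ := by ring
  have hbnorm := hAp b _ hbdeg hnode
  have hsumE : coeffNorm k (∑ κ ∈ Finset.range s,
      C (1 / ((κ + 1).factorial : ℝ) * (τ / h) ^ (κ + 1)) * E κ) ≤
      (∑ κ ∈ Finset.range s, L * D κ) * δ := by
    have hle : ∀ (t : Finset ℕ) (q : ℕ → ℝ[X]),
        coeffNorm k (∑ κ ∈ t, q κ) ≤ ∑ κ ∈ t, coeffNorm k (q κ) := fun t q =>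
      Finset.le_sum_of_subadditive _ (by simp [coeffNorm]) coeffNorm_add_le t q
    refine (hle _ _).trans ?_
    rw [Finset.sum_mul]
    refine Finset.sum_le_sum fun κ hκ => ?_
    have hκ := Finset.mem_range.1 hκ
    have h1 : |1 / ((κ + 1).factorial : ℝ) * (τ / h) ^ (κ + 1)| ≤ (τ / h) ^ (κ + 1) := by
      rw [abs_of_nonneg (by positivity)]
      refine mul_le_of_le_one_left (by positivity) ?_
      rw [div_le_one (by positivity)]
      exact_mod_cast (κ + 1).factorial_pos
    have h2 : (τ / h) ^ (κ + 1) * h ^ (k + 2) ≤ L * (τ * h ^ (k + 1)) := by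
      have h3 : (τ / h) ^ κ ≤ L := by
        calc (τ / h) ^ κ ≤ (1 + |Λ|) ^ κ := by
              gcongr; linarith [le_abs_self Λ]
          _ ≤ L := pow_le_pow_right₀ hΛ1 (by omega)
      calc (τ / h) ^ (κ + 1) * h ^ (k + 2) = (τ / h) ^ κ * (τ * h ^ (k + 1)) := by
            rw [pow_succ (τ / h), pow_succ h (k + 1)]; field_simp
        _ ≤ L * (τ * h ^ (k + 1)) := by gcongr
    have h4 := hD0 κ
    rw [coeffNorm_C_mul]
    calc _ ≤ (τ / h) ^ (κ + 1) * (D κ * (h ^ (k + 2) * B)) := by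
          have := hE κ
          have := coeffNorm_nonneg (k := k) (E κ)
          gcongr
      _ = D κ * ((τ / h) ^ (κ + 1) * h ^ (k + 2)) * B := by ring
      _ ≤ D κ * (L * (τ * h ^ (k + 1))) * B := by gcongr
      _ = L * D κ * (τ * h ^ (k + 1) * B) := by ring
      _ ≤ L * D κ * δ := by gcongr
  rw [hsplit]
  calc _ ≤ _ := coeffNorm_sub_le _ _
    _ ≤ A * ((1 + L + s * L) * δ) + (∑ κ ∈ Finset.range s, L * D κ) * δ := add_le_add hbnorm hsumE
    _ = _ := by ring

end Consistency

/-! ### Weak bounds on derivatives and mollification -/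

/-- All weak derivatives of `v` of order at most `m` on `(p,q)` are bounded by `M`, expressed by
testing: `|∫ v φ^{(j)}| ≤ M ∫ |φ|` for test functions on `(p,q)`. -/
def WeakBound (p q : ℝ) (m : ℕ) (v : ℝ → ℝ) (M : ℝ) : Prop :=
  ∀ j ≤ m, ∀ φ : ℝ → ℝ, ContDiff ℝ ∞ φ → HasCompactSupport φ → tsupport φ ⊆ Ioo p q →
    |∫ x, v x * iteratedDeriv j φ x| ≤ M * ∫ x, |φ x|

lemma iteratedDeriv_eq_zero_of_notMem_tsupport {φ : ℝ → ℝ} {x : ℝ} (h : x ∉ tsupport φ) (j : ℕ) :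
    iteratedDeriv j φ x = 0 := by
  have h1 : iteratedFDeriv ℝ j φ x = 0 := by
    by_contra h2
    exact h (support_iteratedFDeriv_subset j h2)
  rw [iteratedDeriv_eq_iteratedFDeriv, h1]
  rfl

/-- The strict inequality provides weak derivatives whose essential suprema are below the bound. -/
lemma WeakBound.of_sobolevNorm_lt {a b M : ℝ} {m : ℕ} {v : ℝ → ℝ}
    (h : sobolevNorm a b m v < ENNReal.ofReal M) : WeakBound a b m v M := by
  simp only [sobolevNorm, iInf_lt_iff] at h
  obtain ⟨D, hD, h⟩ := h
  have hM : 0 ≤ M := by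
    by_contra hM
    rw [ENNReal.ofReal_of_nonpos (by linarith)] at h
    simp at h
  intro j hj φ hφ hc hs
  have hbd : ∀ᵐ x ∂(volume.restrict (Ioo a b)), |D j x| ≤ M := by
    have h1 : eLpNormEssSup (D j) (volume.restrict (Ioo a b)) ≤ ENNReal.ofReal M := by
      rw [← eLpNorm_exponent_top]
      exact (le_iSup₂ (f := fun j (_ : j ≤ m) =>
        eLpNorm (D j) ∞ (volume.restrict (Ioo a b))) j hj).trans h.le
    filter_upwards [ae_le_eLpNormEssSup (f := D j) (μ := volume.restrict (Ioo a b))] with x hx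
    have h2 := hx.trans h1
    rw [← ofReal_norm] at h2
    exact (ENNReal.ofReal_le_ofReal_iff hM).1 h2
  have hoff : ∀ x ∉ Ioo a b, v x * iteratedDeriv j φ x = 0 := fun x hx => by
    rw [iteratedDeriv_eq_zero_of_notMem_tsupport (fun h => hx (hs h)), mul_zero]
  have hint : Integrable (fun x => M * |φ x|) :=
    ((hφ.continuous.integrable_of_hasCompactSupport hc).abs).const_mul M
  have hφi : ∀ᵐ x ∂(volume.restrict (Ioo a b)), ‖D j x * φ x‖ ≤ M * |φ x| := by
    filter_upwards [hbd] with x hx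
    rw [norm_mul]
    exact mul_le_mul_of_nonneg_right hx (abs_nonneg _)
  rw [← setIntegral_eq_integral_of_forall_compl_eq_zero hoff, (hD j hj).2.2 φ hφ hc hs, abs_mul,
    abs_pow, abs_neg, abs_one, one_pow, one_mul]
  refine (norm_integral_le_of_norm_le (hint.restrict (s := Ioo a b)) hφi).trans ?_
  rw [← integral_const_mul]
  exact setIntegral_le_integral hint (Filter.Eventually.of_forall fun x => by
    simp only [Pi.zero_apply]; positivity)

/-- Weak bounds are local and invariant under translations. -/
lemma WeakBound.comp_add {a b p q M t : ℝ} {m : ℕ} {v w : ℝ → ℝ} (h : WeakBound a b m v M)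
    (hw : ∀ z ∈ Ioo p q, z + t ∈ Ioo a b ∧ w z = v (z + t)) : WeakBound p q m w M := by
  intro j hj φ hφ hc hs
  have hcont : Continuous fun z : ℝ => z - t := continuous_id.sub continuous_const
  have hsup : tsupport (fun z => φ (z - t)) ⊆ (fun z => z - t) ⁻¹' tsupport φ :=
    tsupport_comp_subset_preimage φ hcont
  have h1 := h j hj (fun z => φ (z - t)) (hφ.comp (contDiff_id.sub contDiff_const))
    (hc.comp_homeomorph (Homeomorph.subRight t)) (fun x hx => by
      have := (hw _ (hs (hsup hx))).1
      simpa using this)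
  rw [integral_sub_right_eq_self (fun z => |φ z|) t, iteratedDeriv_comp_sub_const,
    ← integral_add_right_eq_self _ t] at h1
  refine le_trans (le_of_eq (congrArg abs (integral_congr_ae
    (Filter.Eventually.of_forall fun z => ?_)))) h1
  simp only [add_sub_cancel_right]
  by_cases hz : z ∈ tsupport φ
  · rw [(hw z (hs hz)).2]
  · rw [iteratedDeriv_eq_zero_of_notMem_tsupport hz, mul_zero, mul_zero]

/-- The mollification of `v` with a normalized bump function. -/
noncomputable def mollify (φ : ContDiffBump (0 : ℝ)) (v : ℝ → ℝ) : ℝ → ℝ :=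
  convolution (φ.normed volume) v (ContinuousLinearMap.lsmul ℝ ℝ) volume

section Mollify

variable (φ : ContDiffBump (0 : ℝ)) {v : ℝ → ℝ}

lemma contDiff_mollify (hv : Continuous v) : ContDiff ℝ ∞ (mollify φ v) :=
  φ.hasCompactSupport_normed.contDiff_convolution_left (n := ⊤) _ φ.contDiff_normed
    hv.locallyIntegrable

lemma abs_mollify_sub_le (hv : Continuous v) {x δ : ℝ}
    (h : ∀ y, |y - x| < φ.rOut → |v y - v x| ≤ δ) : |mollify φ v x - v x| ≤ δ :=
  φ.dist_normed_convolution_le hv.aestronglyMeasurable fun y hy => h y hy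

lemma mollify_periodic {c : ℝ} (hv : ∀ x, v (x + c) = v x) (x : ℝ) :
    mollify φ v (x + c) = mollify φ v x := by
  simp only [mollify, convolution_lsmul]
  refine integral_congr_ae (Filter.Eventually.of_forall fun t => ?_)
  have := hv (x - t)
  simp only
  rw [← this]
  congr 2
  ring

lemma iteratedDeriv_mollify (hv : Continuous v) (j : ℕ) :
    iteratedDeriv j (mollify φ v) =
      convolution (iteratedDeriv j (φ.normed volume)) v (ContinuousLinearMap.lsmul ℝ ℝ) volume := by
  induction j with
  | zero => simp [mollify]
  | succ j ih =>
    funext x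
    rw [iteratedDeriv_succ, ih, iteratedDeriv_succ]
    have hs : ContDiff ℝ ∞ (φ.normed (volume : Measure ℝ)) := φ.contDiff_normed (n := ⊤)
    have hcs : HasCompactSupport (iteratedDeriv j (φ.normed (volume : Measure ℝ))) :=
      φ.hasCompactSupport_normed.mono' fun x hx => by
        by_contra h
        exact hx (iteratedDeriv_eq_zero_of_notMem_tsupport h j)
    refine (hcs.hasDerivAt_convolution_left _ ?_ hv.locallyIntegrable x).deriv
    rw [iteratedDeriv_eq_iterate]
    exact (hs.iterate_deriv j).of_le (by norm_cast)

/-- The derivatives of the mollification inherit the weak bounds. -/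
lemma WeakBound.abs_iteratedDeriv_mollify_le (hv : Continuous v) {p q M : ℝ} {m j : ℕ}
    (h : WeakBound p q m v M) (hj : j ≤ m) {x : ℝ} (hp : p < x - φ.rOut) (hq : x + φ.rOut < q) :
    |iteratedDeriv j (mollify φ v) x| ≤ M := by
  have hs : ContDiff ℝ ∞ (φ.normed (volume : Measure ℝ)) := φ.contDiff_normed (n := ⊤)
  have hcont : Continuous fun z : ℝ => x - z := continuous_const.sub continuous_id
  have hsup : tsupport (fun z => φ.normed volume (x - z)) ⊆
      (fun z => x - z) ⁻¹' tsupport (φ.normed volume) :=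
    tsupport_comp_subset_preimage (φ.normed volume) hcont
  have h1 := h j hj (fun z => φ.normed volume (x - z)) (hs.comp (contDiff_const.sub contDiff_id))
    (φ.hasCompactSupport_normed.comp_homeomorph (Homeomorph.subLeft x)) (fun z hz => by
      have h2 := hsup hz
      rw [mem_preimage, φ.tsupport_normed_eq, Metric.mem_closedBall, Real.dist_eq, sub_zero,
        abs_le] at h2
      exact ⟨by linarith [h2.2], by linarith [h2.1]⟩)
  rw [integral_sub_left_eq_self (fun z => |φ.normed volume z|) volume x,
    iteratedDeriv_comp_const_sub] at h1
  have h3 : ∫ z, |φ.normed volume z| = 1 := by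
    rw [← φ.integral_normed (μ := volume)]
    exact integral_congr_ae (Filter.Eventually.of_forall fun z => abs_of_nonneg (φ.nonneg_normed z))
  rw [h3, mul_one] at h1
  have h4 : ∫ z, v z * ((-1 : ℝ) ^ j • iteratedDeriv j (φ.normed volume) (x - z)) =
      (-1) ^ j * iteratedDeriv j (mollify φ v) x := by
    rw [iteratedDeriv_mollify φ hv, convolution_eq_swap, ← integral_const_mul]
    refine integral_congr_ae (Filter.Eventually.of_forall fun z => ?_)
    simp only [ContinuousLinearMap.lsmul_apply, smul_eq_mul]
    ring
  simp only [] at h1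
  rw [h4, abs_mul, abs_pow, abs_neg, abs_one, one_pow, one_mul] at h1
  exact h1

end Mollify

/-! ### Solutions are constant along characteristics -/

lemma abs_sub_sub_mul_deriv_le {g : ℝ → ℝ} (hg : ContDiff ℝ ∞ g) {M x y : ℝ}
    (h : ∀ ξ ∈ uIcc x y, |iteratedDeriv 2 g ξ| ≤ M) :
    |g y - g x - (y - x) * iteratedDeriv 1 g x| ≤ M * |y - x| ^ 2 := by
  have h1 := abs_iteratedDeriv_sub_taylorPoly_le hg 2 x y M h (κ := 0) (by omega)
  simp only [iteratedDeriv_zero, Function.iterate_zero, id, Nat.sub_zero, eval_taylorPoly,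
    Finset.sum_range_succ, Finset.sum_range_zero] at h1
  convert h1 using 2
  simp
  ring

/-- A weak bound on the second derivative bounds the remainder of the first order Taylor expansion
at every point of differentiability. -/
lemma WeakBound.abs_sub_sub_mul_le {a b M : ℝ} {m : ℕ} {v : ℝ → ℝ} (h : WeakBound a b m v M)
    (hm : 2 ≤ m) (hv : ContinuousOn v (Icc a b)) {x y p : ℝ} (hx : x ∈ Ioo a b) (hy : y ∈ Ioo a b)
    (hp : HasDerivAt v p x) : |v y - v x - (y - x) * p| ≤ M * |y - x| ^ 2 := by
  have hab : a ≤ b := (hx.1.trans hx.2).le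
  let w : ℝ → ℝ := IccExtend hab ((Icc a b).domRestrict v)
  have hw : Continuous w := (continuousOn_iff_continuous_domRestrict.1 hv).Icc_extend'
  have hwv : ∀ z ∈ Ioo a b, w z = v z := fun z hz => IccExtend_of_mem hab _ (Ioo_subset_Icc_self hz)
  have hW : WeakBound a b m w M := h.comp_add (t := 0) fun z hz => by
    simpa using ⟨hz, hwv z hz⟩
  let φ : ℕ → ContDiffBump (0 : ℝ) := fun n =>
    ⟨1 / ((n : ℝ) + 1) / 2, 1 / ((n : ℝ) + 1), by positivity, half_lt_self (by positivity)⟩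
  have hφ : Filter.Tendsto (fun n => (φ n).rOut) Filter.atTop (nhds 0) :=
    tendsto_one_div_add_atTop_nhds_zero_nat
  have hlim : ∀ z, Filter.Tendsto (fun n => mollify (φ n) w z) Filter.atTop (nhds (w z)) :=
    fun z => ContDiffBump.convolution_tendsto_right_of_continuous hφ hw z
  -- the quotient-free comparison of two difference quotients at the same base point
  have hthree : ∀ z ∈ Ioo a b, |(z - x) * (v y - v x) - (y - x) * (v z - v x)| ≤
      M * (|z - x| * |y - x| ^ 2 + |y - x| * |z - x| ^ 2) := by
    intro z hz
    rw [← hwv z hz, ← hwv x hx, ← hwv y hy]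
    refine le_of_tendsto ((((hlim y).sub (hlim x)).const_mul (z - x)).sub
      (((hlim z).sub (hlim x)).const_mul (y - x))).abs ?_
    set lo := min x (min y z) with hlo
    set hi := max x (max y z) with hhi
    have hlo' : a < lo := lt_min hx.1 (lt_min hy.1 hz.1)
    have hhi' : hi < b := max_lt hx.2 (max_lt hy.2 hz.2)
    filter_upwards [hφ.eventually_lt_const (show 0 < min (lo - a) (b - hi) from
      lt_min (by linarith) (by linarith))] with n hn
    have hn1 := hn.trans_le (min_le_left _ _)
    have hn2 := hn.trans_le (min_le_right _ _)
    have hsm := contDiff_mollify (φ n) hw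
    have hbd : ∀ ξ ∈ Icc lo hi, |iteratedDeriv 2 (mollify (φ n) w) ξ| ≤ M := fun ξ hξ =>
      hW.abs_iteratedDeriv_mollify_le (φ n) hw hm (by linarith [hξ.1]) (by linarith [hξ.2])
    have hsub : ∀ y' ∈ Icc lo hi, uIcc x y' ⊆ Icc lo hi := fun y' hy' =>
      uIcc_subset_Icc ⟨min_le_left _ _, le_max_left _ _⟩ hy'
    have h1 := abs_sub_sub_mul_deriv_le hsm fun ξ hξ => hbd ξ (hsub y
      ⟨(min_le_right _ _).trans (min_le_left _ _), (le_max_left _ _).trans (le_max_right _ _)⟩ hξ)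
    have h2 := abs_sub_sub_mul_deriv_le hsm fun ξ hξ => hbd ξ (hsub z
      ⟨(min_le_right _ _).trans (min_le_right _ _), (le_max_right _ _).trans (le_max_right _ _)⟩ hξ)
    set G := mollify (φ n) w
    have e : (z - x) * (G y - G x) - (y - x) * (G z - G x) =
        (z - x) * (G y - G x - (y - x) * iteratedDeriv 1 G x) -
        (y - x) * (G z - G x - (z - x) * iteratedDeriv 1 G x) := by ring
    rw [e]
    refine (abs_sub _ _).trans ?_
    rw [abs_mul, abs_mul]
    calc _ ≤ |z - x| * (M * |y - x| ^ 2) + |y - x| * (M * |z - x| ^ 2) := by gcongr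
      _ = _ := by ring
  have hs := hasDerivAt_iff_tendsto_slope.1 hp
  have hl : Filter.Tendsto (fun z => |v y - v x - (y - x) * slope v x z|) (nhdsWithin x {x}ᶜ)
      (nhds |v y - v x - (y - x) * p|) := (tendsto_const_nhds.sub (hs.const_mul _)).abs
  have hr : Filter.Tendsto (fun z => M * (|y - x| ^ 2 + |y - x| * |z - x|)) (nhdsWithin x {x}ᶜ)
      (nhds (M * |y - x| ^ 2)) := by
    have : Filter.Tendsto (fun z => M * (|y - x| ^ 2 + |y - x| * |z - x|)) (nhds x)
        (nhds (M * (|y - x| ^ 2 + |y - x| * |x - x|))) := by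
      refine Continuous.tendsto ?_ x
      fun_prop
    rw [sub_self, abs_zero, mul_zero, add_zero] at this
    exact this.mono_left nhdsWithin_le_nhds
  refine le_of_tendsto_of_tendsto hl hr ?_
  filter_upwards [self_mem_nhdsWithin, nhdsWithin_le_nhds (Ioo_mem_nhds hx.1 hx.2)] with z hz hz'
  have hzx : 0 < |z - x| := abs_pos.2 (sub_ne_zero.2 hz)
  have h1 := hthree z hz'
  refine le_of_mul_le_mul_left ?_ hzx
  rw [← abs_mul, slope_def_field]
  have hne : z - x ≠ 0 := sub_ne_zero.2 hz
  calc _ = |(z - x) * (v y - v x) - (y - x) * (v z - v x)| := by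
        congr 1
        field_simp
    _ ≤ _ := h1
    _ = _ := by ring

section Characteristics

variable {bc : BC} {a b T M : ℝ} {u₀ : ℝ → ℝ} {u : ℝ → ℝ → ℝ}

lemma IsSolution.continuousOn_left (hu : IsSolution bc a b T u₀ u) {t : ℝ} (ht : t ∈ Icc 0 T) :
    ContinuousOn (fun x => u x t) (Icc a b) :=
  hu.cont.comp (f := fun x => (x, t)) (by fun_prop) fun _ hx => ⟨hx, ht⟩

lemma IsSolution.continuousOn_right (hu : IsSolution bc a b T u₀ u) {x : ℝ} (hx : x ∈ Icc a b) :
    ContinuousOn (fun t => u x t) (Icc 0 T) :=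
  hu.cont.comp (f := fun t => (x, t)) (by fun_prop) fun _ ht => ⟨hx, ht⟩

/-- The partial derivatives of a classical solution need not be continuous, but the bound on the
second derivative in space makes the first one continuous in time, which is enough for the chain rule
along a characteristic. -/
lemma IsSolution.hasDerivAt_characteristic (hu : IsSolution bc a b T u₀ u)
    (hM : ∀ t ∈ Icc 0 T, WeakBound a b 2 (fun x => u x t) M) {x t : ℝ} (hx : x ∈ Ioo a b)
    (ht : t ∈ Ioo 0 T) : HasDerivAt (fun r => u (x + r) (t + r)) 0 0 := by
  have hder : ∀ t' : ℝ, ∃ q : ℝ, t' ∈ Ioo 0 T →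
      HasDerivAt (fun z => u z t') q x ∧ HasDerivAt (fun r => u x r) (-q) t' := by
    intro t'
    by_cases h : t' ∈ Ioo 0 T
    · obtain ⟨ux, ut, h1, h2, h3⟩ := hu.pde x (Ioo_subset_Icc_self hx) t' ⟨h.1, h.2.le⟩
      refine ⟨ux, fun _ => ⟨h1.hasDerivAt (Icc_mem_nhds hx.1 hx.2), ?_⟩⟩
      rw [show -ux = ut by linarith]
      exact h2.hasDerivAt (Icc_mem_nhds h.1 h.2)
    · exact ⟨0, fun h' => absurd h' h⟩
  choose q hq using hder
  have hTay : ∀ t' ∈ Ioo 0 T, ∀ y ∈ Ioo a b,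
      |u y t' - u x t' - (y - x) * q t'| ≤ M * |y - x| ^ 2 := fun t' ht' y hy =>
    (hM t' (Ioo_subset_Icc_self ht')).abs_sub_sub_mul_le le_rfl
      (hu.continuousOn_left (Ioo_subset_Icc_self ht')) hx hy (hq t' ht').1
  have hcont : ∀ y ∈ Ioo a b, ContinuousAt (fun r => u y r) t := fun y hy =>
    (hu.continuousOn_right (Ioo_subset_Icc_self hy)).continuousAt (Icc_mem_nhds ht.1 ht.2)
  have hqc : ContinuousAt q t := by
    rw [Metric.continuousAt_iff']
    intro η hη
    have hM0 : 0 ≤ |M| := abs_nonneg M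
    set d := min ((b - x) / 2) (η / (4 * (|M| + 1))) with hd
    have hd0 : 0 < d := lt_min (by linarith [hx.2]) (by positivity)
    have hdη : |M| * d ≤ η / 4 := by
      have h1 : d ≤ η / (4 * (|M| + 1)) := min_le_right _ _
      calc |M| * d ≤ (|M| + 1) * (η / (4 * (|M| + 1))) := by gcongr; linarith
        _ = η / 4 := by field_simp
    have hy : x + d ∈ Ioo a b := ⟨by linarith [hx.1], by
      have : d ≤ (b - x) / 2 := min_le_left _ _
      linarith [hx.2]⟩
    have c1 := Metric.continuousAt_iff'.1 (hcont _ hy) (d * η / 8) (by positivity)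
    have c2 := Metric.continuousAt_iff'.1 (hcont _ hx) (d * η / 8) (by positivity)
    filter_upwards [c1, c2, Ioo_mem_nhds ht.1 ht.2] with t' h1 h2 ht'
    rw [Real.dist_eq] at h1 h2 ⊢
    have h3 := hTay t' ht' _ hy
    have h4 := hTay t ht _ hy
    rw [add_sub_cancel_left, abs_of_pos hd0] at h3 h4
    have h5 : M * d ^ 2 ≤ d * (η / 4) := by
      calc M * d ^ 2 ≤ |M| * d ^ 2 := by gcongr; exact le_abs_self M
        _ = d * (|M| * d) := by ring
        _ ≤ _ := by gcongr
    have h6 : |d * (q t' - q t)| < d * η := by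
      rw [abs_lt] at h1 h2 ⊢
      rw [abs_le] at h3 h4
      constructor <;> nlinarith [h1.1, h1.2, h2.1, h2.2, h3.1, h3.2, h4.1, h4.2]
    rw [abs_mul, abs_of_pos hd0] at h6
    exact lt_of_mul_lt_mul_left h6 hd0.le
  -- the increment splits into one in time at `x` and one in space at the later time
  have hB : HasDerivAt (fun r => u x (t + r)) (-q t) 0 := by
    have h1 := (hq t ht).2
    rw [← add_zero t] at h1
    simpa using h1.comp_const_add t 0
  have hA : HasDerivAt (fun r => u (x + r) (t + r) - u x (t + r)) (q t) 0 := by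
    rw [hasDerivAt_iff_tendsto_slope]
    have hq0 : Filter.Tendsto (fun r => q (t + r)) (nhdsWithin 0 {0}ᶜ) (nhds (q t)) := by
      have h1 : Filter.Tendsto (fun r : ℝ => t + r) (nhds 0) (nhds t) := by
        have : Continuous fun r : ℝ => t + r := by fun_prop
        simpa using this.tendsto 0
      exact (hqc.tendsto.comp h1).mono_left nhdsWithin_le_nhds
    have herr : Filter.Tendsto (fun r => slope (fun r => u (x + r) (t + r) - u x (t + r)) 0 r
        - q (t + r)) (nhdsWithin 0 {0}ᶜ) (nhds 0) := by
      have h0 : Filter.Tendsto (fun r : ℝ => M * |r|) (nhdsWithin 0 {0}ᶜ) (nhds 0) := by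
        have : Continuous fun r : ℝ => M * |r| := by fun_prop
        simpa using (this.tendsto 0).mono_left (nhdsWithin_le_nhds (s := {0}ᶜ))
      refine squeeze_zero_norm' ?_ h0
      have m1 : ∀ᶠ r : ℝ in nhds 0, t + r ∈ Ioo 0 T :=
        (show Continuous fun r : ℝ => t + r by fun_prop).continuousAt.eventually_mem
          (by simpa using Ioo_mem_nhds ht.1 ht.2)
      have m2 : ∀ᶠ r : ℝ in nhds 0, x + r ∈ Ioo a b :=
        (show Continuous fun r : ℝ => x + r by fun_prop).continuousAt.eventually_mem
          (by simpa using Ioo_mem_nhds hx.1 hx.2)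
      filter_upwards [self_mem_nhdsWithin, nhdsWithin_le_nhds m1, nhdsWithin_le_nhds m2]
        with r hr h1 h2
      have hr0 : r ≠ 0 := hr
      have h3 := hTay _ h1 _ h2
      rw [add_sub_cancel_left] at h3
      rw [Real.norm_eq_abs, slope_def_field]
      simp only [add_zero, sub_self, sub_zero]
      refine le_of_mul_le_mul_left ?_ (abs_pos.2 hr0)
      rw [← abs_mul]
      calc _ = |u (x + r) (t + r) - u x (t + r) - r * q (t + r)| := by
            congr 1
            field_simp
        _ ≤ _ := h3
        _ = _ := by ring
    have := herr.add hq0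
    simpa using this
  have hAB := hA.add hB
  rw [add_neg_cancel] at hAB
  exact hAB.congr_of_eventuallyEq (Filter.Eventually.of_forall fun r => by simp)

/-- A solution is constant along characteristics. -/
lemma IsSolution.eq_of_characteristic (hu : IsSolution bc a b T u₀ u)
    (hM : ∀ t ∈ Icc 0 T, WeakBound a b 2 (fun x => u x t) M) {x t r : ℝ} (hx : x ≤ b)
    (ht : t ≤ T) (hr : 0 ≤ r) (hxr : a ≤ x - r) (htr : 0 ≤ t - r) : u x t = u (x - r) (t - r) := by
  rcases hr.eq_or_lt with rfl | hr
  · simp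
  have hc : ContinuousOn (fun ϖ => u (x - r + ϖ) (t - r + ϖ)) (Icc 0 r) :=
    hu.cont.comp (f := fun ϖ => (x - r + ϖ, t - r + ϖ)) (by fun_prop) fun ϖ hϖ =>
      ⟨⟨by linarith [hϖ.1], by linarith [hϖ.2]⟩, ⟨by linarith [hϖ.1], by linarith [hϖ.2]⟩⟩
  obtain ⟨c, _, h⟩ := exists_hasDerivAt_eq_slope (fun ϖ => u (x - r + ϖ) (t - r + ϖ)) (fun _ => 0)
    hr hc fun ϖ hϖ => by
      have h1 := hu.hasDerivAt_characteristic hM (x := x - r + ϖ) (t := t - r + ϖ)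
        ⟨by linarith [hϖ.1], by linarith [hϖ.2]⟩ ⟨by linarith [hϖ.1], by linarith [hϖ.2]⟩
      have h2 : HasDerivAt (fun z => u (x - r + ϖ + (z - ϖ)) (t - r + ϖ + (z - ϖ))) 0 ϖ :=
        HasDerivAt.comp_sub_const (f := fun z => u (x - r + ϖ + z) (t - r + ϖ + z)) ϖ ϖ
          (by rwa [sub_self])
      refine h2.congr_of_eventuallyEq (Filter.Eventually.of_forall fun z => ?_)
      simp only
      congr 1 <;> ring
  simp only [sub_add_cancel, add_zero] at h
  rw [eq_comm, div_eq_zero_iff] at h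
  rcases h with h | h <;> linarith

end Characteristics

/-! ### Smooth approximations of the solution -/

section Profile

variable {a b T M : ℝ} {u₀ : ℝ → ℝ} {u : ℝ → ℝ → ℝ} {m : ℕ}

lemma WeakBound.of_eq_zero {p q : ℝ} {w : ℝ → ℝ} (hM : 0 ≤ M) (hw : ∀ z ∈ Ioo p q, w z = 0) :
    WeakBound p q m w M := by
  intro j _ φ _ _ hs
  have h0 : ∀ x, w x * iteratedDeriv j φ x = 0 := fun x => by
    by_cases hx : x ∈ tsupport φ
    · rw [hw x (hs hx), zero_mul]
    · rw [iteratedDeriv_eq_zero_of_notMem_tsupport hx, mul_zero]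
  simp only [h0, integral_zero, abs_zero]
  exact mul_nonneg hM (integral_nonneg fun x => abs_nonneg _)

/-- A bound on the solution at time `t` is a bound on its profile over an interval shifted by `t`.
Short intervals that straddle `a` are reached this way as well. -/
lemma WeakBound.of_translate {G : ℝ → ℝ} (hT : 0 < T)
    (hG : ∀ x ∈ Icc a b, ∀ t ∈ Icc 0 T, u x t = G (x - t))
    (hM : ∀ t ∈ Icc 0 T, WeakBound a b m (fun x => u x t) M) {p : ℝ} (hp : p ∈ Icc a b) :
    WeakBound (p - min T (b - a)) p m G M := by
  set δ := min T (b - a) with hδ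
  have hδT : δ ≤ T := min_le_left _ _
  have hδb : δ ≤ b - a := min_le_right _ _
  set t := max 0 (a - p + δ) with ht
  have ht0 : 0 ≤ t := le_max_left _ _
  have ht1 : a - p + δ ≤ t := le_max_right _ _
  have ht2 : t ≤ T := max_le hT.le (by linarith [hp.1])
  have ht3 : p + t ≤ b := by
    rcases max_choice 0 (a - p + δ) with h | h
    · rw [ht, h]; linarith [hp.2]
    · rw [ht, h]; linarith
  refine (hM t ⟨ht0, ht2⟩).comp_add (t := t) fun z hz => ?_
  have hz' : z + t ∈ Ioo a b := ⟨by linarith [hz.1], by linarith [hz.2]⟩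
  refine ⟨hz', ?_⟩
  rw [hG _ (Ioo_subset_Icc_self hz') t ⟨ht0, ht2⟩, add_sub_cancel_right]

/-- The profile of a solution with inflow boundary condition, extended by zero. -/
lemma IsSolution.exists_profile_inflow (hab : a < b) (hT : 0 < T)
    (hu : IsSolution .inflow a b T u₀ u) (hm : 2 ≤ m) (hM0 : 0 ≤ M)
    (hM : ∀ t ∈ Icc 0 T, WeakBound a b m (fun x => u x t) M) :
    ∃ G : ℝ → ℝ, Continuous G ∧ (∀ x ∈ Icc a b, ∀ t ∈ Icc 0 T, u x t = G (x - t)) ∧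
      (∀ p ≤ b, WeakBound (p - min T (b - a)) p m G M) ∧ ∀ z ≤ a, G z = 0 := by
  have hM2 : ∀ t ∈ Icc 0 T, WeakBound a b 2 (fun x => u x t) M := fun t ht j hj =>
    hM t ht j (hj.trans hm)
  have h0T : (0 : ℝ) ∈ Icc 0 T := ⟨le_rfl, hT.le⟩
  have hzero : ∀ z ≤ a, u (max a (min b z)) 0 = 0 := fun z hz => by
    rw [max_eq_left ((min_le_right _ _).trans hz)]
    exact hu.boundary 0 h0T
  have hG : ∀ x ∈ Icc a b, ∀ t ∈ Icc 0 T, u x t = u (max a (min b (x - t))) 0 := by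
    intro x hx t ht
    rcases le_total a (x - t) with h | h
    · rw [min_eq_right (by linarith [hx.2, ht.1]), max_eq_right h,
        hu.eq_of_characteristic hM2 hx.2 ht.2 ht.1 h (by simp), sub_self]
    · rw [hzero _ h, hu.eq_of_characteristic hM2 (r := x - a) hx.2 ht.2 (by linarith [hx.1])
        (by linarith) (by linarith), sub_sub_cancel]
      exact hu.boundary _ ⟨by linarith, by linarith [ht.2, hx.1]⟩
  refine ⟨fun z => u (max a (min b z)) 0, ?_, hG, fun p hp => ?_, hzero⟩
  · exact (hu.continuousOn_left h0T).comp_continuous (f := fun z => max a (min b z)) (by fun_prop)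
      fun z => ⟨le_max_left _ _, max_le hab.le (min_le_left _ _)⟩
  · rcases le_total a p with h | h
    · exact .of_translate hT hG hM ⟨h, hp⟩
    · exact .of_eq_zero hM0 fun z hz => hzero z (hz.2.le.trans h)

/-- The profile of a periodic solution, extended periodically. -/
lemma IsSolution.exists_profile_periodic (hab : a < b) (hT : 0 < T)
    (hu : IsSolution .periodic a b T u₀ u) (hm : 2 ≤ m)
    (hM : ∀ t ∈ Icc 0 T, WeakBound a b m (fun x => u x t) M) :
    ∃ G : ℝ → ℝ, Continuous G ∧ (∀ x ∈ Icc a b, ∀ t ∈ Icc 0 T, u x t = G (x - t)) ∧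
      (∀ p ≤ b, WeakBound (p - min T (b - a)) p m G M) ∧ ∀ z, G (z + (b - a)) = G z := by
  have hM2 : ∀ t ∈ Icc 0 T, WeakBound a b 2 (fun x => u x t) M := fun t ht j hj =>
    hM t ht j (hj.trans hm)
  have h0T : (0 : ℝ) ∈ Icc 0 T := ⟨le_rfl, hT.le⟩
  have hab' : 0 < b - a := sub_pos.2 hab
  have : Fact (0 < b - a) := ⟨hab'⟩
  have hb0 : u a 0 = u b 0 := hu.boundary 0 h0T
  let F : AddCircle (b - a) → ℝ := AddCircle.liftIco (b - a) a (fun x => u x 0)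
  have hF : Continuous F := by
    refine AddCircle.liftIco_continuous ?_ ?_
    · simpa using hb0
    · simpa using hu.continuousOn_left h0T
  let G : ℝ → ℝ := fun z => F (z : AddCircle (b - a))
  have hper : ∀ z, G (z + (b - a)) = G z := fun z => by
    simp only [G, AddCircle.coe_add_period]
  have hGu : ∀ x ∈ Icc a b, u x 0 = G x := by
    have h1 : ∀ x ∈ Ico a b, u x 0 = G x := fun x hx => by
      have : x ∈ Ico a (a + (b - a)) := by simpa using hx
      exact (AddCircle.liftIco_coe_apply (f := fun x => u x 0) this).symm
    intro x hx
    rcases hx.2.eq_or_lt with rfl | h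
    · rw [← hb0, h1 a ⟨le_rfl, hab⟩, ← hper a, add_sub_cancel]
    · exact h1 x ⟨hx.1, h⟩
  have hstep : ∀ n : ℕ, ∀ x ∈ Icc a b, ∀ t ∈ Icc 0 T, t ≤ x - a + n * (b - a) →
      u x t = G (x - t) := by
    intro n
    induction n with
    | zero =>
      intro x hx t ht h
      simp only [Nat.cast_zero, zero_mul, add_zero] at h
      rw [hu.eq_of_characteristic hM2 hx.2 ht.2 ht.1 (by linarith) (by simp), sub_self]
      exact hGu _ ⟨by linarith, by linarith [hx.2, ht.1]⟩
    | succ n ih =>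
      intro x hx t ht h
      rcases le_total t (x - a) with h1 | h1
      · exact ih x hx t ht (h1.trans (by have : 0 ≤ (n : ℝ) * (b - a) := by positivity
                                         linarith))
      · have h2 : t - (x - a) ∈ Icc 0 T := ⟨by linarith, by linarith [ht.2, hx.1]⟩
        rw [hu.eq_of_characteristic hM2 (r := x - a) hx.2 ht.2 (by linarith [hx.1])
          (by linarith) h2.1, sub_sub_cancel]
        have h3 : u a (t - (x - a)) = u b (t - (x - a)) := hu.boundary _ h2
        push_cast at h
        rw [h3, ih b ⟨hab.le, le_rfl⟩ _ h2 (by linarith), ← hper (x - t)]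
        congr 1
        ring
  have hG : ∀ x ∈ Icc a b, ∀ t ∈ Icc 0 T, u x t = G (x - t) := by
    intro x hx t ht
    obtain ⟨n, hn⟩ := exists_nat_ge (t / (b - a))
    rw [div_le_iff₀ hab'] at hn
    exact hstep n x hx t ht (by linarith [hx.1])
  refine ⟨G, hF.comp (AddCircle.continuous_mk' _), hG, fun p _ => ?_, hper⟩
  obtain ⟨n, hn, -⟩ := existsUnique_add_zsmul_mem_Ioc hab' p a
  have hz : ∀ z, G (z + n • (b - a)) = G z := fun z => by
    simp only [G, AddCircle.coe_add, AddCircle.coe_zsmul, AddCircle.coe_period, smul_zero, add_zero]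
  refine (WeakBound.of_translate hT hG hM (p := p + n • (b - a)) ⟨hn.1.le, by
    simpa using hn.2⟩).comp_add (t := n • (b - a)) fun z hz' => ⟨⟨?_, ?_⟩, (hz z).symm⟩
  · linarith [hz'.1]
  · linarith [hz'.2]

/-- Mollifying with a bump that looks upstream keeps the bounds up to `b`, where the profile ends. -/
lemma exists_smooth_of_profile {δ₀ : ℝ} (hδ₀ : 0 < δ₀) {G : ℝ → ℝ} (hG : Continuous G)
    (hW : ∀ p ≤ b, WeakBound (p - δ₀) p m G M) {δ : ℝ} (hδ : 0 < δ) :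
    ∃ g : ℝ → ℝ, ContDiff ℝ ∞ g ∧ (∀ z ∈ Icc (a - T) b, |g z - G z| ≤ δ) ∧
      (∀ j ≤ m, ∀ z ≤ b, |iteratedDeriv j g z| ≤ M) ∧
      ((∀ z ≤ a, G z = 0) → ∀ κ, ∀ z ≤ a, iteratedDeriv κ g z = 0) ∧
      ∀ c, (∀ z, G (z + c) = G z) → ∀ z, g (z + c) = g z := by
  have huc := (isCompact_Icc (a := a - T - 1) (b := b)).uniformContinuousOn_of_continuous
    hG.continuousOn
  obtain ⟨η, hη, hη'⟩ := Metric.uniformContinuousOn_iff_le.1 huc (δ / 2) (by positivity)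
  set ε := min (min (δ₀ / 4) (η / 4)) (1 / 4) with hε
  have hε0 : 0 < ε := by positivity
  have h1 : ε ≤ δ₀ / 4 := (min_le_left _ _).trans (min_le_left _ _)
  have h2 : ε ≤ η / 4 := (min_le_left _ _).trans (min_le_right _ _)
  have h3 : ε ≤ 1 / 4 := min_le_right _ _
  let φ : ContDiffBump (0 : ℝ) := ⟨ε / 2, ε, by positivity, half_lt_self hε0⟩
  have hφ : φ.rOut = ε := rfl
  have hsm := contDiff_mollify φ hG
  refine ⟨fun z => mollify φ G (z - 2 * ε), hsm.comp (contDiff_id.sub contDiff_const),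
    fun z hz => ?_, fun j hj z hz => ?_, fun h0 κ z hz => ?_, fun c hc z => ?_⟩
  · have hmem : ∀ x, |x - (z - 2 * ε)| ≤ 2 * ε → x ∈ Icc (a - T - 1) b := fun x hx => by
      rw [abs_le] at hx
      exact ⟨by linarith [hz.1, hx.1], by linarith [hz.2, hx.2]⟩
    have hz2 : z - 2 * ε ∈ Icc (a - T - 1) b := hmem _ (by simpa using hε0.le)
    have e1 : |mollify φ G (z - 2 * ε) - G (z - 2 * ε)| ≤ δ / 2 := by
      refine abs_mollify_sub_le φ hG fun x hx => ?_
      rw [hφ] at hx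
      exact hη' x (hmem x (by linarith)) _ hz2 (by rw [Real.dist_eq]; linarith)
    have e2 : |G (z - 2 * ε) - G z| ≤ δ / 2 := by
      refine hη' _ hz2 z (hmem z ?_) ?_
      · rw [sub_sub_cancel, abs_of_pos (by positivity)]
      · rw [Real.dist_eq, sub_sub_cancel_left, abs_neg, abs_of_pos (by positivity)]
        linarith
    rw [abs_le] at e1 e2 ⊢
    constructor <;> linarith [e1.1, e1.2, e2.1, e2.2]
  · rw [iteratedDeriv_comp_sub_const]
    exact (hW z hz).abs_iteratedDeriv_mollify_le φ hG hj (by rw [hφ]; linarith)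
      (by rw [hφ]; linarith)
  · have hev : (fun z => mollify φ G (z - 2 * ε)) =ᶠ[nhds z] fun _ => 0 := by
      filter_upwards [Iio_mem_nhds (show z < a + ε by linarith)] with x hx
      rw [mem_Iio] at hx
      have hx0 : G (x - 2 * ε) = 0 := h0 _ (by linarith)
      have := abs_mollify_sub_le φ hG (x := x - 2 * ε) (δ := 0) fun y hy => by
        rw [hφ, abs_lt] at hy
        rw [hx0, h0 y (by linarith [hy.2])]
        simp
      rw [hx0, sub_zero] at this
      exact abs_nonpos_iff.1 this
    rw [hev.iteratedDeriv_eq]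
    simp
  · have := mollify_periodic φ hc (z - 2 * ε)
    simp only
    rw [← this]
    congr 1
    ring

/-- A smooth solution of the transport equation that is uniformly close to `u`, satisfies the same
bounds and has the same kind of boundary values. -/
lemma IsSolution.exists_smooth {bc : BC} (hab : a < b) (hT : 0 < T) (hu : IsSolution bc a b T u₀ u)
    (hm : 2 ≤ m) (hM0 : 0 ≤ M) (hM : ∀ t ∈ Icc 0 T, WeakBound a b m (fun x => u x t) M)
    {δ : ℝ} (hδ : 0 < δ) :
    ∃ g : ℝ → ℝ, ContDiff ℝ ∞ g ∧ (∀ x ∈ Icc a b, ∀ t ∈ Icc 0 T, |g (x - t) - u x t| ≤ δ) ∧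
      (∀ j ≤ m, ∀ z ≤ b, |iteratedDeriv j g z| ≤ M) ∧
      match bc with
      | .inflow => ∀ κ, ∀ z ≤ a, iteratedDeriv κ g z = 0
      | .periodic => ∀ z, g (z + (b - a)) = g z := by
  have hδ₀ : 0 < min T (b - a) := lt_min hT (sub_pos.2 hab)
  cases bc with
  | inflow =>
    obtain ⟨G, h1, h2, h3, h4⟩ := hu.exists_profile_inflow hab hT hm hM0 hM
    obtain ⟨g, g1, g2, g3, g4, -⟩ := exists_smooth_of_profile (a := a) (T := T) hδ₀ h1 h3 hδ
    refine ⟨g, g1, fun x hx t ht => ?_, g3, g4 h4⟩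
    rw [h2 x hx t ht]
    exact g2 _ ⟨by linarith [hx.1, ht.2], by linarith [hx.2, ht.1]⟩
  | periodic =>
    obtain ⟨G, h1, h2, h3, h4⟩ := hu.exists_profile_periodic hab hT hm hM
    obtain ⟨g, g1, g2, g3, -, g4⟩ := exists_smooth_of_profile (a := a) (T := T) hδ₀ h1 h3 hδ
    refine ⟨g, g1, fun x hx t ht => ?_, g3, g4 _ h4⟩
    rw [h2 x hx t ht]
    exact g2 _ ⟨by linarith [hx.1, ht.2], by linarith [hx.2, ht.1]⟩

end Profile

/-! ### The scheme on the reference element -/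

/-- A polynomial of degree at most `k` is determined by its averages over the control volumes. -/
lemma eq_zero_of_integral_eq_zero {kind : SVKind} {k : ℕ} {y : ℕ → ℝ} (hy : IsSubdivision kind k y)
    {p : ℝ[X]} (hp : p.natDegree ≤ k) (h : ∀ j ≤ k, ∫ x in (y j)..(y (j + 1)), p.eval x = 0) :
    p = 0 := by
  let S₀ : ℝ[X] := ∑ i ∈ Finset.range (k + 1), C (p.coeff i / (i + 1)) * X ^ (i + 1)
  have hS₀ : derivative S₀ = p := by
    rw [p.as_sum_range' (k + 1) (by omega), derivative_sum]
    refine Finset.sum_congr rfl fun i _ => ?_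
    have : ((i : ℝ) + 1) ≠ 0 := by positivity
    rw [derivative_C_mul_X_pow, Nat.add_sub_cancel, ← C_mul_X_pow_eq_monomial]
    congr 2
    push_cast
    field_simp
  set S : ℝ[X] := S₀ - C (S₀.eval (-1)) with hS
  have hSd : derivative S = p := by rw [hS, derivative_sub, derivative_C, sub_zero, hS₀]
  have hSdeg : S.natDegree ≤ k + 1 := by
    refine (natDegree_sub_le _ _).trans (max_le (natDegree_sum_le_of_forall_le _ _ fun i hi => ?_)
      (by simp))
    have := Finset.mem_range.1 hi
    exact (natDegree_C_mul_X_pow_le _ _).trans (by omega)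
  have hS1 : S.eval (-1) = 0 := by simp [hS]
  have hroot : ∀ j ≤ k + 1, S.eval (y j) = 0 := by
    intro j
    induction j with
    | zero => intro _; rw [hy.left, hS1]
    | succ j ih =>
      intro hj
      have h1 := h j (by omega)
      rw [← hSd, integral_derivative_eval, ih (by omega), sub_zero] at h1
      exact h1
  by_contra hne
  have hSne : S ≠ 0 := fun h0 => hne (by rw [← hSd, h0, derivative_zero])
  exact eval_neg_one_ne_zero hy S hSne hSdeg (fun j _ hj => hroot j hj) hS1

namespace Mesh

variable {a b : ℝ} {N : ℕ} (m : Mesh a b N)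

/-- The midpoint of the `i`-th element. -/
noncomputable def mid (i : ℕ) : ℝ := (m.node i + m.node (i + 1)) / 2

/-- The pullbacks to the reference element of the pieces of a piecewise polynomial. -/
noncomputable def toRef (p : ℕ → ℝ[X]) (i : ℕ) : ℝ[X] :=
  if i < N then (p i).comp (C (m.len i / 2) * X + C (m.mid i)) else 0

variable {m}

lemma len_pos {i : ℕ} (hi : i < N) : 0 < m.len i := sub_pos.2 (m.lt i hi)

lemma toRef_eval {p : ℕ → ℝ[X]} {i : ℕ} (hi : i < N) (ξ : ℝ) :
    (m.toRef p i).eval ξ = (p i).eval (m.len i / 2 * ξ + m.mid i) := by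
  simp [toRef, hi, eval_comp]

lemma toRef_mem {k : ℕ} {p : ℕ → ℝ[X]} (hp : ∀ i < N, (p i).natDegree ≤ k) :
    m.toRef p ∈ degSubmodule k := by
  intro i
  by_cases hi : i < N
  · simp only [toRef, hi, if_true]
    refine natDegree_comp_le.trans ?_
    have : (C (m.len i / 2) * X + C (m.mid i)).natDegree ≤ 1 := natDegree_linear_le
    calc _ ≤ k * 1 := Nat.mul_le_mul (hp i hi) this
      _ = k := mul_one k
  · simp [toRef, hi]

lemma integral_point {y : ℕ → ℝ} {p : ℕ → ℝ[X]} {i : ℕ} (hi : i < N) (j : ℕ) :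
    ∫ x in (m.point y i j)..(m.point y i (j + 1)), (p i).eval x =
      m.len i / 2 * ∫ ξ in (y j)..(y (j + 1)), (m.toRef p i).eval ξ := by
  simp only [toRef_eval hi]
  exact (intervalIntegral.mul_integral_comp_mul_add (f := fun x => (p i).eval x) _ _).symm

lemma toRef_eval_one {p : ℕ → ℝ[X]} {i : ℕ} (hi : i < N) :
    (m.toRef p i).eval 1 = (p i).eval (m.node (i + 1)) := by
  rw [toRef_eval hi]
  congr 1
  simp only [len, mid]
  ring

/-- The traces of the scheme on the reference element. -/
lemma leftTrace_eq {bc : BC} {y : ℕ → ℝ} {p : ℕ → ℝ[X]} {i : ℕ} (hi : i < N) (j : ℕ) :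
    leftTrace bc m y p i j =
      if j = 0 then upwindTrace bc N (m.toRef p) i else (m.toRef p i).eval (y j) := by
  unfold leftTrace
  refine if_congr Iff.rfl ?_ ?_
  · unfold upwindTrace
    refine if_ctx_congr Iff.rfl (fun _ => ?_) (fun h => ?_)
    · cases bc
      · rfl
      · simp only
        rw [toRef_eval_one (by omega), Nat.sub_add_cancel (by omega), m.last]
    · rw [toRef_eval_one (by omega), Nat.sub_add_cancel (by omega)]
  · rw [toRef_eval hi]
    rfl

end Mesh

section Scheme

variable {a b : ℝ} {N : ℕ} {m : Mesh a b N} {kind : SVKind} {s k : ℕ} {bc : BC} {y : ℕ → ℝ}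
  {τ : ℝ} {M : ℕ} {U : ℕ → ℕ → ℕ → ℝ[X]} {R : ℝ[X]} {γ : ℝ}

/-- The averages of the spatial operator over the control volumes are the flux differences. -/
lemma integral_svOp (hy : IsSubdivision kind k y) (hR : IsCorrection k y R γ) {i : ℕ} (hi : i < N)
    (p : ℕ → ℝ[X]) {j : ℕ} (hj : j ≤ k) :
    m.len i / 2 * ∫ ξ in (y j)..(y (j + 1)),
        (svOp bc N m.len (derivative R) (m.toRef p) i).eval ξ =
      -(leftTrace bc m y p i (j + 1) - leftTrace bc m y p i j) := by
  have hl := m.len_pos hi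
  set v := m.toRef p with hv
  have e : svOp bc N m.len (derivative R) v i = derivative (C (-(2 / m.len i)) *
      (v i + C ((v i).eval (-1) - upwindTrace bc N v i) * R)) := by
    rw [svOp_apply hi, derivative_C_mul, derivative_add, derivative_C_mul]
  rw [e, integral_derivative_eval, Mesh.leftTrace_eq hi, Mesh.leftTrace_eq hi, ← hv,
    if_neg (Nat.succ_ne_zero j)]
  simp only [eval_mul, eval_add, eval_C]
  rw [hR.root (j + 1) (by omega) (by omega)]
  by_cases h0 : j = 0
  · rw [if_pos h0, h0, hy.left, hR.left]
    field_simp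
    ring
  · rw [if_neg h0, hR.root j (by omega) (by omega)]
    field_simp
    ring

lemma IsRKSV.toRef_mem (hU : IsRKSV s k bc m y τ M U) {n l : ℕ} (hn : n < M) (hl : l ≤ s) :
    m.toRef (U n l) ∈ degSubmodule k :=
  Mesh.toRef_mem fun i hi => hU.degree n hn l hl i hi

lemma IsRKSV.toRef_stage (hU : IsRKSV s k bc m y τ M U) (hy : IsSubdivision kind k y)
    (hR : IsCorrection k y R γ) {n l : ℕ} (hn : n < M) (hl : l < s) :
    m.toRef (U n (l + 1)) = ∑ κ ∈ Finset.range (l + 1),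
      ((rkC s l κ : ℝ) • m.toRef (U n κ) +
        (rkD s l κ : ℝ) • (τ • svOp bc N m.len (derivative R)) (m.toRef (U n κ))) := by
  have hr : (derivative R).natDegree ≤ k :=
    (natDegree_derivative_le _).trans (by have := hR.degree; omega)
  set E := svOp bc N m.len (derivative R) with hE
  funext i
  by_cases hi : i < N
  · have hl0 := m.len_pos hi
    rw [← sub_eq_zero]
    refine eq_zero_of_integral_eq_zero hy ?_ fun j hj => ?_
    · refine (natDegree_sub_le _ _).trans (max_le (hU.toRef_mem hn (by omega) i) ?_)
      refine (Submodule.sum_mem (degSubmodule k) fun κ hκ => ?_ : _ ∈ degSubmodule k) i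
      have hκ := Finset.mem_range.1 hκ
      have h1 := hU.toRef_mem hn (l := κ) (by omega)
      refine Submodule.add_mem _ (Submodule.smul_mem _ _ h1) (Submodule.smul_mem _ _ ?_)
      rw [LinearMap.smul_apply]
      exact Submodule.smul_mem _ _ (svOp_mem hr h1)
    · have h1 := hU.stage n hn l hl i hi j hj
      rw [Mesh.integral_point hi] at h1
      have h2 : ∀ κ, m.len i / 2 * ∫ ξ in (y j)..(y (j + 1)),
          (((rkC s l κ : ℝ) • m.toRef (U n κ) + (rkD s l κ : ℝ) • (τ • E) (m.toRef (U n κ))) i).eval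
            ξ = (rkC s l κ : ℝ) * (∫ x in (m.point y i j)..(m.point y i (j + 1)), (U n κ i).eval x) -
          τ * (rkD s l κ : ℝ) *
            (leftTrace bc m y (U n κ) i (j + 1) - leftTrace bc m y (U n κ) i j) := by
        intro κ
        have h3 := integral_svOp (bc := bc) (m := m) hy hR hi (U n κ) hj
        rw [← hE] at h3
        simp only [Pi.add_apply, Pi.smul_apply, LinearMap.smul_apply, eval_add, eval_smul,
          smul_eq_mul]
        rw [intervalIntegral.integral_add ((intervalIntegrable_eval _ _ _).const_mul _)
          (((intervalIntegrable_eval _ _ _).const_mul _).const_mul _),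
          intervalIntegral.integral_const_mul, intervalIntegral.integral_const_mul,
          intervalIntegral.integral_const_mul, Mesh.integral_point hi]
        linear_combination (rkD s l κ : ℝ) * τ * h3
      have h4 : m.len i / 2 * ∫ ξ in (y j)..(y (j + 1)), ((∑ κ ∈ Finset.range (l + 1),
          ((rkC s l κ : ℝ) • m.toRef (U n κ) + (rkD s l κ : ℝ) • (τ • E) (m.toRef (U n κ)))) i).eval
            ξ = m.len i / 2 * ∫ ξ in (y j)..(y (j + 1)), (m.toRef (U n (l + 1)) i).eval ξ := by
        rw [h1, ← Finset.sum_congr rfl fun κ _ => h2 κ, ← Finset.mul_sum,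
          ← intervalIntegral.integral_finsetSum fun κ _ => intervalIntegrable_eval _ _ _]
        simp only [Finset.sum_apply, eval_finsetSum]
      have h5 := mul_left_cancel₀ (by positivity) h4
      simp only [eval_sub]
      rw [intervalIntegral.integral_sub (intervalIntegrable_eval _ _ _)
        (intervalIntegrable_eval _ _ _)]
      linarith
  · have h0 : ∀ p, m.toRef p i = 0 := fun p => if_neg hi
    have h1 : ∀ v, E v i = 0 := fun v => if_neg hi
    simp only [Finset.sum_apply, Pi.add_apply, Pi.smul_apply, LinearMap.smul_apply, h0, h1]
    simp

/-- One step of the scheme is the truncated exponential of the spatial operator. -/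
lemma IsRKSV.toRef_step (hU : IsRKSV s k bc m y τ M U) (hs : 1 ≤ s) (hy : IsSubdivision kind k y)
    (hR : IsCorrection k y R γ) {n : ℕ} (hn : n < M) :
    m.toRef (U (n + 1) 0) =
      rkStep s (τ • svOp bc N m.len (derivative R)) (m.toRef (U n 0)) := by
  set E := τ • svOp bc N m.len (derivative R) with hE
  have hstage : ∀ l ≤ s, m.toRef (U n l) =
      aeval E ((stagePoly s l).map (algebraMap ℚ ℝ)) (m.toRef (U n 0)) := by
    intro l
    induction l using Nat.strong_induction_on with
    | _ l ih =>
      intro hl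
      rcases l with _ | l
      · rw [stagePoly]; simp
      · rw [hU.toRef_stage hy hR hn (by omega), stagePoly,
          Fin.sum_univ_eq_sum_range (fun κ => (C (rkC s l κ) + C (rkD s l κ) * X) * stagePoly s κ),
          Polynomial.map_sum, map_sum, LinearMap.sum_apply]
        refine Finset.sum_congr rfl fun κ hκ => ?_
        have hκ := Finset.mem_range.1 hκ
        rw [ih κ (by omega) (by omega), ← hE]
        simp [aeval_C, Module.algebraMap_end_apply, Module.End.mul_apply]
  have h1 : m.toRef (U (n + 1) 0) = m.toRef (U n s) := by
    funext i
    by_cases hi : i < N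
    · simp only [Mesh.toRef, hi, if_true, hU.step n hn i hi]
    · simp [Mesh.toRef, hi]
  rw [h1, hstage s le_rfl, stagePoly_eq_expPoly s hs, rkStep, expPoly]
  simp [Polynomial.map_sum, map_sum, LinearMap.sum_apply, Module.algebraMap_end_apply,
    Module.End.mul_apply]

end Scheme

/-! ### Piecewise polynomials on the mesh -/

namespace Mesh

variable {a b : ℝ} {N : ℕ} {m : Mesh a b N}

lemma card_pos (m : Mesh a b N) (hab : a < b) : 0 < N := by
  rcases Nat.eq_zero_or_pos N with rfl | h
  · exact absurd (m.first.symm.trans m.last) hab.ne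
  · exact h

lemma node_mono {i j : ℕ} (hij : i ≤ j) (hj : j ≤ N) : m.node i ≤ m.node j := by
  induction j, hij using Nat.le_induction with
  | base => exact le_rfl
  | succ j _ ih => exact (ih (by omega)).trans (m.lt j (by omega)).le

lemma node_mem {i : ℕ} (hi : i ≤ N) : m.node i ∈ Icc a b := by
  constructor
  · exact m.first.symm.trans_le (node_mono (Nat.zero_le _) hi)
  · exact (node_mono hi le_rfl).trans_eq m.last

lemma sum_len : ∑ i ∈ Finset.range N, m.len i = b - a := by
  simp only [len, Finset.sum_range_sub, m.first, m.last]

lemma len_le_h {i : ℕ} (hi : i < N) : m.len i ≤ m.h :=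
  le_ciSup (f := fun i : Fin N => m.len i) (finite_range _).bddAbove ⟨i, hi⟩

lemma quasiUniform {α : ℝ} (hab : a < b) (hα : 0 < α) (hm : m.Regular α) :
    QuasiUniform N m.len α m.h where
  card_pos := m.card_pos hab
  α_pos := hα
  h_pos := (len_pos (m.card_pos hab)).trans_le (len_le_h (m.card_pos hab))
  le_len i hi := hm.trans (ciInf_le (f := fun i : Fin N => m.len i) (finite_range _).bddBelow ⟨i, hi⟩)
  len_le _ hi := len_le_h hi

lemma exists_mem_Ioc {x : ℝ} (hx : x ∈ Ioc a b) :
    ∃ i < N, x ∈ Ioc (m.node i) (m.node (i + 1)) := by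
  suffices H : ∀ n ≤ N, x ≤ m.node n → ∃ i < n, x ∈ Ioc (m.node i) (m.node (i + 1)) from
    H N le_rfl (by rw [m.last]; exact hx.2)
  intro n
  induction n with
  | zero => intro _ h; rw [m.first] at h; exact absurd hx.1 (not_lt.2 h)
  | succ n ih =>
    intro hn h
    rcases le_or_gt x (m.node n) with h1 | h1
    · obtain ⟨i, hi, h2⟩ := ih (by omega) h1
      exact ⟨i, by omega, h2⟩
    · exact ⟨n, by omega, h1, h⟩

lemma broken_eq (p : ℕ → ℝ[X]) {i : ℕ} (hi : i < N) {x : ℝ}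
    (hx : x ∈ Ioc (m.node i) (m.node (i + 1))) : m.broken p x = (p i).eval x := by
  rw [broken, Finset.sum_eq_single i]
  · rw [indicator_of_mem hx]
  · intro j hj hne
    have hj := Finset.mem_range.1 hj
    refine indicator_of_notMem (fun h => ?_) _
    rcases lt_or_gt_of_ne hne with h1 | h1
    · have := m.node_mono (show j + 1 ≤ i from h1) hi.le
      linarith [h.2, hx.1]
    · have := m.node_mono (show i + 1 ≤ j from h1) hj.le
      linarith [h.1, hx.2]
  · intro h; exact absurd (Finset.mem_range.2 hi) h

lemma broken_sub (p q : ℕ → ℝ[X]) (x : ℝ) :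
    m.broken (fun i => p i - q i) x = m.broken p x - m.broken q x := by
  simp only [broken, ← Finset.sum_sub_distrib]
  refine Finset.sum_congr rfl fun i _ => ?_
  by_cases h : x ∈ Ioc (m.node i) (m.node (i + 1)) <;> simp [h]

lemma measurable_broken (p : ℕ → ℝ[X]) : Measurable (m.broken p) := by
  unfold broken
  exact Finset.measurable_sum _ fun i _ =>
    (Polynomial.continuous (p i)).measurable.indicator measurableSet_Ioc

lemma toRef_sub (p q : ℕ → ℝ[X]) :
    m.toRef (fun i => p i - q i) = m.toRef p - m.toRef q := by
  funext i
  by_cases hi : i < N <;> simp [toRef, hi]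

/-- The piecewise polynomial with given pullbacks to the reference element. -/
noncomputable def ofRef (m : Mesh a b N) (w : ℕ → ℝ[X]) (i : ℕ) : ℝ[X] :=
  (w i).comp (C (2 / m.len i) * (X - C (m.mid i)))

lemma toRef_ofRef {w : ℕ → ℝ[X]} (hw : ∀ i, ¬ i < N → w i = 0) : m.toRef (m.ofRef w) = w := by
  funext i
  by_cases hi : i < N
  · have hl := (m.len_pos hi).ne'
    simp only [toRef, hi, if_true, ofRef, comp_assoc]
    have : (C (2 / m.len i) * (X - C (m.mid i))).comp (C (m.len i / 2) * X + C (m.mid i)) = X := by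
      simp only [mul_comp, sub_comp, C_comp, X_comp, add_sub_cancel_right, ← mul_assoc, ← C_mul]
      rw [show 2 / m.len i * (m.len i / 2) = 1 by field_simp, C_1, one_mul]
    rw [this, comp_X]
  · simp [toRef, hi, hw i hi]

lemma eval_ofRef (w : ℕ → ℝ[X]) (i : ℕ) (x : ℝ) :
    (m.ofRef w i).eval x = (w i).eval (2 / m.len i * (x - m.mid i)) := by
  simp [ofRef, eval_comp]

lemma integral_element {p : ℕ → ℝ[X]} {i : ℕ} (hi : i < N) :
    ∫ x in (m.node i)..(m.node (i + 1)), (p i).eval x * (p i).eval x =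
      m.len i / 2 * refInt (m.toRef p i * m.toRef p i) := by
  simp only [refInt, eval_mul, toRef_eval hi]
  have h := intervalIntegral.mul_integral_comp_mul_add (a := -1) (b := 1)
    (f := fun x => (p i).eval x * (p i).eval x) (m.len i / 2) (m.mid i)
  rw [h]
  congr 1 <;> simp only [len, mid] <;> ring

/-- The `L²` norm of a piecewise polynomial in terms of its pullbacks. -/
lemma l2Norm_broken (hab : a < b) (p : ℕ → ℝ[X]) :
    l2Norm a b (m.broken p) = ENNReal.ofReal
      (Real.sqrt (∑ i ∈ Finset.range N, m.len i / 2 * refInt (m.toRef p i * m.toRef p i))) := by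
  have hEq : ∀ i < N, EqOn (fun x => (p i).eval x * (p i).eval x)
      (fun x => m.broken p x * m.broken p x) (uIoc (m.node i) (m.node (i + 1))) := by
    intro i hi x hx
    rw [uIoc_of_le (m.lt i hi).le] at hx
    simp only [broken_eq p hi hx]
  have hII : ∀ i < N, IntervalIntegrable (fun x => m.broken p x * m.broken p x) volume
      (m.node i) (m.node (i + 1)) := fun i hi => by
    have := intervalIntegrable_eval (p i * p i) (m.node i) (m.node (i + 1))
    simp only [eval_mul] at this
    exact this.congr (hEq i hi)
  have hint : ∫ x in Icc a b, m.broken p x * m.broken p x =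
      ∑ i ∈ Finset.range N, m.len i / 2 * refInt (m.toRef p i * m.toRef p i) := by
    rw [integral_Icc_eq_integral_Ioc, ← intervalIntegral.integral_of_le hab.le]
    have h1 := intervalIntegral.sum_integral_adjacent_intervals (a := m.node) (n := N) hII
    rw [m.first, m.last] at h1
    rw [← h1]
    refine Finset.sum_congr rfl fun i hi => ?_
    have hi := Finset.mem_range.1 hi
    rw [← integral_element hi]
    exact (intervalIntegral.integral_congr_ae (Filter.Eventually.of_forall (hEq i hi))).symm
  have hon : IntegrableOn (fun x => m.broken p x * m.broken p x) (Icc a b) := by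
    rw [integrableOn_Icc_iff_integrableOn_Ioc, ← intervalIntegrable_iff_integrableOn_Ioc_of_le hab.le]
    have := IntervalIntegrable.trans_iterate (a := m.node) (n := N) hII
    rwa [m.first, m.last] at this
  have hmem : MemLp (m.broken p) 2 (volume.restrict (Icc a b)) :=
    (memLp_two_iff_integrable_sq (measurable_broken p).aestronglyMeasurable).2
      (by simpa only [sq] using (show Integrable _ (volume.restrict (Icc a b)) from hon))
  rw [l2Norm, hmem.eLpNorm_eq_integral_rpow_norm (by norm_num) (by norm_num), ← hint,
    Real.sqrt_eq_rpow]
  congr 2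
  · refine integral_congr_ae (Filter.Eventually.of_forall fun x => ?_)
    simp [sq]
  · norm_num

end Mesh

lemma l2Norm_le_of_abs_le {a b c : ℝ} (hab : a < b) {F : ℝ → ℝ} (h : ∀ x ∈ Ioc a b, |F x| ≤ c) :
    l2Norm a b F ≤ ENNReal.ofReal (Real.sqrt (b - a) * c) := by
  have hae : ∀ᵐ x ∂(volume.restrict (Icc a b)), ‖F x‖ ≤ c := by
    rw [← Measure.restrict_congr_set Ioc_ae_eq_Icc]
    exact (ae_restrict_iff' measurableSet_Ioc).2 (Filter.Eventually.of_forall h)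
  refine (eLpNorm_le_of_ae_bound hae).trans (le_of_eq ?_)
  rw [Measure.restrict_apply_univ, Real.volume_Icc, ENNReal.ofReal_mul (Real.sqrt_nonneg _),
    Real.sqrt_eq_rpow, ← ENNReal.ofReal_rpow_of_nonneg (by linarith) (by norm_num)]
  norm_num

/-! ### The error estimate -/

section Error

variable {a b : ℝ} {N : ℕ} {m : Mesh a b N} {k : ℕ} {bc : BC} {γ : ℝ}

/-- The smooth function `x ↦ g (x - t)`, where `g` has bounded derivatives up to `b` and the boundary
values of a solution. -/
lemma Mesh.isProfile {g : ℝ → ℝ} {B t : ℝ} (ht : 0 ≤ t) (hg : ContDiff ℝ ∞ g)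
    (hB : ∀ j ≤ k + 2, ∀ z ≤ b, |iteratedDeriv j g z| ≤ B)
    (hbc : match bc with
      | .inflow => ∀ κ, ∀ z ≤ a, iteratedDeriv κ g z = 0
      | .periodic => ∀ z, g (z + (b - a)) = g z) :
    IsProfile k bc N m.len (fun i => m.mid i - t) g B := by
  have hright : ∀ i, m.mid i - t + m.len i / 2 = m.node (i + 1) - t := fun i => by
    simp only [mid, len]; ring
  have hleft : ∀ i, m.mid i - t - m.len i / 2 = m.node i - t := fun i => by
    simp only [mid, len]; ring
  refine ⟨hg, fun j hj i hi x hx => hB j hj x ?_, fun i hi => ?_⟩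
  · rw [hright] at hx
    have := (m.node_mem (show i + 1 ≤ N from hi)).2
    linarith
  · simp only [hleft, hright]
    rcases Nat.eq_zero_or_pos i with rfl | hi0
    · cases bc with
      | inflow =>
        refine Or.inl ⟨fun v => by simp [upwindTrace], fun κ => hbc κ _ ?_⟩
        have := m.first
        linarith
      | periodic =>
        refine Or.inr ⟨N - 1, by omega, fun v => by simp [upwindTrace], fun κ => ?_⟩
        have h1 : (fun z => g (z + (b - a))) = g := funext hbc
        have h2 := congrFun (iteratedDeriv_comp_add_const κ g (b - a)) (a - t)
        rw [h1] at h2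
        rw [Nat.sub_add_cancel hi, m.last, m.first, h2]
        congr 1
        ring
    · refine Or.inr ⟨i - 1, by omega, fun v => ?_, fun κ => ?_⟩
      · cases bc <;> simp [upwindTrace, hi0.ne']
      · rw [Nat.sub_add_cancel hi0]

lemma energy_le_of_coeffNorm_le (hγ : 0 ≤ γ) {d : ℕ → ℝ[X]} {c : ℝ}
    (hd : ∀ i < N, (d i).natDegree ≤ k) (h : ∀ i < N, coeffNorm k (d i) ≤ c) :
    energy k γ N m.len d d ≤ (b - a) * ((2 + γ) * c ^ 2) := by
  rw [energy, ← m.sum_len, Finset.sum_mul]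
  refine Finset.sum_le_sum fun i hi => ?_
  have hi := Finset.mem_range.1 hi
  have hl := m.len_pos hi
  refine mul_le_mul_of_nonneg_left ((refInner_self_le hγ (hd i hi)).trans ?_) hl.le
  have h1 := coeffNorm_nonneg (k := k) (d i)
  have h2 := h i hi
  gcongr

/-- A discrete Gronwall inequality. -/
lemma discrete_gronwall {E : ℕ → ℝ} {c d : ℝ} (hc : 0 ≤ c) (hd : 0 ≤ d) (h0 : 0 ≤ E 0) {M : ℕ}
    (h : ∀ n < M, E (n + 1) ≤ (1 + c) * E n + d) :
    ∀ n ≤ M, E n ≤ Real.exp (n * c) * (E 0 + n * d) := by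
  intro n
  induction n with
  | zero => intro _; simp
  | succ n ih =>
    intro hn
    have h1 := ih (by omega)
    have h2 : 1 + c ≤ Real.exp c := by linarith [Real.add_one_le_exp c]
    have h3 : Real.exp ((n + 1 : ℕ) * c) = Real.exp (n * c) * Real.exp c := by
      rw [← Real.exp_add]; congr 1; push_cast; ring
    have h4 : 1 ≤ Real.exp ((n + 1 : ℕ) * c) := Real.one_le_exp (by positivity)
    calc E (n + 1) ≤ (1 + c) * E n + d := h n (by omega)
      _ ≤ Real.exp c * (Real.exp (n * c) * (E 0 + n * d)) + Real.exp ((n + 1 : ℕ) * c) * d := by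
          refine add_le_add ?_ (le_mul_of_one_le_left hd h4)
          calc (1 + c) * E n ≤ (1 + c) * (Real.exp (n * c) * (E 0 + n * d)) := by gcongr
            _ ≤ _ := by gcongr
      _ = _ := by rw [h3]; push_cast; ring

/-- Stability and consistency bound the distance of the discrete solution to the interpolant of a
smooth solution, in terms of the initial distance. -/
lemma exists_energy_error {kind : SVKind} {y : ℕ → ℝ} (hy : IsSubdivision kind k y) {R : ℝ[X]}
    (hR : IsCorrection k y R γ) {s : ℕ} (hs : 1 ≤ s) {α T C : ℝ} (hab : a < b) (hα : 0 < α)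
    (hT : 0 < T) (hC : 0 ≤ C) (Λ : ℝ) :
    ∃ K : ℝ, 0 ≤ K ∧ ∀ (bc : BC) (N : ℕ) (m : Mesh a b N), m.Regular α →
      ∀ (M : ℕ) (τ : ℝ), 0 < τ → M * τ = T → 1 ≤ M → τ / m.h ≤ Λ →
      StableStep s k bc R γ N m.len τ C →
      ∀ (g : ℝ → ℝ) (B : ℝ), (∀ t, 0 ≤ t → IsProfile k bc N m.len (fun i => m.mid i - t) g B) →
      ∀ U, IsRKSV s k bc m y τ M U →
      ∀ w : ℕ → ℕ → ℝ[X], (∀ n : ℕ, ∀ i < N,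
        IsNodeInterp k y (pullback (m.mid i - n * τ) (m.len i) g) (w n i)) →
      (∀ n i, ¬ i < N → w n i = 0) → ∀ n ≤ M,
      energy k γ N m.len (w n - m.toRef (U n 0)) (w n - m.toRef (U n 0)) ≤
        K * (energy k γ N m.len (w 0 - m.toRef (U 0 0)) (w 0 - m.toRef (U 0 0)) +
          ((m.h ^ (k + 1) + τ ^ s) * B) ^ 2) := by
  obtain ⟨A, hA, hAp⟩ := exists_truncation_error hy hR hα s Λ
  have hγ := hR.nonneg
  have hr : (derivative R).natDegree ≤ k :=
    (natDegree_derivative_le _).trans (by have := hR.degree; omega)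
  set D : ℝ := (1 + T) * ((b - a) * ((2 + γ) * A ^ 2)) with hD
  have hD0 : 0 ≤ D := by
    have : 0 < b - a := sub_pos.2 hab
    positivity
  refine ⟨Real.exp (T * (1 + C + C * T)) * (1 + T * D), by positivity, ?_⟩
  intro bc N m hm M τ hτ hMτ hM1 hΛ hstab g B hP U hU w hw hw0
  have H := m.quasiUniform hab hα hm
  have hτT : τ ≤ T := by
    rw [← hMτ]
    exact le_mul_of_one_le_left hτ.le (by exact_mod_cast hM1)
  set ε := (m.h ^ (k + 1) + τ ^ s) * B with hε
  have hwmem : ∀ n, w n ∈ degSubmodule k := fun n i => by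
    by_cases hi : i < N
    · exact (hw n i hi).1
    · rw [hw0 n i hi]; simp
  set S := rkStep s (τ • svOp bc N m.len (derivative R)) with hS
  have hSmem : ∀ v ∈ degSubmodule k, S v ∈ degSubmodule k := fun v hv => by
    rw [hS, rkStep_apply]
    exact Submodule.sum_mem _ fun κ _ => Submodule.smul_mem _ _ (smul_svOp_pow_mem hr τ hv κ)
  let e : ℕ → ℕ → ℝ[X] := fun n => w n - m.toRef (U n 0)
  let E : ℕ → ℝ := fun n => energy k γ N m.len (e n) (e n)
  have hE0 : ∀ n, 0 ≤ E n := fun n => energy_self_nonneg hγ H.len_pos _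
  have hstep : ∀ n < M, E (n + 1) ≤ (1 + τ * (1 + C + C * T)) * E n + τ * (D * ε ^ 2) := by
    intro n hn
    let d : ℕ → ℝ[X] := w (n + 1) - S (w n)
    have he : e (n + 1) = S (e n) + d := by
      simp only [e, d]
      rw [hU.toRef_step hs hy hR hn, map_sub, ← hS]
      abel
    have hd : energy k γ N m.len d d ≤ (b - a) * ((2 + γ) * (A * (τ * ε)) ^ 2) := by
      refine energy_le_of_coeffNorm_le hγ
        (fun i _ => (Submodule.sub_mem _ (hwmem _) (hSmem _ (hwmem _)) : d ∈ degSubmodule k) i)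
        fun i hi => ?_
      have h1 := hAp bc N m.len (fun i => m.mid i - n * τ) g B m.h τ (hP _ (by positivity)) H hτ.le
        hΛ (w n) (hwmem n) (hw n) i hi (w (n + 1) i) (by
          have := hw (n + 1) i hi
          rwa [show m.mid i - ((n + 1 : ℕ) : ℝ) * τ = m.mid i - n * τ - τ by push_cast; ring] at this)
      refine h1.trans (le_of_eq ?_)
      rw [hε]; ring
    have hst : energy k γ N m.len (S (e n)) (S (e n)) ≤ (1 + C * τ) * E n :=
      hstab (e n) (Submodule.sub_mem _ (hwmem n) (hU.toRef_mem hn (Nat.zero_le _)))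
    have hsplit := energy_add_self_le (k := k) hγ H.len_pos (S (e n)) d hτ
    rw [← he] at hsplit
    have h1 : (1 + τ) * (1 + C * τ) ≤ 1 + τ * (1 + C + C * T) := by
      have : C * τ * τ ≤ C * τ * T := by gcongr
      linarith
    have h2 : (1 + 1 / τ) * ((b - a) * ((2 + γ) * (A * (τ * ε)) ^ 2)) ≤ τ * (D * ε ^ 2) := by
      have e1 : (1 + 1 / τ) * ((b - a) * ((2 + γ) * (A * (τ * ε)) ^ 2)) =
          τ * ((1 + τ) * ((b - a) * ((2 + γ) * A ^ 2)) * ε ^ 2) := by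
        field_simp
        ring
      have : 0 < b - a := sub_pos.2 hab
      rw [e1, hD]
      gcongr
    calc E (n + 1) ≤ (1 + τ) * energy k γ N m.len (S (e n)) (S (e n))
          + (1 + 1 / τ) * energy k γ N m.len d d := hsplit
      _ ≤ (1 + τ) * ((1 + C * τ) * E n)
          + (1 + 1 / τ) * ((b - a) * ((2 + γ) * (A * (τ * ε)) ^ 2)) := by gcongr
      _ = (1 + τ) * (1 + C * τ) * E n
          + (1 + 1 / τ) * ((b - a) * ((2 + γ) * (A * (τ * ε)) ^ 2)) := by ring
      _ ≤ _ := add_le_add (mul_le_mul_of_nonneg_right h1 (hE0 n)) h2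
  intro n hn
  have h1 := discrete_gronwall (c := τ * (1 + C + C * T)) (by positivity) (by positivity) (hE0 0)
    hstep n hn
  have hnT : n * τ ≤ T := by
    rw [← hMτ]
    have : (n : ℝ) ≤ M := by exact_mod_cast hn
    gcongr
  have h2 : Real.exp (n * (τ * (1 + C + C * T))) ≤ Real.exp (T * (1 + C + C * T)) := by
    rw [← mul_assoc]
    gcongr
  have h3 : (n : ℝ) * (τ * (D * ε ^ 2)) ≤ T * (D * ε ^ 2) := by
    rw [← mul_assoc]
    gcongr
  have h4 := hE0 0
  calc E n ≤ Real.exp (n * (τ * (1 + C + C * T))) * (E 0 + n * (τ * (D * ε ^ 2))) := h1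
    _ ≤ Real.exp (T * (1 + C + C * T)) * (E 0 + T * (D * ε ^ 2)) := by gcongr
    _ ≤ Real.exp (T * (1 + C + C * T)) * ((1 + T * D) * (E 0 + ε ^ 2)) := by
        gcongr
        have h5 : 0 ≤ T * D * E 0 := by positivity
        have h6 : 0 ≤ ε ^ 2 := by positivity
        nlinarith
    _ = _ := by ring

/-- The energy controls the `L²` norm. -/
lemma l2Norm_broken_le_energy (hγ : 0 ≤ γ) (hab : a < b) {p : ℕ → ℝ[X]} {X : ℝ} (hX : 0 ≤ X)
    (h : energy k γ N m.len (m.toRef p) (m.toRef p) ≤ X ^ 2) :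
    l2Norm a b (m.broken p) ≤ ENNReal.ofReal X := by
  rw [m.l2Norm_broken hab]
  refine ENNReal.ofReal_le_ofReal (Real.sqrt_le_iff.2 ⟨hX, le_trans ?_ h⟩)
  refine Finset.sum_le_sum fun i hi => ?_
  have hl := m.len_pos (Finset.mem_range.1 hi)
  have h1 := refInt_mul_self_nonneg (m.toRef p i)
  have h2 : refInt (m.toRef p i * m.toRef p i) ≤ refInner k γ (m.toRef p i) (m.toRef p i) := by
    rw [refInner]
    have := mul_self_nonneg ((m.toRef p i).coeff k)
    have := mul_nonneg hγ this
    linarith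
  have h3 : m.len i / 2 ≤ m.len i := by linarith
  gcongr

/-- The `L²` norm controls the energy of piecewise polynomials of degree at most `k`. -/
lemma exists_energy_le_l2Norm (k : ℕ) (hγ : 0 ≤ γ) :
    ∃ K : ℝ, 0 ≤ K ∧ ∀ (a b : ℝ) (N : ℕ) (m : Mesh a b N), a < b → ∀ (p : ℕ → ℝ[X]) (X : ℝ),
      0 ≤ X → m.toRef p ∈ degSubmodule k → l2Norm a b (m.broken p) ≤ ENNReal.ofReal X →
      energy k γ N m.len (m.toRef p) (m.toRef p) ≤ K * X ^ 2 := by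
  obtain ⟨K, hK, hKp⟩ := exists_coeffNorm_sq_le_refInt k
  refine ⟨(2 + γ) * (2 * K), by positivity, fun a b N m hab p X hX hp h => ?_⟩
  rw [m.l2Norm_broken hab, ENNReal.ofReal_le_ofReal_iff hX, Real.sqrt_le_iff] at h
  refine le_trans ?_ (mul_le_mul_of_nonneg_left h.2 (by positivity))
  rw [energy, Finset.mul_sum]
  refine Finset.sum_le_sum fun i hi => ?_
  have hl := m.len_pos (Finset.mem_range.1 hi)
  have h1 := refInner_self_le hγ (hp i)
  have h2 := hKp _ (hp i)
  calc _ ≤ m.len i * ((2 + γ) * (K * refInt (m.toRef p i * m.toRef p i))) := by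
        gcongr
        refine h1.trans ?_
        gcongr
    _ = _ := by ring

end Error

lemma weakBound_of_solutionNorm_lt {a b T B : ℝ} {m : ℕ} {u : ℝ → ℝ → ℝ}
    (h : solutionNorm a b T m u < ENNReal.ofReal B) :
    ∀ t ∈ Icc 0 T, WeakBound a b m (fun x => u x t) B := fun t ht =>
  WeakBound.of_sobolevNorm_lt ((le_iSup₂
    (f := fun t (_ : t ∈ Icc 0 T) => sobolevNorm a b m (fun x => u x t)) t ht).trans_lt h)

lemma l2Norm_add_le {a b X Y : ℝ} {f g : ℝ → ℝ}
    (hf : AEStronglyMeasurable f (volume.restrict (Icc a b)))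
    (hg : AEStronglyMeasurable g (volume.restrict (Icc a b))) (hX : 0 ≤ X) (hY : 0 ≤ Y)
    (hfX : l2Norm a b f ≤ ENNReal.ofReal X) (hgY : l2Norm a b g ≤ ENNReal.ofReal Y) :
    l2Norm a b (f + g) ≤ ENNReal.ofReal (X + Y) := by
  rw [ENNReal.ofReal_add hX hY]
  exact (eLpNorm_add_le hf hg (by norm_num)).trans (add_le_add hfX hgY)

/-- The error estimate for one bound `B` on the solution. -/
lemma exists_error_estimate_of_lt {kind : SVKind} {k : ℕ} {y : ℕ → ℝ} (hy : IsSubdivision kind k y)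
    {R : ℝ[X]} {γ : ℝ} (hR : IsCorrection k y R γ) {s : ℕ} (hs : 1 ≤ s) {a b α T C : ℝ}
    (hab : a < b) (hα : 0 < α) (hT : 0 < T) (hC : 0 ≤ C) (C₀ Λ : ℝ) :
    ∃ K : ℝ, 0 < K ∧ ∀ (bc : BC) (N : ℕ) (m : Mesh a b N), m.Regular α →
      ∀ (M : ℕ), 0 < M → ∀ τ : ℝ, τ = T / M → τ / m.h ≤ Λ →
      StableStep s k bc R γ N m.len τ C →
      ∀ (u₀ : ℝ → ℝ) (u : ℝ → ℝ → ℝ), IsSolution bc a b T u₀ u →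
      ∀ U : ℕ → ℕ → ℕ → ℝ[X], IsRKSV s k bc m y τ M U →
      (IsInterpolant k m y u₀ (U 0 0) ∨
        l2Norm a b (fun x => u₀ x - m.broken (U 0 0) x) ≤
          ENNReal.ofReal (C₀ * (m.h ^ (k + 1) + τ ^ s)) * solutionNorm a b T (k + 2) u) →
      ∀ B : ℝ, 0 < B → solutionNorm a b T (k + 2) u < ENNReal.ofReal B → ∀ n ≤ M,
      l2Norm a b (fun x => u x (n * τ) - m.broken (U n 0) x) ≤
        ENNReal.ofReal (K * (m.h ^ (k + 1) + τ ^ s)) * ENNReal.ofReal B := by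
  have hγ := hR.nonneg
  obtain ⟨K1, hK1, hK1p⟩ := exists_energy_error hy hR hs hab hα hT hC Λ
  obtain ⟨K2, hK2, hK2p⟩ := exists_interp_error hy
  obtain ⟨K3, hK3, hK3p⟩ := exists_energy_le_l2Norm k hγ
  obtain ⟨K4, hK4, hK4p⟩ := exists_coeffNorm_le_of_nodes hy
  have hba : 0 < b - a := sub_pos.2 hab
  set β := Real.sqrt (b - a) * (1 + K2) with hβ
  have hβ0 : 0 ≤ β := by positivity
  set K5 := (b - a) * ((2 + γ) * K4 ^ 2) + K3 * (β + |C₀|) ^ 2 with hK5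
  have hK50 : 0 ≤ K5 := by positivity
  set Z := Real.sqrt (K1 * (K5 + 1)) with hZ
  have hZ0 : 0 ≤ Z := Real.sqrt_nonneg _
  refine ⟨β + Z + 1, by positivity, ?_⟩
  intro bc N m hm M hM τ hτ hΛ hstab u₀ u hu U hU hinit B hB hnorm
  have H := m.quasiUniform hab hα hm
  have hh := H.h_pos
  have hM' : (0 : ℝ) < M := by exact_mod_cast hM
  have hτ0 : 0 < τ := by rw [hτ]; positivity
  have hMτ : M * τ = T := by rw [hτ]; field_simp
  set ε := m.h ^ (k + 1) + τ ^ s with hε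
  have hε0 : 0 < ε := by positivity
  set ϱ := ε * B with hϱ
  have hϱ0 : 0 < ϱ := by positivity
  have hhϱ : m.h ^ (k + 1) * B ≤ ϱ := by
    rw [hϱ, hε]
    gcongr
    exact le_add_of_nonneg_right (by positivity)
  -- a smooth solution whose distance to `u` is of the order of the error
  obtain ⟨g, hg, hgu, hgB, hgbc⟩ := hu.exists_smooth hab hT (m := k + 2) (by omega) hB.le
    (weakBound_of_solutionNorm_lt hnorm) hϱ0
  have hP : ∀ t, 0 ≤ t → IsProfile k bc N m.len (fun i => m.mid i - t) g B := fun t ht =>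
    m.isProfile ht hg hgB hgbc
  choose w' hw' using fun (n i : ℕ) =>
    exists_isNodeInterp hy (pullback (m.mid i - n * τ) (m.len i) g)
  let w : ℕ → ℕ → ℝ[X] := fun n i => if i < N then w' n i else 0
  have hw : ∀ n : ℕ, ∀ i < N, IsNodeInterp k y (pullback (m.mid i - n * τ) (m.len i) g) (w n i) :=
    fun n i hi => by simp only [w, hi, if_true]; exact hw' n i
  have hw0 : ∀ n i, ¬ i < N → w n i = 0 := fun n i hi => by simp [w, hi]
  have hwmem : ∀ n, w n ∈ degSubmodule k := fun n i => by
    by_cases hi : i < N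
    · exact (hw n i hi).1
    · rw [hw0 n i hi]; simp
  have htime : ∀ n ≤ M, (n : ℝ) * τ ∈ Icc 0 T := fun n hn => ⟨by positivity, by
    rw [← hMτ]
    have : (n : ℝ) ≤ M := by exact_mod_cast hn
    gcongr⟩
  have hpt : ∀ n ≤ M, ∀ x ∈ Ioc a b, |u x (n * τ) - m.broken (m.ofRef (w n)) x| ≤ (1 + K2) * ϱ := by
    intro n hn x hx
    obtain ⟨i, hi, hxi⟩ := m.exists_mem_Ioc hx
    have hl := m.len_pos hi
    rw [m.broken_eq _ hi hxi, Mesh.eval_ofRef]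
    set ξ := 2 / m.len i * (x - m.mid i) with hξ
    have hξmem : ξ ∈ Icc (-1 : ℝ) 1 := by
      have e : 2 / m.len i * (x - m.mid i) = 2 * (x - m.mid i) / m.len i := by ring
      rw [hξ, e]
      constructor
      · rw [le_div_iff₀ hl]
        simp only [Mesh.mid, Mesh.len]
        linarith [hxi.1]
      · rw [div_le_iff₀ hl]
        simp only [Mesh.mid, Mesh.len]
        linarith [hxi.2]
    have h1 := hK2p bc N m.len (fun i => m.mid i - n * τ) g B α m.h (hP _ (htime n hn).1) H i hi
      (w n i) (hw n i hi) ξ hξmem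
    have h2 : pullback (m.mid i - n * τ) (m.len i) g ξ = g (x - n * τ) := by
      rw [pullback, hξ]
      congr 1
      field_simp
      ring
    rw [h2] at h1
    have h3 := hgu x (Ioc_subset_Icc_self hx) _ (htime n hn)
    have h4 : K2 * m.h ^ (k + 1) * B ≤ K2 * ϱ := by
      rw [mul_assoc]
      gcongr
    rw [abs_le] at h1 h3 ⊢
    constructor <;> linarith [h1.1, h1.2, h3.1, h3.2]
  have hcont : ∀ n ≤ M, AEStronglyMeasurable (fun x => u x (n * τ)) (volume.restrict (Icc a b)) :=
    fun n hn => (hu.continuousOn_left (htime n hn)).aestronglyMeasurable measurableSet_Icc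
  have hbr : ∀ p, AEStronglyMeasurable (m.broken p) (volume.restrict (Icc a b)) := fun p =>
    (m.measurable_broken p).aestronglyMeasurable
  let e : ℕ → ℕ → ℝ[X] := fun n i => m.ofRef (w n) i - U n 0 i
  have heref : ∀ n, m.toRef (e n) = w n - m.toRef (U n 0) := fun n => by
    simp only [e]
    rw [m.toRef_sub, m.toRef_ofRef (hw0 n)]
  have hlw : ∀ n ≤ M, l2Norm a b (fun x => u x (n * τ) - m.broken (m.ofRef (w n)) x) ≤
      ENNReal.ofReal (β * ϱ) := fun n hn => by
    rw [hβ, mul_assoc]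
    exact l2Norm_le_of_abs_le hab (hpt n hn)
  have hinit' : energy k γ N m.len (w 0 - m.toRef (U 0 0)) (w 0 - m.toRef (U 0 0)) ≤ K5 * ϱ ^ 2 := by
    have hdeg : w 0 - m.toRef (U 0 0) ∈ degSubmodule k :=
      Submodule.sub_mem _ (hwmem 0) (hU.toRef_mem hM (Nat.zero_le _))
    rcases hinit with hI | hI
    · have h1 : energy k γ N m.len (w 0 - m.toRef (U 0 0)) (w 0 - m.toRef (U 0 0)) ≤
          (b - a) * ((2 + γ) * (K4 * ϱ) ^ 2) := by
        refine energy_le_of_coeffNorm_le hγ (fun i _ => hdeg i) fun i hi => ?_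
        refine hK4p _ _ (hdeg i) fun j hj1 hj2 => ?_
        have hmem : m.point y i j ∈ Icc a b := by
          have h2 := hy.mem_Icc hj2
          have hl := m.len_pos hi
          have h3 := m.node_mem hi.le
          have h4 := m.node_mem (show i + 1 ≤ N from hi)
          have h5 : m.len i / 2 * y j ≤ m.len i / 2 * 1 := by
            have := h2.2; gcongr
          have h6 : m.len i / 2 * -1 ≤ m.len i / 2 * y j := by
            have := h2.1; gcongr
          simp only [Mesh.point, Mesh.len] at h5 h6 ⊢
          constructor <;> linarith [h3.1, h3.2, h4.1, h4.2]
        have h3 := hgu _ hmem 0 ⟨le_rfl, hT.le⟩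
        have h4 := (hw 0 i hi).2 j hj1 hj2
        have h5 := (hI i hi).2 j hj1 hj2
        rw [Pi.sub_apply, eval_sub, h4, m.toRef_eval hi]
        have e1 : m.len i / 2 * y j + m.mid i = m.point y i j := rfl
        rw [e1, h5, ← hu.init _ hmem]
        refine le_trans (le_of_eq ?_) h3
        rw [pullback, ← e1]
        congr 3
        push_cast
        ring
      refine h1.trans ?_
      rw [hK5, add_mul]
      have h2 : 0 ≤ K3 * (β + |C₀|) ^ 2 * ϱ ^ 2 := by positivity
      linarith [show (b - a) * ((2 + γ) * (K4 * ϱ) ^ 2) = (b - a) * ((2 + γ) * K4 ^ 2) * ϱ ^ 2 by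
        ring]
    · have h1 : l2Norm a b (fun x => u₀ x - m.broken (U 0 0) x) ≤ ENNReal.ofReal (|C₀| * ϱ) := by
        refine hI.trans ?_
        rw [show |C₀| * ϱ = |C₀| * ε * B by rw [hϱ]; ring,
          ENNReal.ofReal_mul (p := |C₀| * ε) (by positivity)]
        refine mul_le_mul' (ENNReal.ofReal_le_ofReal ?_) hnorm.le
        gcongr
        exact le_abs_self _
      have hu0 : ∀ x ∈ Icc a b, u x ((0 : ℕ) * τ) = u₀ x := fun x hx => by
        rw [Nat.cast_zero, zero_mul, hu.init x hx]
      have hm0 : AEStronglyMeasurable u₀ (volume.restrict (Icc a b)) :=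
        (hcont 0 (Nat.zero_le _)).congr ((ae_restrict_iff' measurableSet_Icc).2
          (Filter.Eventually.of_forall hu0))
      have h2 : l2Norm a b (fun x => m.broken (m.ofRef (w 0)) x - u₀ x) ≤ ENNReal.ofReal (β * ϱ) := by
        rw [hβ, mul_assoc]
        refine l2Norm_le_of_abs_le hab fun x hx => ?_
        rw [← hu0 x (Ioc_subset_Icc_self hx), abs_sub_comm]
        exact hpt 0 (Nat.zero_le _) x hx
      have h3 := l2Norm_add_le ((hbr _).sub hm0) (hm0.sub (hbr _)) (by positivity) (by positivity)
        h2 h1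
      have h4 : (fun x => m.broken (m.ofRef (w 0)) x - u₀ x) +
          (fun x => u₀ x - m.broken (U 0 0) x) = m.broken (e 0) := by
        funext x
        rw [Pi.add_apply, m.broken_sub]
        ring
      have h5 : l2Norm a b (m.broken (e 0)) ≤ ENNReal.ofReal (β * ϱ + |C₀| * ϱ) := by
        rw [← h4]; exact h3
      have h6 := hK3p a b N m hab (e 0) _ (by positivity) (by rw [heref]; exact hdeg) h5
      rw [heref] at h6
      refine h6.trans ?_
      rw [hK5, add_mul]
      have h7 : 0 ≤ (b - a) * ((2 + γ) * K4 ^ 2) * ϱ ^ 2 := by positivity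
      linarith [show K3 * (β * ϱ + |C₀| * ϱ) ^ 2 = K3 * (β + |C₀|) ^ 2 * ϱ ^ 2 by ring]
  intro n hn
  have hen := hK1p bc N m hm M τ hτ0 hMτ hM hΛ hstab g B hP U hU w hw hw0 n hn
  rw [← heref n] at hen
  have hen2 : energy k γ N m.len (m.toRef (e n)) (m.toRef (e n)) ≤ (Z * ϱ) ^ 2 := by
    refine hen.trans ?_
    rw [← hε, ← hϱ, mul_pow Z ϱ, hZ, Real.sq_sqrt (by positivity)]
    calc _ ≤ K1 * (K5 * ϱ ^ 2 + ϱ ^ 2) := by gcongr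
      _ = _ := by ring
  have h1 := l2Norm_broken_le_energy hγ hab (by positivity) hen2
  have h2 := l2Norm_add_le ((hcont n hn).sub (hbr (m.ofRef (w n)))) (hbr (e n)) (by positivity)
    (by positivity) (hlw n hn) h1
  have h3 : (fun x => u x (n * τ) - m.broken (m.ofRef (w n)) x) + m.broken (e n) =
      fun x => u x (n * τ) - m.broken (U n 0) x := by
    funext x
    rw [Pi.add_apply, m.broken_sub]
    ring
  have h4 : l2Norm a b (fun x => u x (n * τ) - m.broken (U n 0) x) ≤
      ENNReal.ofReal (β * ϱ + Z * ϱ) := by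
    rw [← h3]; exact h2
  rw [← ENNReal.ofReal_mul (by positivity)]
  refine h4.trans (ENNReal.ofReal_le_ofReal ?_)
  rw [show (β + Z + 1) * ε * B = (β + Z + 1) * ϱ by rw [hϱ]; ring]
  linarith

/-- Stability of the steps implies the optimal error estimate. -/
lemma exists_optimalEstimate {kind : SVKind} {k : ℕ} {y : ℕ → ℝ} (hy : IsSubdivision kind k y)
    {R : ℝ[X]} {γ : ℝ} (hR : IsCorrection k y R γ) {s : ℕ} (hs : 1 ≤ s) (bc : BC) {a b α T C : ℝ}
    (hab : a < b) (hα : 0 < α) (hT : 0 < T) (hC : 0 ≤ C) (C₀ Λ : ℝ) {cfl : ℝ → ℝ → Prop}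
    (hcfl : ∀ (N : ℕ) (m : Mesh a b N), m.Regular α → ∀ τ, 0 ≤ τ → τ ≤ T → cfl τ m.h →
      τ / m.h ≤ Λ ∧ StableStep s k bc R γ N m.len τ C) :
    ∃ K : ℝ, 0 < K ∧ OptimalEstimate s k bc y α a b T C₀ K cfl := by
  obtain ⟨K, hK, hKp⟩ := exists_error_estimate_of_lt hy hR hs hab hα hT hC C₀ Λ
  refine ⟨K, hK, fun N m hm M hM τ hτ hc u₀ u hu U hU hinit n hn => ?_⟩
  have hM1 : (1 : ℝ) ≤ M := by exact_mod_cast hM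
  have hτ0 : 0 < τ := by rw [hτ]; positivity
  obtain ⟨h1, h2⟩ := hcfl N m hm τ hτ0.le (by rw [hτ]; exact div_le_self hT.le hM1) hc
  have hh := (m.quasiUniform hab hα hm).h_pos
  have hc0 : ENNReal.ofReal (K * (m.h ^ (k + 1) + τ ^ s)) ≠ 0 := by
    rw [Ne, ENNReal.ofReal_eq_zero, not_le]
    positivity
  rw [← ENNReal.div_le_iff' hc0 ENNReal.ofReal_ne_top]
  refine le_of_forall_gt_imp_ge_of_dense fun B hB => ?_
  rcases eq_or_ne B ∞ with rfl | hBtop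
  · exact le_top
  have hB0 : 0 < B.toReal := ENNReal.toReal_pos (ne_bot_of_gt hB) hBtop
  have h3 := hKp bc N m hm M hM τ hτ h1 h2 u₀ u hu U hU hinit B.toReal hB0
    (by rwa [ENNReal.ofReal_toReal hBtop]) n hn
  rw [ENNReal.ofReal_toReal hBtop] at h3
  exact (ENNReal.div_le_iff' hc0 ENNReal.ofReal_ne_top).2 h3

end RKSV

theorem mainTheorem2 (s k : ℕ) (hs : 1 ≤ s) (hk : 1 ≤ k) (kind : RKSV.SVKind) (y : ℕ → ℝ)
    (hy : RKSV.IsSubdivision kind k y) (bc : RKSV.BC) (α : ℝ) (hα : 0 < α) :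
    (RKSV.terminationValue s < 0 → RKSV.contributionIndex s = RKSV.terminationIndex s →
      ∃ lam₀ : ℝ, 0 < lam₀ ∧ ∀ a b T C₀ : ℝ, a < b → 0 < T →
        ∃ C : ℝ, 0 < C ∧ RKSV.OptimalEstimate s k bc y α a b T C₀ C
          (fun τ h => τ ≤ lam₀ * h)) ∧
    (RKSV.terminationValue s < 0 → RKSV.contributionIndex s < RKSV.terminationIndex s →
      ∀ a b T C₀ K : ℝ, a < b → 0 < T →
        ∃ C : ℝ, 0 < C ∧ RKSV.OptimalEstimate s k bc y α a b T C₀ C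
          (fun τ h => (τ / h) ^ (2 * RKSV.contributionIndex s + 1) ≤ K * τ)) ∧
    (0 < RKSV.terminationValue s →
      ∀ a b T C₀ K : ℝ, a < b → 0 < T →
        ∃ C : ℝ, 0 < C ∧ RKSV.OptimalEstimate s k bc y α a b T C₀ C
          (fun τ h => (τ / h) ^
            (min (2 * RKSV.terminationIndex s) (2 * RKSV.contributionIndex s + 1)) ≤ K * τ)) := by
  obtain ⟨R, γ, hR⟩ := RKSV.exists_isCorrection hk hy
  refine ⟨fun hneg hρ => ?_, fun hneg _ a b T C₀ K hab hT => ?_, fun _ a b T C₀ K hab hT => ?_⟩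
  · obtain ⟨lam, hlam, h⟩ := RKSV.exists_stableStep_of_neg s hs hk hα hR hy.right hneg hρ
    refine ⟨lam, hlam, fun a b T C₀ hab hT => ?_⟩
    refine RKSV.exists_optimalEstimate hy hR hs bc hab hα hT le_rfl C₀ lam
      fun N m hm τ hτ _ hc => ?_
    have H := m.quasiUniform hab hα hm
    have h1 : τ / m.h ≤ lam := (div_le_iff₀ H.h_pos).2 hc
    exact ⟨h1, h bc N m.len m.h τ H hτ h1⟩
  · obtain ⟨lam, C, _, hC, h⟩ := RKSV.exists_stableStep_of_pow s hs hk hα hR hy.right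
      (2 * RKSV.contributionIndex s + 1) (by omega) le_rfl (Or.inl hneg) T K hT
    exact RKSV.exists_optimalEstimate hy hR hs bc hab hα hT hC C₀ lam
      fun N m hm τ hτ hτT hc => h bc N m.len m.h τ (m.quasiUniform hab hα hm) hτ hτT hc
  · have hζ := (RKSV.terminationIndex_spec s hs).1
    obtain ⟨lam, C, _, hC, h⟩ := RKSV.exists_stableStep_of_pow s hs hk hα hR hy.right
      (min (2 * RKSV.terminationIndex s) (2 * RKSV.contributionIndex s + 1))
      (le_min (by omega) (by omega)) (min_le_right _ _) (Or.inr (min_le_left _ _)) T K hT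
    exact RKSV.exists_optimalEstimate hy hR hs bc hab hα hT hC C₀ lam
      fun N m hm τ hτ hτT hc => h bc N m.len m.h τ (m.quasiUniform hab hα hm) hτ hτT hc
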